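/- **Proposition 2.2.** Let $G$ be a finite graph (loops and multiple edges are allowed), regarded as a topological space in the usual way, let $\Lambda$ be a set of subgraphs of $G$, and let $m$ be a positive integer. A *plane generic immersion* of $G$ is a continuous map $f:G\to\mathbb{R}^2$ that is a smooth regular curve on each closed edge and whose multiple points are only finitely many transversal double points between edges (so images of vertices are not multiple points). Such double points are called *crossings*; they may be crossings of an edge with itself. For a subgraph $H$ of $G$, let $c(f(H))$ denote the number of crossings of the restriction $f|_H$. The following conditions (A) and (B) are equivalent. (A) For any plane generic immersions $f$ and $g$ of $G$, $$\sum_{\lambda\in\Lambda}c(f(\lambda))\equiv\sum_{\lambda\in\Lambda}c(g(\lambda))\pmod m.$$ (B) All of the following conditions hold. 1. For every edge $e$ of $G$, the number of elements of $\Lambda$ containing $e$ is a multiple of $m$. 2. For every pair of distinct edges $d$ and $e$ of $G$, twice the number of elements of $\Lambda$ containing both $d$ and $e$ is a multiple of $m$. 3. For every vertex $v$ and every edge $e$ of $G$, $$\sum_{i=1}^{k}\left|\{\lambda\in\Lambda\mid\lambda\supset e\cup e_i\}\right|\equiv 0\pmod m,$$ where $e_1,\dots,e_k$ are the edges of $G$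 incident to $v$, a loop at $v$ being listed twice (once for each of its two ends); $e$ itself may be one of the $e_i$. 4. For every pair of distinct edges $d$ and $e$ of $G$ that are adjacent (that is, share an end vertex), the number of elements of $\Lambda$ containing both $d$ and $e$ is a multiple of $m$. -/

import Mathlib

namespace PlaneGraph

open Set
open scoped ContDiff

/-- The plane `ℝ²`. -/
abbrev Plane : Type := EuclideanSpace ℝ (Fin 2)

/-- The points of a multigraph `H` regarded as a topological space: its vertices `Sum.inl v`, and
the points `Sum.inr (e, t)` with `0 < t < 1` of its open edges, where every edge `e` is
parametrized by the unit interval. Each point of the space occurs exactly once. For a subgraph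
`H ≤ G` this is a subset of the points of `G`. -/
def pointSet {α β : Type*} (H : Graph α β) : Set (α ⊕ β × ℝ) :=
  {p | (∃ v ∈ H.vertexSet, p = Sum.inl v) ∨
    (∃ e ∈ H.edgeSet, ∃ t ∈ Ioo (0 : ℝ) 1, p = Sum.inr (e, t))}

/-- The map on points given by the images of the vertices and by the parametrized images of the
edges. -/
def pointMap {α β : Type*} (vert : α → Plane) (edge : β → ℝ → Plane) : α ⊕ β × ℝ → Plane :=
  Sum.elim vert fun p => edge p.1 p.2

/-- The multiple points, in the plane, of the restriction to `H` of the map given by `vert` and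
`edge`: the points with at least two preimages in `H`. -/
def multiplePoints {α β : Type*} (vert : α → Plane) (edge : β → ℝ → Plane) (H : Graph α β) :
    Set Plane :=
  {q | ∃ p ∈ pointSet H, ∃ p' ∈ pointSet H,
    p ≠ p' ∧ pointMap vert edge p = q ∧ pointMap vert edge p' = q}

/-- A plane generic immersion of a multigraph `G` (loops and multiple edges are allowed): a
continuous map of the space `G` into the plane which is a smooth regular curve on every closed
edge, and whose multiple points are only finitely many transversal double points between (open)
edges. Local injectivity at the vertices follows from these conditions. The values of `vert` and
`edge` outside the graph, and of `edge e` outside `[0, 1]`, play no role. -/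
structure GenericImmersion {α β : Type*} (G : Graph α β) where
  /-- the images of the vertices -/
  vert : α → Plane
  /-- the parametrized images of the edges -/
  edge : β → ℝ → Plane
  /-- the ends of an edge are mapped to the images of its end vertices -/
  ends : ∀ e ∈ G.edgeSet, ∃ x y, G.IsLink e x y ∧ edge e 0 = vert x ∧ edge e 1 = vert y
  smooth : ∀ e ∈ G.edgeSet, ContDiffOn ℝ ∞ (edge e) (Icc 0 1)
  regular : ∀ e ∈ G.edgeSet, ∀ t ∈ Icc (0 : ℝ) 1, derivWithin (edge e) (Icc 0 1) t ≠ 0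
  /-- there are only finitely many multiple points -/
  finite_multiplePoints : (multiplePoints vert edge G).Finite
  /-- no point of the plane has three preimages -/
  double : ∀ p ∈ pointSet G, ∀ p' ∈ pointSet G, ∀ p'' ∈ pointSet G,
    pointMap vert edge p = pointMap vert edge p' → pointMap vert edge p' = pointMap vert edge p'' →
      p = p' ∨ p' = p'' ∨ p = p''
  /-- the image of a vertex is not a multiple point -/
  vertex_simple : ∀ v ∈ G.vertexSet, ∀ p ∈ pointSet G,
    pointMap vert edge p = vert v → p = Sum.inl v
  /-- the two branches through a double point are transversal -/
  transversal : ∀ d ∈ G.edgeSet, ∀ e ∈ G.edgeSet, ∀ s ∈ Ioo (0 : ℝ) 1, ∀ t ∈ Ioo (0 : ℝ) 1,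
    (d, s) ≠ (e, t) → edge d s = edge e t →
      LinearIndependent ℝ ![deriv (edge d) s, deriv (edge e) t]

/-- `c(f(H))`: the number of crossings of the restriction of `f` to the subgraph `H`. -/
noncomputable def GenericImmersion.crossingNumber {α β : Type*} {G : Graph α β}
    (f : GenericImmersion G) (H : Graph α β) : ℕ :=
  (multiplePoints f.vert f.edge H).ncard

/-- The number of elements of `Λ` containing both the edge `d` and the edge `e`. -/
noncomputable def countContaining {α β : Type*} (Λ : Finset (Graph α β)) (d e : β) : ℕ :=
  {H : Graph α β | H ∈ Λ ∧ d ∈ H.edgeSet ∧ e ∈ H.edgeSet}.ncard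

open Classical in
/-- The number of ends of the edge `e` at the vertex `v`: two for a loop at `v`, one for any other
edge incident to `v`, and zero for an edge that is not incident to `v`. -/
noncomputable def endsAt {α β : Type*} (G : Graph α β) (v : α) (e : β) : ℕ :=
  if G.IsLoopAt e v then 2 else if G.Inc e v then 1 else 0

/-- Two distinct edges are adjacent if they share an end vertex. -/
def AdjacentEdges {α β : Type*} (G : Graph α β) (d e : β) : Prop :=
  d ≠ e ∧ ∃ v, G.Inc d v ∧ G.Inc e v

end PlaneGraph

/-! Write n(d,e) for the number of members of Λ containing both d and e, and c(d,e) for the number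
of crossings between d and e. Each double point belongs to exactly one unordered pair of edges, so
the sum in (A) is the sum of n(d,e) c(d,e) over unordered pairs, d = e included
(`sum_crossingNumber`). The question is how the numbers c(d,e) can vary together.

(B) implies (A). For edges γ, δ without a common end, the crossings are the zeros of γ(s) - δ(t) in
the unit square. Transversality makes these zeros nondegenerate, so their number has the parity of
the winding number along the boundary. That winding number is a signed sum of the variations of the
argument of each edge, seen from the ends of the other one (`curves_parity`). Passing from g to f,
the variation of e seen from a vertex u changes by 2πi φ(e,u) with φ(e,u) an integer, up to terms θ
that are symmetric in pairs of vertices and cancel in the signed sum. Hence c(d,e) changes modulo 2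
by the sum of φ(d,·) over the ends of e and of φ(e,·) over the ends of d. Since 2n(d,e) = 0 modulo m
for d ≠ e, and n(d,e) = 0 modulo m for equal or adjacent edges, the total change is the sum over e
and u of φ(e,u) times the sum in condition 3 (`sum_crossingNumber_sub`).

(A) implies (B). Each condition is detected by two immersions. A small kink on e adds one
self-crossing, giving condition 1 (`exists_kink`). Replacing one crossing of d and e by three gives
condition 2 (`exists_swerve`). Interchanging two neighbouring ends at a vertex adds one crossing of
d and e, giving condition 4 (`exists_twist`). For v not on e, two drawings that differ only in
whether e winds once around v have φ = 1 at (e,v) and 0 elsewhere, so the difference formula gives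
condition 3; for v on e it follows from conditions 1 and 4.

The immersions come from explicit drawings that are straight near the vertices. A small polynomial
perturbation of the middle parts of the edges makes them generic, by an affine form of parametric
transversality (`ae_surjective_fderiv`). -/

namespace PlaneGraph

open Set Filter Topology MeasureTheory
open scoped ContDiff

/-! ### Continuous logarithms and their variation along curves -/

/-- A continuous nowhere vanishing function on a rectangle has a continuous logarithm. -/
theorem exists_log_rect {a b c d : ℝ} (hab : a ≤ b) (hcd : c ≤ d) {F : ℝ × ℝ → ℂ}
    (hF : ContinuousOn F (Icc a b ×ˢ Icc c d)) (h0 : ∀ p ∈ Icc a b ×ˢ Icc c d, F p ≠ 0) :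
    ∃ L : ℝ × ℝ → ℂ, ContinuousOn L (Icc a b ×ˢ Icc c d) ∧
      ∀ p ∈ Icc a b ×ˢ Icc c d, Complex.exp (L p) = F p := by
  -- Retracting the plane onto the rectangle extends `F` to a nowhere vanishing function on a simply
  -- connected open set.
  set π : ℝ × ℝ → ℝ × ℝ := fun p => (projIcc a b hab p.1, projIcc c d hcd p.2) with hπ
  have hmem : ∀ p, π p ∈ Icc a b ×ˢ Icc c d := fun p =>
    ⟨(projIcc a b hab p.1).2, (projIcc c d hcd p.2).2⟩
  have hid : ∀ p ∈ Icc a b ×ˢ Icc c d, π p = p := by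
    rintro ⟨x, y⟩ ⟨hx, hy⟩
    simp only [hπ]
    rw [projIcc_of_mem hab hx, projIcc_of_mem hcd hy]
  have hπc : Continuous π := by
    refine Continuous.prodMk ?_ ?_
    · exact continuous_subtype_val.comp (continuous_projIcc.comp continuous_fst)
    · exact continuous_subtype_val.comp (continuous_projIcc.comp continuous_snd)
  have hsc : IsSimplyConnected (univ : Set (ℝ × ℝ)) := by
    have : ContractibleSpace (univ : Set (ℝ × ℝ)) :=
      (Homeomorph.Set.univ (ℝ × ℝ)).contractibleSpace
    exact SimplyConnectedSpace.ofContractible _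
  obtain ⟨L, hL, hL'⟩ := Complex.exists_continuousOn_eqOn_exp_comp hsc isOpen_univ
    (g := F ∘ π) (hF.comp_continuous hπc hmem).continuousOn (by
      rintro ⟨p, -, hp⟩
      exact h0 _ (hmem p) hp)
  refine ⟨L, hL.mono (subset_univ _), fun p hp => ?_⟩
  have := hL' (mem_univ p)
  simpa [hid p hp] using this

theorem exists_log_Icc {a b : ℝ} (hab : a ≤ b) {γ : ℝ → ℂ} (hγ : ContinuousOn γ (Icc a b))
    (h0 : ∀ t ∈ Icc a b, γ t ≠ 0) :
    ∃ l : ℝ → ℂ, ContinuousOn l (Icc a b) ∧ ∀ t ∈ Icc a b, Complex.exp (l t) = γ t := by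
  obtain ⟨L, hL, hL'⟩ := exists_log_rect hab (le_refl (0 : ℝ)) (F := fun p => γ p.1)
    (hγ.comp continuousOn_fst fun p hp => hp.1) (fun p hp => h0 _ hp.1)
  refine ⟨fun t => L (t, 0), hL.comp (by fun_prop) fun t ht => ⟨ht, by simp⟩,
    fun t ht => hL' (t, 0) ⟨ht, by simp⟩⟩

open Classical in
/-- The total variation of a continuous logarithm of `γ` along `[a, b]`. -/
noncomputable def logVar (γ : ℝ → ℂ) (a b : ℝ) : ℂ :=
  if h : ∃ l : ℝ → ℂ, ContinuousOn l (Icc a b) ∧ ∀ t ∈ Icc a b, Complex.exp (l t) = γ t then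
    h.choose b - h.choose a else 0

/-- Two continuous logarithms differ by a continuous function with values in 2πiℤ, which is constant
on an interval. This makes the choice in `logVar` irrelevant, and explicit logarithms can be used
throughout. -/
theorem logVar_eq {γ l : ℝ → ℂ} {a b : ℝ} (hab : a ≤ b) (hl : ContinuousOn l (Icc a b))
    (he : ∀ t ∈ Icc a b, Complex.exp (l t) = γ t) : logVar γ a b = l b - l a := by
  have h : ∃ l : ℝ → ℂ, ContinuousOn l (Icc a b) ∧ ∀ t ∈ Icc a b, Complex.exp (l t) = γ t :=
    ⟨l, hl, he⟩
  rw [logVar, dif_pos h]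
  obtain ⟨hl', he'⟩ := h.choose_spec
  set l' := h.choose
  -- the difference of two logarithms is locally constant
  have key : ∀ t ∈ Icc a b, ∃ n : ℤ, l' t - l t = n * (2 * Real.pi * Complex.I) := fun t ht =>
    Complex.exp_eq_one_iff.1 (by rw [Complex.exp_sub, he' t ht, he t ht, div_self]
                                 rw [← he t ht]; exact Complex.exp_ne_zero _)
  have hpi : (2 * Real.pi * Complex.I : ℂ) ≠ 0 := by
    simp [Real.pi_ne_zero]
  have hc : ContinuousOn (fun t => ((l' t - l t) / (2 * Real.pi * Complex.I)).re) (Icc a b) :=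
    Complex.continuous_re.comp_continuousOn ((hl'.sub hl).div_const _)
  have hval : ∀ t ∈ Icc a b, ∃ n : ℤ, ((l' t - l t) / (2 * Real.pi * Complex.I)).re = n ∧
      l' t - l t = n * (2 * Real.pi * Complex.I) := by
    intro t ht
    obtain ⟨n, hn⟩ := key t ht
    exact ⟨n, by rw [hn, mul_div_assoc, div_self hpi]; simp, hn⟩
  have hconst : ((l' a - l a) / (2 * Real.pi * Complex.I)).re =
      ((l' b - l b) / (2 * Real.pi * Complex.I)).re := by
    refine isPreconnected_Icc.constant_of_mapsTo (T := range ((↑) : ℤ → ℝ))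
      ⟨Int.isClosedEmbedding_coe_real.isEmbedding.toHomeomorph.discreteTopology⟩ hc ?_
      (left_mem_Icc.2 hab) (right_mem_Icc.2 hab)
    intro t ht
    obtain ⟨n, hn, -⟩ := hval t ht
    exact ⟨n, hn.symm⟩
  obtain ⟨n, hn, hn'⟩ := hval a (left_mem_Icc.2 hab)
  obtain ⟨k, hk, hk'⟩ := hval b (right_mem_Icc.2 hab)
  have : n = k := by
    have : (n : ℝ) = k := by rw [← hn, ← hk, hconst]
    exact_mod_cast this
  subst this
  linear_combination hk' - hn'

theorem exp_logVar {γ : ℝ → ℂ} {a b : ℝ} (hab : a ≤ b) (hγ : ContinuousOn γ (Icc a b))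
    (h0 : ∀ t ∈ Icc a b, γ t ≠ 0) : Complex.exp (logVar γ a b) = γ b / γ a := by
  obtain ⟨l, hl, he⟩ := exists_log_Icc hab hγ h0
  rw [logVar_eq hab hl he, Complex.exp_sub, he _ (right_mem_Icc.2 hab), he _ (left_mem_Icc.2 hab)]

theorem logVar_add {γ : ℝ → ℂ} {a b c : ℝ} (hab : a ≤ b) (hbc : b ≤ c)
    (hγ : ContinuousOn γ (Icc a c)) (h0 : ∀ t ∈ Icc a c, γ t ≠ 0) :
    logVar γ a b + logVar γ b c = logVar γ a c := by
  obtain ⟨l, hl, he⟩ := exists_log_Icc (hab.trans hbc) hγ h0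
  have h1 : Icc a b ⊆ Icc a c := Icc_subset_Icc le_rfl hbc
  have h2 : Icc b c ⊆ Icc a c := Icc_subset_Icc hab le_rfl
  rw [logVar_eq (hab.trans hbc) hl he, logVar_eq hab (hl.mono h1) fun t ht => he t (h1 ht),
    logVar_eq hbc (hl.mono h2) fun t ht => he t (h2 ht)]
  ring

theorem logVar_mul {γ δ : ℝ → ℂ} {a b : ℝ} (hab : a ≤ b)
    (hγ : ContinuousOn γ (Icc a b)) (h0 : ∀ t ∈ Icc a b, γ t ≠ 0)
    (hδ : ContinuousOn δ (Icc a b)) (h0' : ∀ t ∈ Icc a b, δ t ≠ 0) :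
    logVar (fun t => γ t * δ t) a b = logVar γ a b + logVar δ a b := by
  obtain ⟨l, hl, he⟩ := exists_log_Icc hab hγ h0
  obtain ⟨k, hk, he'⟩ := exists_log_Icc hab hδ h0'
  rw [logVar_eq hab hl he, logVar_eq hab hk he',
    logVar_eq (l := fun t => l t + k t) hab (hl.add hk) fun t ht => by
      rw [Complex.exp_add, he t ht, he' t ht]]
  ring

theorem logVar_congr {γ δ : ℝ → ℂ} {a b : ℝ} (hab : a ≤ b) (hγ : ContinuousOn γ (Icc a b))
    (h0 : ∀ t ∈ Icc a b, γ t ≠ 0) (h : ∀ t ∈ Icc a b, δ t = γ t) :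
    logVar δ a b = logVar γ a b := by
  obtain ⟨l, hl, he⟩ := exists_log_Icc hab hγ h0
  rw [logVar_eq hab hl he, logVar_eq hab hl fun t ht => (he t ht).trans (h t ht).symm]

theorem logVar_const {a b : ℝ} (hab : a ≤ b) {z : ℂ} (hz : z ≠ 0) :
    logVar (fun _ => z) a b = 0 := by
  rw [logVar_eq (l := fun _ => Complex.log z) hab continuousOn_const fun t _ => Complex.exp_log hz]
  ring

theorem logVar_neg {γ : ℝ → ℂ} {a b : ℝ} (hab : a ≤ b)
    (hγ : ContinuousOn γ (Icc a b)) (h0 : ∀ t ∈ Icc a b, γ t ≠ 0) :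
    logVar (fun t => -γ t) a b = logVar γ a b := by
  have := logVar_mul (γ := fun _ => (-1 : ℂ)) hab continuousOn_const (by simp) hγ h0
  rw [logVar_const hab (by simp)] at this
  simpa using this

/-- The logarithm of a curve near `1` varies as its principal logarithm. -/
theorem logVar_of_near_one {γ : ℝ → ℂ} {a b : ℝ} (hab : a ≤ b) (hγ : ContinuousOn γ (Icc a b))
    (h0 : ∀ t ∈ Icc a b, ‖γ t - 1‖ < 1) :
    logVar γ a b = Complex.log (γ b) - Complex.log (γ a) := by
  have hs : ∀ t ∈ Icc a b, γ t ∈ Complex.slitPlane := fun t ht =>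
    Complex.ball_one_subset_slitPlane (by simpa [dist_eq_norm] using h0 t ht)
  refine logVar_eq (l := fun t => Complex.log (γ t)) hab (hγ.clog hs) fun t ht =>
    Complex.exp_log (Complex.slitPlane_ne_zero (hs t ht))

/-- The argument of Rouché's theorem: δ/γ stays in the disc of radius 1 about 1, where the principal
logarithm is continuous. The correction depends only on the ends, so it cancels around a closed path
and vanishes when the curves share their ends. -/
theorem logVar_eq_of_close {γ δ : ℝ → ℂ} {a b : ℝ} (hab : a ≤ b) (hγ : ContinuousOn γ (Icc a b))
    (hδ : ContinuousOn δ (Icc a b)) (h : ∀ t ∈ Icc a b, ‖δ t - γ t‖ < ‖γ t‖)  :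
    logVar δ a b = logVar γ a b +
      (Complex.log (δ b / γ b) - Complex.log (δ a / γ a)) := by
  have h0 : ∀ t ∈ Icc a b, γ t ≠ 0 := fun t ht h' => by
    have := h t ht
    rw [h', norm_zero] at this
    exact absurd this (not_lt.2 (norm_nonneg _))
  have hc : ContinuousOn (fun t => δ t / γ t) (Icc a b) := hδ.div hγ h0
  have h1 : ∀ t ∈ Icc a b, ‖δ t / γ t - 1‖ < 1 := fun t ht => by
    rw [div_sub_one (h0 t ht), norm_div, div_lt_one (norm_pos_iff.2 (h0 t ht))]
    exact h t ht
  have h2 : ∀ t ∈ Icc a b, δ t / γ t ≠ 0 := fun t ht h' => by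
    have := h1 t ht
    simp [h'] at this
  have := logVar_mul hab hγ h0 hc h2
  rw [logVar_of_near_one hab hc h1] at this
  rw [← this]
  refine logVar_congr hab (hγ.mul hc) (fun t ht => mul_ne_zero (h0 t ht) (h2 t ht)) fun t ht => ?_
  field_simp [h0 t ht]

theorem logVar_reverse {γ : ℝ → ℂ} {a b c : ℝ} (hab : a ≤ b)
    (hγ : ContinuousOn γ (Icc a b)) (h0 : ∀ t ∈ Icc a b, γ t ≠ 0) :
    logVar (fun t => γ (c - t)) (c - b) (c - a) = - logVar γ a b := by
  obtain ⟨l, hl, he⟩ := exists_log_Icc hab hγ h0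
  have hm : ∀ t ∈ Icc (c - b) (c - a), c - t ∈ Icc a b := fun t ht =>
    ⟨by linarith [ht.2], by linarith [ht.1]⟩
  rw [logVar_eq hab hl he, logVar_eq (l := fun t => l (c - t)) (by linarith)
    (hl.comp (by fun_prop) hm) fun t ht => he _ (hm t ht)]
  simp

/-! ### Winding numbers along rectangles and the parity of the number of zeros -/

/-- The variation of the logarithm of `F` around the boundary of a rectangle. -/
noncomputable def boundaryVar (F : ℝ × ℝ → ℂ) (a b c d : ℝ) : ℂ :=
  logVar (fun s => F (s, c)) a b + logVar (fun t => F (b, t)) c d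
    - logVar (fun s => F (s, d)) a b - logVar (fun t => F (a, t)) c d

theorem boundaryVar_eq_zero {F : ℝ × ℝ → ℂ} {a b c d : ℝ} (hab : a ≤ b) (hcd : c ≤ d)
    (hF : ContinuousOn F (Icc a b ×ˢ Icc c d)) (h0 : ∀ p ∈ Icc a b ×ˢ Icc c d, F p ≠ 0) :
    boundaryVar F a b c d = 0 := by
  obtain ⟨L, hL, he⟩ := exists_log_rect hab hcd hF h0
  have hr : ∀ t ∈ Icc c d, ContinuousOn (fun s => L (s, t)) (Icc a b) := fun t ht =>
    hL.comp (by fun_prop) fun s hs => ⟨hs, ht⟩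
  have hv : ∀ s ∈ Icc a b, ContinuousOn (fun t => L (s, t)) (Icc c d) := fun s hs =>
    hL.comp (by fun_prop) fun t ht => ⟨hs, ht⟩
  have ha := left_mem_Icc.2 hab
  have hb := right_mem_Icc.2 hab
  have hc := left_mem_Icc.2 hcd
  have hd := right_mem_Icc.2 hcd
  rw [boundaryVar, logVar_eq hab (hr c hc) fun s hs => he _ ⟨hs, hc⟩,
    logVar_eq hab (hr d hd) fun s hs => he _ ⟨hs, hd⟩,
    logVar_eq hcd (hv a ha) fun s hs => he _ ⟨ha, hs⟩,
    logVar_eq hcd (hv b hb) fun s hs => he _ ⟨hb, hs⟩]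
  ring

theorem boundaryVar_split_left {F : ℝ × ℝ → ℂ} {a b c d x : ℝ} (hx : x ∈ Icc a b) (hcd : c ≤ d)
    (hF : ContinuousOn F (Icc a b ×ˢ Icc c d)) (hc : ∀ s ∈ Icc a b, F (s, c) ≠ 0)
    (hd : ∀ s ∈ Icc a b, F (s, d) ≠ 0) :
    boundaryVar F a b c d = boundaryVar F a x c d + boundaryVar F x b c d := by
  have hr : ∀ t ∈ Icc c d, ContinuousOn (fun s => F (s, t)) (Icc a b) := fun t ht =>
    hF.comp (by fun_prop) fun s hs => ⟨hs, ht⟩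
  simp only [boundaryVar]
  rw [← logVar_add hx.1 hx.2 (hr c (left_mem_Icc.2 hcd)) hc,
    ← logVar_add hx.1 hx.2 (hr d (right_mem_Icc.2 hcd)) hd]
  ring

theorem boundaryVar_split_right {F : ℝ × ℝ → ℂ} {a b c d x : ℝ} (hx : x ∈ Icc c d) (hab : a ≤ b)
    (hF : ContinuousOn F (Icc a b ×ˢ Icc c d)) (hc : ∀ s ∈ Icc c d, F (a, s) ≠ 0)
    (hd : ∀ s ∈ Icc c d, F (b, s) ≠ 0) :
    boundaryVar F a b c d = boundaryVar F a b c x + boundaryVar F a b x d := by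
  have hv : ∀ s ∈ Icc a b, ContinuousOn (fun t => F (s, t)) (Icc c d) := fun s hs =>
    hF.comp (by fun_prop) fun t ht => ⟨hs, ht⟩
  simp only [boundaryVar]
  rw [← logVar_add hx.1 hx.2 (hv a (left_mem_Icc.2 hab)) hc,
    ← logVar_add hx.1 hx.2 (hv b (right_mem_Icc.2 hab)) hd]
  ring

/-- A linear map is odd, so opposite sides of the centred square contribute equally. Half of the
boundary leads from a corner to the opposite one, where the value is the negative; its variation is
an odd multiple of πi. -/
theorem boundaryVar_linear (L : ℝ × ℝ →L[ℝ] ℂ) (hL : Function.Injective L) (z : ℝ × ℝ) {ε : ℝ}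
    (hε : 0 < ε) :
    ∃ k : ℤ, boundaryVar (fun p => L (p - z)) (z.1 - ε) (z.1 + ε) (z.2 - ε) (z.2 + ε) =
      2 * Real.pi * Complex.I * (2 * k + 1) := by
  have hne : ∀ p : ℝ × ℝ, p ≠ z → L (p - z) ≠ 0 := fun p hp h =>
    hp (sub_eq_zero.1 (hL (h.trans (map_zero L).symm)))
  have h1 : z.1 - ε ≤ z.1 + ε := by linarith
  have h2 : z.2 - ε ≤ z.2 + ε := by linarith
  have hbc : ContinuousOn (fun s => L ((s, z.2 - ε) - z)) (Icc (z.1 - ε) (z.1 + ε)) := by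
    fun_prop
  have hrc : ContinuousOn (fun t => L ((z.1 + ε, t) - z)) (Icc (z.2 - ε) (z.2 + ε)) := by
    fun_prop
  have hb0 : ∀ s ∈ Icc (z.1 - ε) (z.1 + ε), L ((s, z.2 - ε) - z) ≠ 0 := fun s _ =>
    hne _ fun h => by
      have := congrArg Prod.snd h
      simp at this
      linarith
  have hr0 : ∀ t ∈ Icc (z.2 - ε) (z.2 + ε), L ((z.1 + ε, t) - z) ≠ 0 := fun s _ =>
    hne _ fun h => by
      have := congrArg Prod.fst h
      simp at this
      linarith
  have htop : logVar (fun s => L ((s, z.2 + ε) - z)) (z.1 - ε) (z.1 + ε) =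
      - logVar (fun s => L ((s, z.2 - ε) - z)) (z.1 - ε) (z.1 + ε) := by
    have e := logVar_reverse (c := 2 * z.1) h1 hbc hb0
    have e1 : 2 * z.1 - (z.1 + ε) = z.1 - ε := by ring
    have e2 : 2 * z.1 - (z.1 - ε) = z.1 + ε := by ring
    rw [e1, e2] at e
    rw [← e]
    have hm : ∀ s ∈ Icc (z.1 - ε) (z.1 + ε), 2 * z.1 - s ∈ Icc (z.1 - ε) (z.1 + ε) :=
      fun s hs => ⟨by linarith [hs.2], by linarith [hs.1]⟩
    rw [← logVar_neg (γ := fun s => L ((2 * z.1 - s, z.2 - ε) - z)) h1 (hbc.comp (by fun_prop) hm)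
      fun s hs => hb0 _ (hm s hs)]
    congr 1
    ext s
    rw [← map_neg]
    congr 1
    ext <;> simp <;> ring
  have hleft : logVar (fun t => L ((z.1 - ε, t) - z)) (z.2 - ε) (z.2 + ε) =
      - logVar (fun t => L ((z.1 + ε, t) - z)) (z.2 - ε) (z.2 + ε) := by
    have e := logVar_reverse (c := 2 * z.2) h2 hrc hr0
    have e1 : 2 * z.2 - (z.2 + ε) = z.2 - ε := by ring
    have e2 : 2 * z.2 - (z.2 - ε) = z.2 + ε := by ring
    rw [e1, e2] at e
    rw [← e]
    have hm : ∀ s ∈ Icc (z.2 - ε) (z.2 + ε), 2 * z.2 - s ∈ Icc (z.2 - ε) (z.2 + ε) :=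
      fun s hs => ⟨by linarith [hs.2], by linarith [hs.1]⟩
    rw [← logVar_neg (γ := fun t => L ((z.1 + ε, 2 * z.2 - t) - z)) h2 (hrc.comp (by fun_prop) hm)
      fun s hs => hr0 _ (hm s hs)]
    congr 1
    ext s
    rw [← map_neg]
    congr 1
    ext <;> simp <;> ring
  have hexp : Complex.exp (logVar (fun s => L ((s, z.2 - ε) - z)) (z.1 - ε) (z.1 + ε) +
      logVar (fun t => L ((z.1 + ε, t) - z)) (z.2 - ε) (z.2 + ε) - Real.pi * Complex.I) = 1 := by
    rw [Complex.exp_sub, Complex.exp_pi_mul_I, Complex.exp_add, exp_logVar h1 hbc hb0,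
      exp_logVar h2 hrc hr0]
    have e3 : L ((z.1 + ε, z.2 + ε) - z) = - L ((z.1 - ε, z.2 - ε) - z) := by
      rw [← map_neg]
      congr 1
      ext <;> simp
    have e4 := hb0 _ (left_mem_Icc.2 h1)
    have e5 := hb0 _ (right_mem_Icc.2 h1)
    rw [e3]
    field_simp
  obtain ⟨n, hn⟩ := Complex.exp_eq_one_iff.1 hexp
  refine ⟨n, ?_⟩
  rw [boundaryVar, htop, hleft]
  linear_combination 2 * hn

/-- Around a nondegenerate zero, the logarithm varies by an odd multiple of `2πi`. -/
theorem boundaryVar_nondegenerate {F : ℝ × ℝ → ℂ} {z : ℝ × ℝ} {L : ℝ × ℝ →L[ℝ] ℂ}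
    (hF : HasFDerivAt F L z) (hz : F z = 0) (hL : Function.Injective L) :
    ∀ᶠ ε in 𝓝[>] (0 : ℝ),
      (∀ p ∈ Icc (z.1 - ε) (z.1 + ε) ×ˢ Icc (z.2 - ε) (z.2 + ε), p ≠ z → F p ≠ 0) ∧
      (ContinuousOn F (Icc (z.1 - ε) (z.1 + ε) ×ˢ Icc (z.2 - ε) (z.2 + ε)) →
        ∃ k : ℤ, boundaryVar F (z.1 - ε) (z.1 + ε) (z.2 - ε) (z.2 + ε) =
          2 * Real.pi * Complex.I * (2 * k + 1)) := by
  obtain ⟨K, hK0, hK⟩ := L.toLinearMap.exists_antilipschitzWith (LinearMap.ker_eq_bot.2 hL)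
  have hK' : ∀ h, ‖h‖ ≤ K * ‖L h‖ := fun h => by
    simpa [dist_eq_norm] using hK.le_mul_dist h 0
  have hsmall := hF.isLittleO.def (c := 1 / (2 * K)) (by positivity)
  rw [Metric.eventually_nhds_iff] at hsmall
  obtain ⟨δ, hδ, hsm⟩ := hsmall
  -- Near `z` the error of the linearization is at most half of `‖L (p - z)‖`, so `F` and its linear
  -- part are close in the sense of `logVar_eq_of_close`; the corner terms then cancel.
  have hclose : ∀ p, dist p z < δ → p ≠ z → ‖F p - L (p - z)‖ < ‖L (p - z)‖ := by
    intro p hp hpz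
    have h1 := hsm hp
    rw [hz, sub_zero] at h1
    have h2 := hK' (p - z)
    have h3 : 0 < ‖p - z‖ := norm_pos_iff.2 (sub_ne_zero.2 hpz)
    have hKr : (0 : ℝ) < K := hK0
    have h4 : 1 / (2 * K) * ‖p - z‖ ≤ 1 / 2 * ‖L (p - z)‖ := by
      calc 1 / (2 * (K : ℝ)) * ‖p - z‖ ≤ 1 / (2 * K) * (K * ‖L (p - z)‖) := by gcongr
        _ = 1 / 2 * ‖L (p - z)‖ := by field_simp
    have h5 : 0 < ‖L (p - z)‖ := by
      by_contra h
      have : ‖L (p - z)‖ = 0 := le_antisymm (not_lt.1 h) (norm_nonneg _)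
      rw [this, mul_zero] at h2
      linarith
    linarith
  filter_upwards [Ioo_mem_nhdsGT hδ] with ε hε
  have hdist : ∀ p ∈ Icc (z.1 - ε) (z.1 + ε) ×ˢ Icc (z.2 - ε) (z.2 + ε), dist p z < δ := by
    rintro ⟨x, y⟩ ⟨hx, hy⟩
    rw [Prod.dist_eq]
    simp only [mem_Icc] at hx hy
    refine max_lt ?_ ?_ <;> rw [Real.dist_eq, abs_lt] <;> constructor <;>
      linarith [hε.1, hε.2, hx.1, hx.2, hy.1, hy.2]
  refine ⟨fun p hp hpz h => ?_, fun hc => ?_⟩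
  · have := hclose p (hdist p hp) hpz
    rw [h, zero_sub, norm_neg] at this
    exact lt_irrefl _ this
  · obtain ⟨k, hk⟩ := boundaryVar_linear L hL z hε.1
    refine ⟨k, ?_⟩
    rw [← hk]
    have h1 : z.1 - ε ≤ z.1 + ε := by linarith [hε.1]
    have h2 : z.2 - ε ≤ z.2 + ε := by linarith [hε.1]
    have hr : ∀ t ∈ Icc (z.2 - ε) (z.2 + ε), t ≠ z.2 →
        logVar (fun s => F (s, t)) (z.1 - ε) (z.1 + ε) =
        logVar (fun s => L ((s, t) - z)) (z.1 - ε) (z.1 + ε) +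
        (Complex.log (F (z.1 + ε, t) / L ((z.1 + ε, t) - z)) -
          Complex.log (F (z.1 - ε, t) / L ((z.1 - ε, t) - z))) := fun t ht htz =>
      logVar_eq_of_close h1 (by fun_prop)
        (hc.comp (by fun_prop) fun s hs => ⟨hs, ht⟩) fun s hs =>
          hclose _ (hdist _ ⟨hs, ht⟩) fun h => htz (congrArg Prod.snd h)
    have hv : ∀ s ∈ Icc (z.1 - ε) (z.1 + ε), s ≠ z.1 →
        logVar (fun t => F (s, t)) (z.2 - ε) (z.2 + ε) =
        logVar (fun t => L ((s, t) - z)) (z.2 - ε) (z.2 + ε) +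
        (Complex.log (F (s, z.2 + ε) / L ((s, z.2 + ε) - z)) -
          Complex.log (F (s, z.2 - ε) / L ((s, z.2 - ε) - z))) := fun s hs hsz =>
      logVar_eq_of_close h2 (by fun_prop)
        (hc.comp (by fun_prop) fun t ht => ⟨hs, ht⟩) fun t ht =>
          hclose _ (hdist _ ⟨hs, ht⟩) fun h => hsz (congrArg Prod.fst h)
    simp only [boundaryVar]
    rw [hr _ (left_mem_Icc.2 h2) (by linarith [hε.1]), hr _ (right_mem_Icc.2 h2) (by linarith [hε.1]),
      hv _ (left_mem_Icc.2 h1) (by linarith [hε.1]), hv _ (right_mem_Icc.2 h1) (by linarith [hε.1])]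
    ring

/-- The number of zeros of `F` in a rectangle has the parity of the winding number of `F` along
the boundary, if the zeros are nondegenerate and have distinct first coordinates. -/
theorem boundaryVar_parity {F : ℝ × ℝ → ℂ} {c d : ℝ} (hcd : c ≤ d) (n : ℕ) :
    ∀ a b : ℝ, a ≤ b → ContinuousOn F (Icc a b ×ˢ Icc c d) →
    (∀ s ∈ Icc a b, F (s, c) ≠ 0) → (∀ s ∈ Icc a b, F (s, d) ≠ 0) →
    (∀ t ∈ Icc c d, F (a, t) ≠ 0) → (∀ t ∈ Icc c d, F (b, t) ≠ 0) →
    {p ∈ Icc a b ×ˢ Icc c d | F p = 0}.Finite →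
    InjOn Prod.fst {p ∈ Icc a b ×ˢ Icc c d | F p = 0} →
    (∀ p ∈ Icc a b ×ˢ Icc c d, F p = 0 →
      ∃ L : ℝ × ℝ →L[ℝ] ℂ, HasFDerivAt F L p ∧ Function.Injective L) →
    {p ∈ Icc a b ×ˢ Icc c d | F p = 0}.ncard = n →
    ∃ k : ℤ, boundaryVar F a b c d = 2 * Real.pi * Complex.I * (n + 2 * k) := by
  induction n using Nat.strong_induction_on with
  | _ n ih =>
  intro a b hab hF hc hd ha hb hfin hinj hnd hn
  rcases Set.eq_empty_or_nonempty {p ∈ Icc a b ×ˢ Icc c d | F p = 0} with he | ⟨z, hz⟩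
  · rw [he, ncard_empty] at hn
    refine ⟨0, ?_⟩
    rw [boundaryVar_eq_zero hab hcd hF fun p hp h => ?_, ← hn]
    · simp
    · have : p ∈ {p ∈ Icc a b ×ˢ Icc c d | F p = 0} := ⟨hp, h⟩
      rw [he] at this
      exact this
  obtain ⟨L, hL, hLi⟩ := hnd z hz.1 hz.2
  have hza : a < z.1 := lt_of_le_of_ne hz.1.1.1 fun h => ha z.2 hz.1.2 (by rw [h]; exact hz.2)
  have hzb : z.1 < b := lt_of_le_of_ne hz.1.1.2 fun h => hb z.2 hz.1.2 (by rw [← h]; exact hz.2)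
  have hzc : c < z.2 := lt_of_le_of_ne hz.1.2.1 fun h => hc z.1 hz.1.1 (by rw [h]; exact hz.2)
  have hzd : z.2 < d := lt_of_le_of_ne hz.1.2.2 fun h => hd z.1 hz.1.1 (by rw [← h]; exact hz.2)
  -- Distinct first coordinates allow a full vertical strip around `z` that contains no other zero,
  -- so cuts along vertical lines suffice for the induction.
  have hiso : ∀ᶠ ε in 𝓝[>] (0 : ℝ), ∀ p ∈ {p ∈ Icc a b ×ˢ Icc c d | F p = 0}, p ≠ z →
      ε < |p.1 - z.1| := by
    rw [hfin.eventually_all]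
    intro p hp
    by_cases hpz : p = z
    · simp [hpz]
    · have : 0 < |p.1 - z.1| := abs_pos.2 (sub_ne_zero.2 fun h => hpz (hinj hp hz h))
      filter_upwards [Ioo_mem_nhdsGT this] with ε hε _ using hε.2
  have hlt : ∀ {x y : ℝ}, x < y → ∀ᶠ ε in 𝓝[>] (0 : ℝ), 0 < ε ∧ ε < y - x := fun h =>
    Ioo_mem_nhdsGT (sub_pos.2 h)
  obtain ⟨ε, ⟨-, hbox⟩, hiso, hε1, hε2, hε3, hε4⟩ :=
    ((boundaryVar_nondegenerate hL hz.2 hLi).and (hiso.and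
      ((hlt hza).and ((hlt hzb).and ((hlt hzc).and (hlt hzd)))))).exists
  have hε0 : 0 < ε := hε1.1
  have hm : ∀ {a' b' : ℝ}, a ≤ a' → b' ≤ b → Icc a' b' ×ˢ Icc c d ⊆ Icc a b ×ˢ Icc c d :=
    fun h h' => prod_mono (Icc_subset_Icc h h') le_rfl
  -- zeros in the strip
  have hstrip : ∀ p ∈ Icc (z.1 - ε) (z.1 + ε) ×ˢ Icc c d, F p = 0 → p = z := by
    intro p hp h
    by_contra hpz
    have := hiso p ⟨hm (by linarith [hε1.2]) (by linarith [hε2.2]) hp, h⟩ hpz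
    have h' : |p.1 - z.1| ≤ ε := abs_le.2 ⟨by linarith [hp.1.1], by linarith [hp.1.2]⟩
    linarith
  have hl0 : ∀ t ∈ Icc c d, F (z.1 - ε, t) ≠ 0 := fun t ht h => by
    have := congrArg Prod.fst (hstrip (z.1 - ε, t) ⟨⟨by simp, by simp; linarith⟩, ht⟩ h)
    simp at this
    linarith
  have hr0 : ∀ t ∈ Icc c d, F (z.1 + ε, t) ≠ 0 := fun t ht h => by
    have := congrArg Prod.fst (hstrip (z.1 + ε, t) ⟨⟨by simp; linarith, by simp⟩, ht⟩ h)
    simp at this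
    linarith
  set Z := {p ∈ Icc a b ×ˢ Icc c d | F p = 0} with hZ
  set Zl := {p ∈ Icc a (z.1 - ε) ×ˢ Icc c d | F p = 0} with hZl
  set Zr := {p ∈ Icc (z.1 + ε) b ×ˢ Icc c d | F p = 0} with hZr
  have hZl' : Zl ⊆ Z := fun p hp => ⟨hm le_rfl (by linarith [hε2.2]) hp.1, hp.2⟩
  have hZr' : Zr ⊆ Z := fun p hp => ⟨hm (by linarith [hε1.2]) le_rfl hp.1, hp.2⟩
  have hcard : Z.ncard = Zl.ncard + 1 + Zr.ncard := by
    have hU : Z = (Zl ∪ {z}) ∪ Zr := by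
      ext p
      constructor
      · intro hp
        by_cases h : p = z
        · exact Or.inl (Or.inr h)
        · have h1 := hiso p hp h
          rcases lt_abs.1 h1 with h2 | h2
          · exact Or.inr ⟨⟨⟨by linarith, hp.1.1.2⟩, hp.1.2⟩, hp.2⟩
          · exact Or.inl (Or.inl ⟨⟨⟨hp.1.1.1, by linarith⟩, hp.1.2⟩, hp.2⟩)
      · rintro ((hp | hp) | hp)
        · exact hZl' hp
        · rw [mem_singleton_iff.1 hp]; exact hz
        · exact hZr' hp
    rw [hU, ncard_union_eq ?_ ((hfin.subset hZl').union (finite_singleton z)) (hfin.subset hZr'),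
      ncard_union_eq ?_ (hfin.subset hZl') (finite_singleton z), ncard_singleton]
    · rw [disjoint_singleton_right]
      intro h
      have := h.1.1.2
      linarith
    · rw [Set.disjoint_left]
      rintro p (hp | hp) hp'
      · have h1 := hp.1.1.2
        have h2 := hp'.1.1.1
        linarith
      · rw [mem_singleton_iff.1 hp] at hp'
        have h2 := hp'.1.1.1
        linarith
  obtain ⟨kl, hkl⟩ := ih Zl.ncard (by omega) a (z.1 - ε) (by linarith [hε1.2])
    (hF.mono (hm le_rfl (by linarith [hε2.2])))
    (fun s hs => hc s ⟨hs.1, by linarith [hs.2, hε2.2]⟩)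
    (fun s hs => hd s ⟨hs.1, by linarith [hs.2, hε2.2]⟩) ha hl0
    (hfin.subset hZl') (hinj.mono hZl')
    (fun p hp => hnd p (hm le_rfl (by linarith [hε2.2]) hp)) rfl
  obtain ⟨kr, hkr⟩ := ih Zr.ncard (by omega) (z.1 + ε) b (by linarith [hε2.2])
    (hF.mono (hm (by linarith [hε1.2]) le_rfl))
    (fun s hs => hc s ⟨by linarith [hs.1, hε1.2], hs.2⟩)
    (fun s hs => hd s ⟨by linarith [hs.1, hε1.2], hs.2⟩) hr0 hb
    (hfin.subset hZr') (hinj.mono hZr')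
    (fun p hp => hnd p (hm (by linarith [hε1.2]) le_rfl hp)) rfl
  have hcs : ContinuousOn F (Icc (z.1 - ε) (z.1 + ε) ×ˢ Icc c d) :=
    hF.mono (hm (by linarith [hε1.2]) (by linarith [hε2.2]))
  have hsub : ∀ {c' d' : ℝ}, c ≤ c' → d' ≤ d →
      Icc (z.1 - ε) (z.1 + ε) ×ˢ Icc c' d' ⊆ Icc (z.1 - ε) (z.1 + ε) ×ˢ Icc c d :=
    fun h h' => prod_mono le_rfl (Icc_subset_Icc h h')
  obtain ⟨k, hk⟩ := hbox (hcs.mono (hsub (by linarith [hε3.2]) (by linarith [hε4.2])))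
  refine ⟨kl + kr + k, ?_⟩
  -- Five rectangles: the parts left and right of the strip are covered by induction, the strip is
  -- cut into the small square about `z` and two zero-free pieces above and below it.
  rw [boundaryVar_split_left (x := z.1 - ε) ⟨by linarith [hε1.2], by linarith [hε2.2]⟩ hcd hF hc hd,
    boundaryVar_split_left (x := z.1 + ε) ⟨by linarith, by linarith [hε2.2]⟩ hcd
      (hF.mono (hm (by linarith [hε1.2]) le_rfl))
      (fun s hs => hc s ⟨by linarith [hs.1, hε1.2], hs.2⟩)
      (fun s hs => hd s ⟨by linarith [hs.1, hε1.2], hs.2⟩),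
    boundaryVar_split_right (x := z.2 - ε) ⟨by linarith [hε3.2], by linarith [hε4.2]⟩
      (by linarith) hcs hl0 hr0,
    boundaryVar_split_right (c := z.2 - ε) (x := z.2 + ε) ⟨by linarith, by linarith [hε4.2]⟩
      (by linarith) (hcs.mono (hsub (by linarith [hε3.2]) le_rfl))
      (fun t ht => hl0 t ⟨by linarith [ht.1, hε3.2], ht.2⟩)
      (fun t ht => hr0 t ⟨by linarith [ht.1, hε3.2], ht.2⟩),
    hkl, hkr, hk,
    boundaryVar_eq_zero (c := c) (d := z.2 - ε) (by linarith) (by linarith [hε3.2])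
      (hcs.mono (hsub le_rfl (by linarith [hε4.2]))) fun p hp h => ?_,
    boundaryVar_eq_zero (c := z.2 + ε) (d := d) (by linarith) (by linarith [hε4.2])
      (hcs.mono (hsub (by linarith [hε3.2]) le_rfl)) fun p hp h => ?_, ← hn, hcard]
  · push_cast
    ring
  · have h1 := hp.2.1
    rw [hstrip p (hsub (by linarith [hε3.2]) le_rfl hp) h] at h1
    linarith
  · have h1 := hp.2.2
    rw [hstrip p (hsub le_rfl (by linarith [hε4.2]) hp) h] at h1
    linarith

/-! ### Parity of the number of crossings of two curves -/

/-- The map is the differential of (s, t) ↦ γ(s) - δ(t), so transversal crossings become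
nondegenerate zeros. -/
theorem injective_of_linearIndependent_pair {E : Type*} [NormedAddCommGroup E] [NormedSpace ℝ E]
    {v w : E} (h : LinearIndependent ℝ ![v, w]) :
    Function.Injective (((ContinuousLinearMap.fst ℝ ℝ ℝ).smulRight v -
      (ContinuousLinearMap.snd ℝ ℝ ℝ).smulRight w : ℝ × ℝ →L[ℝ] E)) := by
  rw [injective_iff_map_eq_zero]
  rintro ⟨x, y⟩ hxy
  simp only [sub_apply, ContinuousLinearMap.smulRight_apply,
    ContinuousLinearMap.coe_fst', ContinuousLinearMap.coe_snd'] at hxy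
  have := LinearIndependent.pair_iff.1 h x (-y) (by rw [neg_smul, ← sub_eq_add_neg, hxy])
  ext <;> simp [this.1, neg_eq_zero.1 this.2]

theorem hasFDerivAt_sub_curves {E : Type*} [NormedAddCommGroup E] [NormedSpace ℝ E]
    {γ δ : ℝ → E} {s t : ℝ} {v w : E} (hγ : HasDerivAt γ v s) (hδ : HasDerivAt δ w t) :
    HasFDerivAt (fun p : ℝ × ℝ => γ p.1 - δ p.2)
      ((ContinuousLinearMap.fst ℝ ℝ ℝ).smulRight v -
        (ContinuousLinearMap.snd ℝ ℝ ℝ).smulRight w) (s, t) := by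
  have h1 : HasFDerivAt (fun p : ℝ × ℝ => γ p.1) ((ContinuousLinearMap.fst ℝ ℝ ℝ).smulRight v)
      (s, t) := by
    convert! (HasDerivAt.hasFDerivAt hγ).comp (s, t)
      (hasFDerivAt_fst (𝕜 := ℝ) (E := ℝ) (F := ℝ) (p := (s, t))) using 1
  have h2 : HasFDerivAt (fun p : ℝ × ℝ => δ p.2) ((ContinuousLinearMap.snd ℝ ℝ ℝ).smulRight w)
      (s, t) := by
    convert! (HasDerivAt.hasFDerivAt hδ).comp (s, t)
      (hasFDerivAt_snd (𝕜 := ℝ) (E := ℝ) (F := ℝ) (p := (s, t))) using 1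
  exact h1.sub h2

/-- The parity of the number of crossings of two curves in general position is determined by the
variation of the arguments of each curve as seen from the ends of the other one. -/
theorem curves_parity {γ δ : ℝ → ℂ} (hγ : ContinuousOn γ (Icc 0 1)) (hδ : ContinuousOn δ (Icc 0 1))
    (h1 : ∀ t ∈ Icc (0 : ℝ) 1, γ t ≠ δ 0 ∧ γ t ≠ δ 1 ∧ δ t ≠ γ 0 ∧ δ t ≠ γ 1)
    (hfin : (γ '' Ioo 0 1 ∩ δ '' Ioo 0 1).Finite)
    (huniq : ∀ s ∈ Ioo (0 : ℝ) 1, ∀ s' ∈ Ioo (0 : ℝ) 1, ∀ t ∈ Ioo (0 : ℝ) 1, ∀ t' ∈ Ioo (0 : ℝ) 1,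
      γ s = δ t → γ s' = δ t' → γ s = γ s' → s = s' ∧ t = t')
    (htr : ∀ s ∈ Ioo (0 : ℝ) 1, ∀ t ∈ Ioo (0 : ℝ) 1, γ s = δ t →
      ∃ v w, HasDerivAt γ v s ∧ HasDerivAt δ w t ∧ LinearIndependent ℝ ![v, w]) :
    ∃ k : ℤ, logVar (fun t => γ t - δ 0) 0 1 + logVar (fun t => δ t - γ 1) 0 1
      - logVar (fun t => γ t - δ 1) 0 1 - logVar (fun t => δ t - γ 0) 0 1 =
      2 * Real.pi * Complex.I * ((γ '' Ioo 0 1 ∩ δ '' Ioo 0 1).ncard + 2 * k) := by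
  set F : ℝ × ℝ → ℂ := fun p => γ p.1 - δ p.2 with hFdef
  set Z := {p ∈ Icc (0 : ℝ) 1 ×ˢ Icc (0 : ℝ) 1 | F p = 0} with hZ
  have hI0 : (0 : ℝ) ∈ Icc (0 : ℝ) 1 := by simp
  have hI1 : (1 : ℝ) ∈ Icc (0 : ℝ) 1 := by simp
  have hZm : ∀ p ∈ Z, p.1 ∈ Ioo (0 : ℝ) 1 ∧ p.2 ∈ Ioo (0 : ℝ) 1 ∧ γ p.1 = δ p.2 := by
    rintro ⟨s, t⟩ ⟨⟨hs, ht⟩, h⟩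
    replace h : γ s = δ t := sub_eq_zero.1 h
    refine ⟨⟨lt_of_le_of_ne hs.1 ?_, lt_of_le_of_ne hs.2 ?_⟩,
      ⟨lt_of_le_of_ne ht.1 ?_, lt_of_le_of_ne ht.2 ?_⟩, h⟩
    · rintro rfl; exact (h1 t ht).2.2.1 h.symm
    · rintro rfl; exact (h1 t ht).2.2.2 h.symm
    · rintro rfl; exact (h1 s hs).1 h
    · rintro rfl; exact (h1 s hs).2.1 h
  have hinj : InjOn (fun p : ℝ × ℝ => γ p.1) Z := by
    intro p hp q hq hpq
    obtain ⟨a1, a2, a3⟩ := hZm p hp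
    obtain ⟨b1, b2, b3⟩ := hZm q hq
    obtain ⟨e1, e2⟩ := huniq _ a1 _ b1 _ a2 _ b2 a3 b3 hpq
    exact Prod.ext e1 e2
  have himg : (fun p : ℝ × ℝ => γ p.1) '' Z = γ '' Ioo 0 1 ∩ δ '' Ioo 0 1 := by
    ext q
    constructor
    · rintro ⟨p, hp, rfl⟩
      obtain ⟨a1, a2, a3⟩ := hZm p hp
      exact ⟨⟨_, a1, rfl⟩, ⟨_, a2, a3.symm⟩⟩
    · rintro ⟨⟨s, hs, rfl⟩, ⟨t, ht, h⟩⟩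
      exact ⟨(s, t), ⟨⟨Ioo_subset_Icc_self hs, Ioo_subset_Icc_self ht⟩, sub_eq_zero.2 h.symm⟩, rfl⟩
  have hZfin : Z.Finite := Finite.of_finite_image (by rw [himg]; exact hfin) hinj
  have hcard : Z.ncard = (γ '' Ioo 0 1 ∩ δ '' Ioo 0 1).ncard := by
    rw [← himg, hinj.ncard_image]
  have hFc : ContinuousOn F (Icc 0 1 ×ˢ Icc 0 1) :=
    (hγ.comp continuousOn_fst fun p hp => hp.1).sub (hδ.comp continuousOn_snd fun p hp => hp.2)
  obtain ⟨k, hk⟩ := boundaryVar_parity (F := F) (zero_le_one' ℝ) _ 0 1 zero_le_one hFc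
    (fun s hs => sub_ne_zero.2 (h1 s hs).1) (fun s hs => sub_ne_zero.2 (h1 s hs).2.1)
    (fun s hs => sub_ne_zero.2 (h1 s hs).2.2.1.symm)
    (fun s hs => sub_ne_zero.2 (h1 s hs).2.2.2.symm) hZfin
    -- Zeros with the same first coordinate give the same crossing point, and each crossing has only
    -- one pair of parameters.
    (fun p hp q hq hpq => hinj hp hq (congrArg γ hpq))
    (fun p hp hp0 => by
      obtain ⟨a1, a2, a3⟩ := hZm p ⟨hp, hp0⟩
      obtain ⟨v, w, hv, hw, hvw⟩ := htr _ a1 _ a2 a3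
      exact ⟨_, hasFDerivAt_sub_curves hv hw, injective_of_linearIndependent_pair hvw⟩) hcard
  refine ⟨k, ?_⟩
  rw [← hk, boundaryVar]
  have e1 : logVar (fun t => F (1, t)) 0 1 = logVar (fun t => δ t - γ 1) 0 1 := by
    rw [← logVar_neg (γ := fun t => δ t - γ 1) zero_le_one (hδ.sub continuousOn_const)
      fun t ht => sub_ne_zero.2 (h1 t ht).2.2.2]
    simp [hFdef]
  have e2 : logVar (fun t => F (0, t)) 0 1 = logVar (fun t => δ t - γ 0) 0 1 := by
    rw [← logVar_neg (γ := fun t => δ t - γ 0) zero_le_one (hδ.sub continuousOn_const)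
      fun t ht => sub_ne_zero.2 (h1 t ht).2.2.1]
    simp [hFdef]
  rw [e1, e2]

/-! ### Sorting crossings by pairs of edges -/

/-- The identification of the plane with the complex numbers. -/
noncomputable def toC : Plane ≃ₗᵢ[ℝ] ℂ := Complex.orthonormalBasisOneI.repr.symm

namespace GenericImmersion
variable {α β : Type*} {G : Graph α β}

theorem inr_mem_pointSet {H : Graph α β} {e : β} {t : ℝ} :
    (Sum.inr (e, t) : α ⊕ β × ℝ) ∈ pointSet H ↔ e ∈ H.edgeSet ∧ t ∈ Ioo (0 : ℝ) 1 := by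
  simp only [pointSet, mem_ofPred_eq, reduceCtorEq, and_false, exists_false, false_or,
    Sum.inr.injEq, Prod.mk.injEq]
  constructor
  · rintro ⟨e', he', t', ht', rfl, rfl⟩
    exact ⟨he', ht'⟩
  · rintro ⟨he, ht⟩
    exact ⟨e, he, t, ht, rfl, rfl⟩

theorem inl_mem_pointSet {H : Graph α β} {v : α} :
    (Sum.inl v : α ⊕ β × ℝ) ∈ pointSet H ↔ v ∈ H.vertexSet := by
  simp [pointSet]

theorem pointSet_mono {H G : Graph α β} (h : H ≤ G) : pointSet H ⊆ pointSet G := by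
  rintro (v | ⟨e, t⟩) hp
  · rw [inl_mem_pointSet] at *
    exact Graph.IsSubgraph.vertexSet_mono h hp
  · rw [inr_mem_pointSet] at *
    exact ⟨Graph.IsSubgraph.edgeSet_mono h hp.1, hp.2⟩

/-- The crossings between the two edges of an unordered pair. -/
def crossings (f : GenericImmersion G) (s : Sym2 β) : Set Plane :=
  {q | ∃ d t d' t', s(d, d') = s ∧ t ∈ Ioo (0 : ℝ) 1 ∧ t' ∈ Ioo (0 : ℝ) 1 ∧ (d, t) ≠ (d', t') ∧
    f.edge d t = q ∧ f.edge d' t' = q}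

theorem multiplePoints_eq (f : GenericImmersion G) {H : Graph α β} (hH : H ≤ G) :
    multiplePoints f.vert f.edge H =
      {q | ∃ s : Sym2 β, (∀ e ∈ s, e ∈ H.edgeSet) ∧ q ∈ f.crossings s} := by
  ext q
  constructor
  · rintro ⟨p, hp, p', hp', hne, rfl, hq⟩
    have hpG := pointSet_mono hH hp
    have hpG' := pointSet_mono hH hp'
    rcases p with v | ⟨d, t⟩
    · exact absurd (f.vertex_simple v (inl_mem_pointSet.1 hpG) p' hpG' hq).symm hne
    rcases p' with v | ⟨e, s⟩
    · exact absurd (f.vertex_simple v (inl_mem_pointSet.1 hpG') _ hpG hq.symm) hne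
    rw [inr_mem_pointSet] at hp hp'
    exact ⟨s(d, e), by simp [hp.1, hp'.1], d, t, e, s, rfl, hp.2, hp'.2, fun h => hne (by rw [h]),
      rfl, hq⟩
  · rintro ⟨_, hs, d, t, d', t', rfl, ht, ht', hne, rfl, h⟩
    simp only [Sym2.mem_iff, forall_eq_or_imp, forall_eq] at hs
    exact ⟨Sum.inr (d, t), inr_mem_pointSet.2 ⟨hs.1, ht⟩, Sum.inr (d', t'),
      inr_mem_pointSet.2 ⟨hs.2, ht'⟩, fun h => hne (Sum.inr.inj h), rfl, h⟩

/-- A point has at most two preimages, and these determine the pair of edges. -/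
theorem crossings_unique (f : GenericImmersion G) {s s' : Sym2 β} (hs : ∀ e ∈ s, e ∈ G.edgeSet)
    (hs' : ∀ e ∈ s', e ∈ G.edgeSet) {q : Plane} (hq : q ∈ f.crossings s)
    (hq' : q ∈ f.crossings s') : s = s' := by
  obtain ⟨d, t, e, u, rfl, ht, hu, hne, h1, h2⟩ := hq
  obtain ⟨d', t', e', u', rfl, ht', hu', hne', h1', h2'⟩ := hq'
  simp only [Sym2.mem_iff, forall_eq_or_imp, forall_eq] at hs hs'
  have A := f.double (Sum.inr (d, t)) (inr_mem_pointSet.2 ⟨hs.1, ht⟩) (Sum.inr (e, u))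
    (inr_mem_pointSet.2 ⟨hs.2, hu⟩) (Sum.inr (d', t')) (inr_mem_pointSet.2 ⟨hs'.1, ht'⟩)
    (h1.trans h2.symm) (h2.trans h1'.symm)
  have B := f.double (Sum.inr (d, t)) (inr_mem_pointSet.2 ⟨hs.1, ht⟩) (Sum.inr (e, u))
    (inr_mem_pointSet.2 ⟨hs.2, hu⟩) (Sum.inr (e', u')) (inr_mem_pointSet.2 ⟨hs'.2, hu'⟩)
    (h1.trans h2.symm) (h2.trans h2'.symm)
  simp only [Sum.inr.injEq] at A B
  grind

theorem crossings_finite (f : GenericImmersion G) {s : Sym2 β} (hs : ∀ e ∈ s, e ∈ G.edgeSet) :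
    (f.crossings s).Finite := by
  refine f.finite_multiplePoints.subset fun q hq => ?_
  rw [multiplePoints_eq f le_rfl]
  exact ⟨s, hs, hq⟩

/-- The number of crossings is the sum of the numbers of crossings of all pairs of edges. -/
theorem crossingNumber_eq_sum [DecidableEq β] (f : GenericImmersion G) {H : Graph α β} (hH : H ≤ G)
    (E : Finset β) (hE : ∀ e, e ∈ E ↔ e ∈ H.edgeSet) :
    f.crossingNumber H = ∑ s ∈ E.sym2, (f.crossings s).ncard := by
  classical
  have hEs : ∀ s ∈ E.sym2, ∀ e ∈ s, e ∈ G.edgeSet := fun s hs e he =>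
    Graph.IsSubgraph.edgeSet_mono hH ((hE e).1 (Finset.mem_sym2_iff.1 hs e he))
  have hfin : ∀ s ∈ E.sym2, (f.crossings s).Finite := fun s hs => f.crossings_finite (hEs s hs)
  have : multiplePoints f.vert f.edge H = ⋃ s ∈ E.sym2, f.crossings s := by
    rw [multiplePoints_eq f hH]
    ext q
    simp only [mem_ofPred_eq, mem_iUnion, Finset.mem_sym2_iff, hE, exists_prop]
  rw [crossingNumber, this]
  have hdisj : (E.sym2 : Set (Sym2 β)).PairwiseDisjoint f.crossings := by
    intro s hs s' hs' hne
    rw [Function.onFun, Set.disjoint_left]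
    intro q hq hq'
    exact hne (f.crossings_unique (hEs s hs) (hEs s' hs') hq hq')
  clear this
  revert hfin hdisj
  clear hEs
  induction E.sym2 using Finset.induction_on with
  | empty => simp
  | insert a S ha ih =>
    intro hfin hdisj
    rw [Finset.sum_insert ha, ← ih (fun s hs => hfin s (Finset.mem_insert_of_mem hs))
      (hdisj.subset (by simp)), Finset.set_biUnion_insert]
    have hS : (⋃ s ∈ S, f.crossings s).Finite :=
      S.finite_toSet.biUnion fun s hs => hfin s (Finset.mem_insert_of_mem hs)
    refine ncard_union_eq ?_ (hfin a (Finset.mem_insert_self _ _)) hS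
    rw [Set.disjoint_iUnion₂_right]
    intro s hs
    exact hdisj (by simp) (by simp [hs]) (fun h => ha (h ▸ hs))

/-- The number of elements of `Λ` containing both edges of an unordered pair. -/
noncomputable def pairCount (Λ : Finset (Graph α β)) (s : Sym2 β) : ℕ :=
  {H : Graph α β | H ∈ Λ ∧ ∀ e ∈ s, e ∈ H.edgeSet}.ncard

theorem pairCount_mk (Λ : Finset (Graph α β)) (d e : β) :
    pairCount Λ s(d, e) = countContaining Λ d e := by
  simp [pairCount, countContaining]

/-- Double counting: a crossing of a pair of edges is seen by exactly those members of Λ that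
contain both edges. -/
theorem sum_crossingNumber [DecidableEq β] (f : GenericImmersion G) (hE : G.edgeSet.Finite)
    (Λ : Finset (Graph α β)) (hΛ : ∀ H ∈ Λ, H ≤ G) :
    ∑ H ∈ Λ, f.crossingNumber H =
      ∑ s ∈ hE.toFinset.sym2, pairCount Λ s * (f.crossings s).ncard := by
  classical
  have h1 : ∀ H ∈ Λ, f.crossingNumber H =
      ∑ s ∈ hE.toFinset.sym2, if ∀ e ∈ s, e ∈ H.edgeSet then (f.crossings s).ncard else 0 := by
    intro H hH
    have hsub := Graph.IsSubgraph.edgeSet_mono (hΛ H hH)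
    rw [f.crossingNumber_eq_sum (hΛ H hH) (hE.subset hsub).toFinset (by simp),
      ← Finset.sum_filter]
    refine Finset.sum_congr ?_ fun _ _ => rfl
    ext s
    simp only [Finset.mem_filter, Finset.mem_sym2_iff, Set.Finite.mem_toFinset]
    exact ⟨fun h => ⟨fun e he => hsub (h e he), h⟩, fun h => h.2⟩
  rw [Finset.sum_congr rfl h1, Finset.sum_comm]
  refine Finset.sum_congr rfl fun s _ => ?_
  rw [← Finset.sum_filter, Finset.sum_const, smul_eq_mul, pairCount]
  congr 1
  rw [← ncard_coe_finset]
  congr 1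
  ext H
  simp

end GenericImmersion

/-! ### Sufficiency: comparing two immersions -/

/-- Used to split the change for a pair {d, e} into a part seen from the ends of d and one seen from
the ends of e. -/
theorem sum_sym2_eq_sum_sum {β R : Type*} [AddCommMonoid R] (w : Sym2 β → R) (c : β → β → R)
    (E : Finset β) (hdiag : ∀ e ∈ E, w s(e, e) = 0 ∧ c e e = 0)
    (h : ∀ d ∈ E, ∀ e ∈ E, d ≠ e → w s(d, e) = c d e + c e d) :
    ∑ s ∈ E.sym2, w s = ∑ d ∈ E, ∑ e ∈ E, c d e := by
  induction E using Finset.cons_induction with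
  | empty => simp
  | cons a S ha ih =>
    have hS : ∀ e ∈ S, e ∈ S.cons a ha := fun e he => Finset.mem_cons_of_mem he
    have ha' : a ∈ S.cons a ha := Finset.mem_cons_self a S
    rw [Finset.sym2_cons, Finset.sum_disjUnion, Finset.sum_map,
      ih (fun e he => hdiag e (hS e he)) (fun d hd e he => h d (hS d hd) e (hS e he)),
      Finset.sum_cons, Finset.sum_cons, Finset.sum_cons]
    have e1 : ∑ d ∈ S, ∑ e ∈ S.cons a ha, c d e = ∑ d ∈ S, (c d a + ∑ e ∈ S, c d e) :=
      Finset.sum_congr rfl fun d _ => Finset.sum_cons _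
    have e2 : ∑ x ∈ S, w (Sym2.mkEmbedding a x) = ∑ x ∈ S, (c a x + c x a) :=
      Finset.sum_congr rfl fun x hx => h a ha' x (hS x hx) fun hax => ha (hax ▸ hx)
    rw [e1, e2, (hdiag a ha').2, Finset.sum_add_distrib, Finset.sum_add_distrib]
    have e3 : w (Sym2.mkEmbedding a a) = 0 := (hdiag a ha').1
    rw [e3]
    abel

/-- The weight 2 of a loop is what makes this hold when `x = y`. -/
theorem sum_endsAt_mul {α β R : Type*} [CommRing R] {G : Graph α β} {e : β} {x y : α}
    (h : G.IsLink e x y) (V : Finset α) (hV : ∀ v, v ∈ V ↔ v ∈ G.vertexSet) (F : α → R) :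
    ∑ u ∈ V, (endsAt G u e : R) * F u = F x + F y := by
  classical
  have hx : x ∈ V := (hV x).2 h.left_mem
  have hy : y ∈ V := (hV y).2 h.right_mem
  have key : ∀ u, (endsAt G u e : R) * F u = (if u = x then F u else 0) + (if u = y then F u else 0) := by
    intro u
    have hinc : G.Inc e u ↔ u = x ∨ u = y :=
      ⟨fun hu => hu.eq_or_eq_of_isLink h, by rintro (rfl | rfl); exacts [h.inc_left, h.inc_right]⟩
    have hloop : G.IsLoopAt e u ↔ u = x ∧ u = y := by
      constructor
      · intro hl
        exact ⟨hl.eq_of_inc h.inc_left, hl.eq_of_inc h.inc_right⟩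
      · rintro ⟨rfl, rfl⟩
        exact h
    simp only [endsAt, hinc, hloop]
    by_cases h1 : u = x <;> by_cases h2 : u = y <;> simp [h1, h2]
    · subst h1
      simp [h2]
      ring
    · subst h1
      simp [h2]
    · subst h2
      simp [h1]
  rw [Finset.sum_congr rfl fun u _ => key u, Finset.sum_add_distrib, Finset.sum_ite_eq' ,
    Finset.sum_ite_eq', if_pos hx, if_pos hy]

theorem linearIndependent_pair_smul {E : Type*} [AddCommGroup E] [Module ℝ E] {v w : E}
    (h : LinearIndependent ℝ ![v, w]) {a b : ℝ} (ha : a ≠ 0) (hb : b ≠ 0) :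
    LinearIndependent ℝ ![a • v, b • w] := by
  rw [LinearIndependent.pair_iff] at *
  intro s t hst
  rw [smul_smul, smul_smul] at hst
  have := h _ _ hst
  simpa [ha, hb] using this

theorem linearIndependent_pair_map {E F : Type*} [AddCommGroup E] [Module ℝ E] [AddCommGroup F]
    [Module ℝ F] (T : E →ₗ[ℝ] F) (hT : Function.Injective T) {v w : E} :
    LinearIndependent ℝ ![T v, T w] ↔ LinearIndependent ℝ ![v, w] := by
  simp only [LinearIndependent.pair_iff, ← map_smul, ← map_add, map_eq_zero_iff T hT]

namespace GenericImmersion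
variable {α β : Type*} {G : Graph α β}

theorem hasStrictDerivAt_edge (f : GenericImmersion G) {e : β} (he : e ∈ G.edgeSet) {t : ℝ}
    (ht : t ∈ Ioo (0 : ℝ) 1) : HasStrictDerivAt (f.edge e) (deriv (f.edge e) t) t :=
  ((f.smooth e he).contDiffAt (Icc_mem_nhds ht.1 ht.2)).hasStrictDerivAt (by simp)

theorem continuousOn_edge (f : GenericImmersion G) {e : β} (he : e ∈ G.edgeSet) :
    ContinuousOn (f.edge e) (Icc 0 1) := (f.smooth e he).continuousOn

open Classical in
/-- The edge `e`, as a curve in the complex plane from the image of `src e` to that of `tgt e`. -/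
noncomputable def orientedEdge (f : GenericImmersion G) (src tgt : β → α) (e : β) : ℝ → ℂ :=
  if f.edge e 0 = f.vert (src e) ∧ f.edge e 1 = f.vert (tgt e) then fun t => toC (f.edge e t)
  else fun t => toC (f.edge e (1 - t))

variable {src tgt : β → α}

theorem orientedEdge_of (f : GenericImmersion G) {e : β} (h0 : f.edge e 0 = f.vert (src e))
    (h1 : f.edge e 1 = f.vert (tgt e)) :
    f.orientedEdge src tgt e = fun t => toC (f.edge e t) := by
  rw [orientedEdge, if_pos ⟨h0, h1⟩]

theorem orientedEdge_ends (f : GenericImmersion G) {e : β} (h : G.IsLink e (src e) (tgt e)) :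
    f.orientedEdge src tgt e 0 = toC (f.vert (src e)) ∧
      f.orientedEdge src tgt e 1 = toC (f.vert (tgt e)) := by
  by_cases hc : f.edge e 0 = f.vert (src e) ∧ f.edge e 1 = f.vert (tgt e)
  · rw [orientedEdge, if_pos hc, hc.1, hc.2]
    exact ⟨rfl, rfl⟩
  · rw [orientedEdge, if_neg hc]
    obtain ⟨x, y, hxy, h0, h1⟩ := f.ends e h.edge_mem
    rcases h.eq_and_eq_or_eq_and_eq hxy with ⟨hx, hy⟩ | ⟨hx, hy⟩
    · exact absurd ⟨by rw [h0, hx], by rw [h1, hy]⟩ hc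
    · simp [h0, h1, hx, hy]

/-- The reparametrization `r` is the identity or t ↦ 1 - t. Only its being an involution with
constant nonzero derivative is used, so the two orientations need not be distinguished again. -/
theorem orientedEdge_spec (f : GenericImmersion G) (src tgt : β → α) (e : β) :
    ∃ (r : ℝ → ℝ) (σ : ℝ), σ ≠ 0 ∧ (∀ t, HasDerivAt r σ t) ∧ (∀ t, r (r t) = t) ∧
      (∀ t ∈ Icc (0 : ℝ) 1, r t ∈ Icc (0 : ℝ) 1) ∧ (∀ t ∈ Ioo (0 : ℝ) 1, r t ∈ Ioo (0 : ℝ) 1) ∧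
      ∀ t, f.orientedEdge src tgt e t = toC (f.edge e (r t)) := by
  by_cases hc : f.edge e 0 = f.vert (src e) ∧ f.edge e 1 = f.vert (tgt e)
  · exact ⟨id, 1, one_ne_zero, fun t => hasDerivAt_id t, fun t => rfl, fun t ht => ht,
      fun t ht => ht, fun t => by rw [orientedEdge, if_pos hc]; rfl⟩
  · refine ⟨fun t => 1 - t, -1, by norm_num, fun t => ?_, fun t => by ring,
      fun t ht => ⟨by linarith [ht.2], by linarith [ht.1]⟩,
      fun t ht => ⟨by linarith [ht.2], by linarith [ht.1]⟩,
      fun t => by rw [orientedEdge, if_neg hc]⟩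
    simpa using (hasDerivAt_id t).const_sub 1

theorem continuousOn_orientedEdge (f : GenericImmersion G) {e : β} (he : e ∈ G.edgeSet) :
    ContinuousOn (f.orientedEdge src tgt e) (Icc 0 1) := by
  obtain ⟨r, σ, hσ, hr, hrr, hI, hI', hc⟩ := f.orientedEdge_spec src tgt e
  have : f.orientedEdge src tgt e = fun t => toC (f.edge e (r t)) := funext hc
  rw [this]
  exact toC.continuous.comp_continuousOn ((f.continuousOn_edge he).comp
    (fun t _ => (hr t).continuousAt.continuousWithinAt) hI)

theorem edge_eq_vert (f : GenericImmersion G) {e : β} (he : e ∈ G.edgeSet) {v : α}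
    (hv : v ∈ G.vertexSet) {t : ℝ} (ht : t ∈ Icc (0 : ℝ) 1) (h : f.edge e t = f.vert v) :
    (t = 0 ∨ t = 1) ∧ G.Inc e v := by
  by_cases hto : t ∈ Ioo (0 : ℝ) 1
  · have := f.vertex_simple v hv (Sum.inr (e, t)) (inr_mem_pointSet.2 ⟨he, hto⟩) h
    exact absurd this (by simp)
  · have h01 : t = 0 ∨ t = 1 := by
      by_contra! hne
      exact hto ⟨lt_of_le_of_ne ht.1 (Ne.symm hne.1), lt_of_le_of_ne ht.2 hne.2⟩
    refine ⟨h01, ?_⟩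
    obtain ⟨x, y, hxy, h0, h1⟩ := f.ends e he
    rcases h01 with rfl | rfl
    · have := f.vertex_simple v hv (Sum.inl x) (inl_mem_pointSet.2 hxy.left_mem) (h0.symm.trans h)
      rw [← Sum.inl.inj this]
      exact hxy.inc_left
    · have := f.vertex_simple v hv (Sum.inl y) (inl_mem_pointSet.2 hxy.right_mem) (h1.symm.trans h)
      rw [← Sum.inl.inj this]
      exact hxy.inc_right

theorem orientedEdge_ne_vert (f : GenericImmersion G) {e : β} (he : e ∈ G.edgeSet) {v : α}
    (hv : v ∈ G.vertexSet) (hev : ¬ G.Inc e v) {t : ℝ} (ht : t ∈ Icc (0 : ℝ) 1) :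
    f.orientedEdge src tgt e t ≠ toC (f.vert v) := by
  obtain ⟨r, σ, hσ, hr, hrr, hI, hI', hc⟩ := f.orientedEdge_spec src tgt e
  rw [hc]
  intro h
  exact hev (f.edge_eq_vert he hv (hI t ht) (toC.injective h)).2

/-- The variation of the logarithm along the edge `e`, as seen from the image of `u`. -/
noncomputable def edgeVar (f : GenericImmersion G) (src tgt : β → α) (e : β) (u : α) : ℂ :=
  logVar (fun t => f.orientedEdge src tgt e t - toC (f.vert u)) 0 1

theorem exp_edgeVar (f : GenericImmersion G) {e : β} (h : G.IsLink e (src e) (tgt e)) {v : α}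
    (hv : v ∈ G.vertexSet) (hev : ¬ G.Inc e v) :
    Complex.exp (f.edgeVar src tgt e v) = (toC (f.vert (tgt e)) - toC (f.vert v)) /
      (toC (f.vert (src e)) - toC (f.vert v)) := by
  rw [edgeVar, exp_logVar (γ := fun t => f.orientedEdge src tgt e t - toC (f.vert v)) zero_le_one
    ((f.continuousOn_orientedEdge h.edge_mem).sub
    continuousOn_const) fun t ht => sub_ne_zero.2 (f.orientedEdge_ne_vert h.edge_mem hv hev ht),
    (f.orientedEdge_ends h).1, (f.orientedEdge_ends h).2]

theorem crossings_image_eq (f : GenericImmersion G) {d e : β} (hde : d ≠ e) :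
    toC '' f.crossings s(d, e) =
      f.orientedEdge src tgt d '' Ioo 0 1 ∩ f.orientedEdge src tgt e '' Ioo 0 1 := by
  obtain ⟨r, -, -, -, hrr, -, hI, hc⟩ := f.orientedEdge_spec src tgt d
  obtain ⟨r', -, -, -, hrr', -, hI', hc'⟩ := f.orientedEdge_spec src tgt e
  ext q
  constructor
  · rintro ⟨_, ⟨d', t, e', t', hs, ht, ht', -, rfl, h⟩, rfl⟩
    rcases Sym2.eq_iff.1 hs with ⟨rfl, rfl⟩ | ⟨rfl, rfl⟩
    · exact ⟨⟨r t, hI t ht, by rw [hc, hrr]⟩, ⟨r' t', hI' t' ht', by rw [hc', hrr', h]⟩⟩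
    · exact ⟨⟨r t', hI t' ht', by rw [hc, hrr, h]⟩, ⟨r' t, hI' t ht, by rw [hc', hrr']⟩⟩
  · rintro ⟨⟨t, ht, rfl⟩, ⟨t', ht', h⟩⟩
    rw [hc, hc'] at h
    refine ⟨f.edge d (r t), ⟨d, r t, e, r' t', rfl, hI t ht, hI' t' ht', ?_, rfl,
      toC.injective h⟩, (hc t).symm⟩
    exact fun h => hde (congrArg Prod.fst h)

/-- Without a common end, neither edge passes through an end of the other, so all four variations
make sense and `curves_parity` applies. -/
theorem crossings_parity (f : GenericImmersion G) {d e : β} (hd : G.IsLink d (src d) (tgt d))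
    (he : G.IsLink e (src e) (tgt e)) (hdisj : ∀ v, G.Inc d v → ¬ G.Inc e v) :
    ∃ k : ℤ, f.edgeVar src tgt d (src e) + f.edgeVar src tgt e (tgt d)
      - f.edgeVar src tgt d (tgt e) - f.edgeVar src tgt e (src d) =
      2 * Real.pi * Complex.I * ((f.crossings s(d, e)).ncard + 2 * k) := by
  have hde : d ≠ e := by
    rintro rfl
    exact hdisj _ hd.inc_left hd.inc_left
  have himg := f.crossings_image_eq (src := src) (tgt := tgt) hde
  have hcard : (f.crossings s(d, e)).ncard = (toC '' f.crossings s(d, e)).ncard :=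
    (toC.injective.injOn.ncard_image).symm
  have hfin : (f.crossings s(d, e)).Finite :=
    f.crossings_finite (by simp [hd.edge_mem, he.edge_mem])
  rw [hcard, himg]
  simp only [edgeVar]
  rw [← (f.orientedEdge_ends hd).1, ← (f.orientedEdge_ends hd).2, ← (f.orientedEdge_ends he).1,
    ← (f.orientedEdge_ends he).2]
  have hd' : ∀ v, G.Inc e v → ¬ G.Inc d v := fun v h h' => hdisj v h' h
  have hmem : ∀ {s : ℝ} {c : β}, c ∈ G.edgeSet → s ∈ Ioo (0 : ℝ) 1 →
      (Sum.inr (c, s) : α ⊕ β × ℝ) ∈ pointSet G := fun hc hs => inr_mem_pointSet.2 ⟨hc, hs⟩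
  obtain ⟨r, σ, hσ, hr, hrr, -, hI, hc⟩ := f.orientedEdge_spec src tgt d
  obtain ⟨r', σ', hσ', hr', hrr', -, hI', hc'⟩ := f.orientedEdge_spec src tgt e
  refine curves_parity (f.continuousOn_orientedEdge hd.edge_mem)
    (f.continuousOn_orientedEdge he.edge_mem) (fun t ht => ⟨?_, ?_, ?_, ?_⟩) ?_ ?_ ?_
  · rw [(f.orientedEdge_ends he).1]
    exact f.orientedEdge_ne_vert hd.edge_mem he.left_mem (hd' _ he.inc_left) ht
  · rw [(f.orientedEdge_ends he).2]
    exact f.orientedEdge_ne_vert hd.edge_mem he.right_mem (hd' _ he.inc_right) ht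
  · rw [(f.orientedEdge_ends hd).1]
    exact f.orientedEdge_ne_vert he.edge_mem hd.left_mem (hdisj _ hd.inc_left) ht
  · rw [(f.orientedEdge_ends hd).2]
    exact f.orientedEdge_ne_vert he.edge_mem hd.right_mem (hdisj _ hd.inc_right) ht
  · rw [← himg]
    exact hfin.image _
  · intro s hs s' hs' t ht t' ht' h1 h2 h3
    simp only [hc, hc', toC.injective.eq_iff] at h1 h2 h3
    have A := f.double _ (hmem hd.edge_mem (hI s hs)) _ (hmem hd.edge_mem (hI s' hs')) _
      (hmem he.edge_mem (hI' t ht)) h3 (h3.symm.trans h1)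
    have B := f.double _ (hmem hd.edge_mem (hI s hs)) _ (hmem he.edge_mem (hI' t ht)) _
      (hmem he.edge_mem (hI' t' ht')) h1 (h1.symm.trans (h3.trans h2))
    simp only [Sum.inr.injEq, Prod.mk.injEq, hde, false_and, or_false, true_and,
      false_or] at A B
    exact ⟨by rw [← hrr s, A, hrr], by rw [← hrr' t, B, hrr']⟩
  · intro s hs t ht h
    have h' := h
    simp only [hc, hc', toC.injective.eq_iff] at h'
    have htr := f.transversal d hd.edge_mem e he.edge_mem _ (hI s hs) _ (hI' t ht)
      (fun h => hde (congrArg Prod.fst h)) h'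
    have A := (toC.toContinuousLinearEquiv : Plane →L[ℝ] ℂ).hasFDerivAt.comp_hasDerivAt s
      ((f.hasStrictDerivAt_edge hd.edge_mem (hI s hs)).hasDerivAt.scomp s (hr s))
    have B := (toC.toContinuousLinearEquiv : Plane →L[ℝ] ℂ).hasFDerivAt.comp_hasDerivAt t
      ((f.hasStrictDerivAt_edge he.edge_mem (hI' t ht)).hasDerivAt.scomp t (hr' t))
    refine ⟨_, _, A.congr_of_eventuallyEq (Eventually.of_forall hc),
      B.congr_of_eventuallyEq (Eventually.of_forall hc'), ?_⟩
    exact (linearIndependent_pair_map (toC.toLinearEquiv : Plane →ₗ[ℝ] ℂ) toC.injective).2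
      (linearIndependent_pair_smul htr hσ hσ')

/-- The difference of the weighted crossing numbers of two immersions. -/
theorem sum_crossingNumber_sub (hV : G.vertexSet.Finite) (hE : G.edgeSet.Finite)
    (Λ : Finset (Graph α β)) (hΛ : ∀ H ∈ Λ, H ≤ G) (m : ℕ)
    (h1 : ∀ e ∈ G.edgeSet, m ∣ countContaining Λ e e)
    (h2 : ∀ d ∈ G.edgeSet, ∀ e ∈ G.edgeSet, d ≠ e → m ∣ 2 * countContaining Λ d e)
    (h4 : ∀ d ∈ G.edgeSet, ∀ e ∈ G.edgeSet, AdjacentEdges G d e → m ∣ countContaining Λ d e)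
    (f g : GenericImmersion G) (hlink : ∀ e ∈ G.edgeSet, G.IsLink e (src e) (tgt e))
    (θ : α → α → ℂ) (hθ : ∀ u ∈ G.vertexSet, ∀ v ∈ G.vertexSet, θ u v = θ v u)
    (φ : β → α → ℤ) (hφ : ∀ e ∈ G.edgeSet, ∀ u ∈ G.vertexSet, ¬ G.Inc e u →
      f.edgeVar src tgt e u - g.edgeVar src tgt e u - θ (tgt e) u + θ (src e) u =
        2 * Real.pi * Complex.I * φ e u) :
    ((∑ H ∈ Λ, f.crossingNumber H : ℕ) : ZMod m) - ((∑ H ∈ Λ, g.crossingNumber H : ℕ) : ZMod m) =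
      ∑ e ∈ hE.toFinset, ∑ u ∈ hV.toFinset, (φ e u : ZMod m) *
        ((∑ d ∈ hE.toFinset, endsAt G u d * countContaining Λ e d : ℕ) : ZMod m) := by
  classical
  have hcomm : ∀ d e, countContaining Λ d e = countContaining Λ e d := fun d e => by
    rw [← pairCount_mk, ← pairCount_mk, Sym2.eq_swap]
  -- The part of the change of the pair {d, e} that is due to `e` as seen from the two ends of `d`.
  set c : β → β → ZMod m := fun d e =>
    (countContaining Λ d e : ZMod m) * ((φ e (src d) : ZMod m) + (φ e (tgt d) : ZMod m)) with hc
  have hz1 : ∀ e ∈ G.edgeSet, (countContaining Λ e e : ZMod m) = 0 := fun e he =>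
    (ZMod.natCast_eq_zero_iff _ _).2 (h1 e he)
  have key : ∑ s ∈ hE.toFinset.sym2, ((pairCount Λ s : ZMod m) * (f.crossings s).ncard -
      (pairCount Λ s : ZMod m) * (g.crossings s).ncard) =
      ∑ d ∈ hE.toFinset, ∑ e ∈ hE.toFinset, c d e := by
    refine sum_sym2_eq_sum_sum _ c _ (fun e he => ?_) fun d hd e he hde => ?_
    · rw [Set.Finite.mem_toFinset] at he
      simp [hc, pairCount_mk, hz1 e he]
    · rw [Set.Finite.mem_toFinset] at hd he
      simp only [hc, pairCount_mk, hcomm e d]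
      by_cases hadj : AdjacentEdges G d e
      · rw [(ZMod.natCast_eq_zero_iff _ _).2 (h4 d hd e he hadj)]
        simp
      have hdisj : ∀ v, G.Inc d v → ¬ G.Inc e v := fun v hv hv' => hadj ⟨hde, v, hv, hv'⟩
      have hld := hlink d hd
      have hle := hlink e he
      obtain ⟨kf, hkf⟩ := f.crossings_parity hld hle hdisj
      obtain ⟨kg, hkg⟩ := g.crossings_parity hld hle hdisj
      have hd' : ∀ v, G.Inc e v → ¬ G.Inc d v := fun v h h' => hdisj v h' h
      have p1 := hφ d hd _ hle.left_mem (hd' _ hle.inc_left)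
      have p2 := hφ d hd _ hle.right_mem (hd' _ hle.inc_right)
      have p3 := hφ e he _ hld.left_mem (hdisj _ hld.inc_left)
      have p4 := hφ e he _ hld.right_mem (hdisj _ hld.inc_right)
      have t1 := hθ _ hld.left_mem _ hle.left_mem
      have t2 := hθ _ hld.left_mem _ hle.right_mem
      have t3 := hθ _ hld.right_mem _ hle.left_mem
      have t4 := hθ _ hld.right_mem _ hle.right_mem
      have hpi : (2 * Real.pi * Complex.I : ℂ) ≠ 0 := by simp [Real.pi_ne_zero]
      have hint : ((f.crossings s(d, e)).ncard : ℤ) - (g.crossings s(d, e)).ncard =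
          φ d (src e) + φ e (tgt d) - φ d (tgt e) - φ e (src d) - 2 * (kf - kg) := by
        have : (2 * Real.pi * Complex.I : ℂ) *
            (((f.crossings s(d, e)).ncard : ℂ) - (g.crossings s(d, e)).ncard) =
            (2 * Real.pi * Complex.I) *
            (φ d (src e) + φ e (tgt d) - φ d (tgt e) - φ e (src d) - 2 * (kf - kg)) := by
          -- Each of the four pairs of an end of `d` and an end of `e` contributes two θ-terms of
          -- opposite sign, which cancel by symmetry of θ.
          linear_combination hkg - hkf + p1 - p2 - p3 + p4 + t3 - t1 - t4 + t2
        exact_mod_cast mul_left_cancel₀ hpi this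
      have hz2 : (2 : ZMod m) * countContaining Λ d e = 0 := by
        have := (ZMod.natCast_eq_zero_iff _ _).2 (h2 d hd e he hde)
        exact_mod_cast this
      have hint' : (((f.crossings s(d, e)).ncard : ℤ) : ZMod m) - ((g.crossings s(d, e)).ncard : ℤ) =
          φ d (src e) + φ e (tgt d) - φ d (tgt e) - φ e (src d) - 2 * (kf - kg) := by
        exact_mod_cast congrArg (Int.cast : ℤ → ZMod m) hint
      push_cast at hint'
      -- Twice the count vanishes in `ZMod m`, so signs and the even error term 2(kf - kg) do not
      -- matter.
      linear_combination (countContaining Λ d e : ZMod m) * hint' -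
        (φ d (tgt e) + φ e (src d) + (kf - kg)) * hz2
  rw [f.sum_crossingNumber hE Λ hΛ, g.sum_crossingNumber hE Λ hΛ]
  push_cast
  rw [← Finset.sum_sub_distrib, key, Finset.sum_comm]
  refine Finset.sum_congr rfl fun e he => ?_
  rw [Set.Finite.mem_toFinset] at he
  have : ∀ u, (φ e u : ZMod m) * ∑ d ∈ hE.toFinset, (endsAt G u d : ZMod m) * countContaining Λ e d =
      ∑ d ∈ hE.toFinset, (endsAt G u d : ZMod m) * ((φ e u : ZMod m) * countContaining Λ e d) := by
    intro u
    rw [Finset.mul_sum]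
    exact Finset.sum_congr rfl fun d _ => by ring
  rw [Finset.sum_congr rfl fun u _ => this u, Finset.sum_comm]
  refine Finset.sum_congr rfl fun d hd => ?_
  rw [Set.Finite.mem_toFinset] at hd
  rw [sum_endsAt_mul (hlink d hd) _ (by simp), hcomm e d]
  ring

/-- It remains to find θ and φ. Exponentials of variations are quotients of end values, so their
dependence on the vertex positions is removed by the logarithms θ, and what is left is an integer
multiple of 2πi. -/
theorem sum_crossingNumber_modEq (hV : G.vertexSet.Finite) (hE : G.edgeSet.Finite)
    (Λ : Finset (Graph α β)) (hΛ : ∀ H ∈ Λ, H ≤ G) (m : ℕ)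
    (h1 : ∀ e ∈ G.edgeSet, m ∣ countContaining Λ e e)
    (h2 : ∀ d ∈ G.edgeSet, ∀ e ∈ G.edgeSet, d ≠ e → m ∣ 2 * countContaining Λ d e)
    (h3 : ∀ v ∈ G.vertexSet, ∀ e ∈ G.edgeSet,
        m ∣ ∑ e' ∈ hE.toFinset, endsAt G v e' * countContaining Λ e e')
    (h4 : ∀ d ∈ G.edgeSet, ∀ e ∈ G.edgeSet, AdjacentEdges G d e → m ∣ countContaining Λ d e)
    (f g : GenericImmersion G) :
    ∑ H ∈ Λ, f.crossingNumber H ≡ ∑ H ∈ Λ, g.crossingNumber H [MOD m] := by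
  classical
  -- A vertex is needed as a default value of `src` and `tgt` outside the edge set; without vertices
  -- there are no edges and no crossings.
  rcases isEmpty_or_nonempty α with hα | hα
  · have : ∀ f : GenericImmersion G, ∀ H ∈ Λ, f.crossingNumber H = 0 := by
      intro f H hH
      rw [crossingNumber, f.multiplePoints_eq (hΛ H hH)]
      rw [show {q | ∃ s : Sym2 β, (∀ e ∈ s, e ∈ H.edgeSet) ∧ q ∈ f.crossings s} = ∅ from ?_,
        ncard_empty]
      rw [eq_empty_iff_forall_notMem]
      rintro q ⟨s, hs, -⟩
      induction s using Sym2.ind with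
      | _ x y =>
        obtain ⟨a, b, hab⟩ := Graph.exists_isLink_of_mem_edgeSet (hs x (by simp))
        exact hα.elim a
    rw [Finset.sum_congr rfl (this f), Finset.sum_congr rfl (this g)]
  have hlink : ∀ e, ∃ p : α × α, e ∈ G.edgeSet → G.IsLink e p.1 p.2 := by
    intro e
    by_cases he : e ∈ G.edgeSet
    · obtain ⟨x, y, h⟩ := Graph.exists_isLink_of_mem_edgeSet he
      exact ⟨(x, y), fun _ => h⟩
    · exact ⟨Classical.arbitrary _, fun h => absurd h he⟩
  choose p hp using hlink
  set src := fun e => (p e).1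
  set tgt := fun e => (p e).2
  have hne : ∀ (f : GenericImmersion G) {u v}, u ∈ G.vertexSet → v ∈ G.vertexSet → u ≠ v →
      toC (f.vert u) - toC (f.vert v) ≠ 0 := by
    intro f u v hu hv huv h
    have := f.vertex_simple v hv (Sum.inl u) (inl_mem_pointSet.2 hu)
      (toC.injective (sub_eq_zero.1 h))
    exact huv (Sum.inl.inj this)
  -- Interchanging `u` and `v` changes both differences by a sign and leaves the quotient unchanged,
  -- so θ is symmetric; any branch of the logarithm would do.
  set θ : α → α → ℂ := fun u v => Complex.log ((toC (f.vert u) - toC (f.vert v)) /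
    (toC (g.vert u) - toC (g.vert v))) with hθ
  have hφ : ∀ e u, ∃ n : ℤ, (e ∈ G.edgeSet → u ∈ G.vertexSet → ¬ G.Inc e u →
      f.edgeVar src tgt e u - g.edgeVar src tgt e u - θ (tgt e) u + θ (src e) u =
        2 * Real.pi * Complex.I * n) := by
    intro e u
    by_cases h : e ∈ G.edgeSet ∧ u ∈ G.vertexSet ∧ ¬ G.Inc e u
    · obtain ⟨he, hu, heu⟩ := h
      have hl : G.IsLink e (src e) (tgt e) := hp e he
      have hs : src e ≠ u := fun h => heu (h ▸ hl.inc_left)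
      have ht : tgt e ≠ u := fun h => heu (h ▸ hl.inc_right)
      have hexp : Complex.exp (f.edgeVar src tgt e u - g.edgeVar src tgt e u - θ (tgt e) u
          + θ (src e) u) = 1 := by
        rw [Complex.exp_add, Complex.exp_sub, Complex.exp_sub, f.exp_edgeVar hl hu heu,
          g.exp_edgeVar hl hu heu, hθ]
        have a1 := hne f hl.left_mem hu hs
        have a2 := hne f hl.right_mem hu ht
        have a3 := hne g hl.left_mem hu hs
        have a4 := hne g hl.right_mem hu ht
        simp only
        rw [Complex.exp_log (div_ne_zero a2 a4), Complex.exp_log (div_ne_zero a1 a3)]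
        field_simp
      obtain ⟨n, hn⟩ := Complex.exp_eq_one_iff.1 hexp
      exact ⟨n, fun _ _ _ => by rw [hn]; ring⟩
    -- For incident `e` and `u` the value is arbitrary: there it only meets coefficients that vanish
    -- modulo `m`.
    · exact ⟨0, fun a b c => absurd ⟨a, b, c⟩ h⟩
  choose φ hφ using hφ
  have := sum_crossingNumber_sub hV hE Λ hΛ m h1 h2 h4 f g (src := src) (tgt := tgt) hp θ
    (fun u _ v _ => by
      simp only [hθ]
      rw [← neg_sub (toC (f.vert v)), ← neg_sub (toC (g.vert v)), neg_div_neg_eq]) φ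
    (fun e he u hu heu => hφ e u he hu heu)
  rw [← ZMod.natCast_eq_natCast_iff, ← sub_eq_zero, this]
  refine Finset.sum_eq_zero fun e he => Finset.sum_eq_zero fun u hu => ?_
  rw [Set.Finite.mem_toFinset] at he hu
  rw [(ZMod.natCast_eq_zero_iff _ _).2 (h3 u hu e he), mul_zero]

end GenericImmersion

/-! ### Sard's theorem and parametric transversality -/

/-- Sard's theorem for maps into a space of at least the same dimension. -/
theorem addHaar_image_eq_zero_of_not_surjective {A P : Type*} [NormedAddCommGroup A]
    [NormedSpace ℝ A] [FiniteDimensional ℝ A] [NormedAddCommGroup P] [NormedSpace ℝ P]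
    [FiniteDimensional ℝ P] [MeasurableSpace P] [BorelSpace P] (μ : Measure P) [μ.IsAddHaarMeasure]
    (hdim : Module.finrank ℝ A ≤ Module.finrank ℝ P) {f : A → P} {f' : A → A →L[ℝ] P} {s : Set A}
    (hf : ∀ x ∈ s, HasFDerivAt f (f' x) x) (hs : ∀ x ∈ s, ¬ Function.Surjective (f' x)) :
    μ (f '' s) = 0 := by
  obtain ⟨i, hi⟩ := finrank_le_iff_exists_linearMap.1 hdim
  obtain ⟨π, hπ⟩ := LinearMap.exists_leftInverse_of_injective i (LinearMap.ker_eq_bot.2 hi)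
  have hπi : ∀ x, π (i x) = x := fun x => by simpa using LinearMap.congr_fun hπ x
  set πc : P →L[ℝ] A := LinearMap.toContinuousLinearMap π with hπc
  -- Composing with a projection `P → A` gives a map of `P` to itself with the same image, whose
  -- differential is not surjective and so has determinant zero.
  have himg : f '' s = (f ∘ πc) '' (πc ⁻¹' s) := by
    ext y
    constructor
    · rintro ⟨x, hx, rfl⟩
      exact ⟨i x, by simpa [hπc, hπi] using hx, by simp [hπc, hπi]⟩
    · rintro ⟨x, hx, rfl⟩
      exact ⟨πc x, hx, rfl⟩
  rw [himg]
  refine addHaar_image_eq_zero_of_det_fderivWithin_eq_zero μ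
    (f' := fun x => (f' (πc x)).comp πc)
    (fun x hx => ((hf _ hx).comp x πc.hasFDerivAt).hasFDerivWithinAt) fun x hx => ?_
  by_contra hdet
  refine hs _ hx fun y => ?_
  have hsurj := (LinearMap.equivOfDetNeZero _ hdet).surjective y
  obtain ⟨z, hz⟩ := hsurj
  exact ⟨πc z, hz⟩

/-- Near x₀ the solution set of L x a + ψ x = 0 is a graph over X × ker (L x₀), and `T` is its
projection to the parameter space. A bad parameter is a critical value of `T`. Since dim X ≤ dim Y,
the source of `T` has at most the dimension of `P`, so `addHaar_image_eq_zero_of_not_surjective`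
suffices. -/
theorem exists_nhds_ae_surjective_fderiv {P X Y : Type*} [NormedAddCommGroup P] [NormedSpace ℝ P]
    [FiniteDimensional ℝ P] [MeasurableSpace P] [BorelSpace P] (μ : Measure P) [μ.IsAddHaarMeasure]
    [NormedAddCommGroup X] [NormedSpace ℝ X] [FiniteDimensional ℝ X]
    [NormedAddCommGroup Y] [NormedSpace ℝ Y] [FiniteDimensional ℝ Y]
    (hdim : Module.finrank ℝ X ≤ Module.finrank ℝ Y)
    {L : X → P →L[ℝ] Y} {ψ : X → Y} (hL : ContDiff ℝ 1 L) (hψ : ContDiff ℝ 1 ψ) (x₀ : X)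
    (hx₀ : Function.Surjective (L x₀)) :
    ∃ U ∈ 𝓝 x₀, ∀ᵐ a ∂μ, ∀ x ∈ U, L x a + ψ x = 0 →
      Function.Surjective (fderiv ℝ (fun x => L x a + ψ x) x) := by
  obtain ⟨R, hR⟩ := (L x₀).toLinearMap.exists_rightInverse_of_surjective (LinearMap.range_eq_top.2 hx₀)
  set Rc : Y →L[ℝ] P := LinearMap.toContinuousLinearMap R with hRc
  have hLR : (L x₀).comp Rc = ContinuousLinearMap.id ℝ Y := by
    ext y
    exact LinearMap.congr_fun hR y
  set M : X → Y →L[ℝ] Y := fun x => (L x).comp Rc with hM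
  have hMc : ContDiff ℝ 1 M := hL.clm_comp contDiff_const
  set K := LinearMap.ker (L x₀).toLinearMap with hK
  -- Starting from a point of the kernel, the equation is restored by a correction in the range of
  -- the right inverse `Rc`, along which `L x` stays invertible for `x` near `x₀`.
  set T : X × K → P := fun p =>
    (p.2 : P) - Rc ((M p.1).inverse (L p.1 p.2 + ψ p.1)) with hT
  set U : Set X := {x | (M x).IsInvertible} with hU
  have hU' : U ∈ 𝓝 x₀ := by
    have h1 : (M x₀).IsInvertible := ⟨ContinuousLinearEquiv.refl ℝ Y, by
      simp only [hM, hLR]; rfl⟩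
    have hopen : IsOpen (range ((↑) : (Y ≃L[ℝ] Y) → Y →L[ℝ] Y)) := ContinuousLinearEquiv.isOpen
    exact hMc.continuous.continuousAt (hopen.mem_nhds h1)
  have hUM : ∀ x ∈ U, ∀ y, M x ((M x).inverse y) = y := by
    rintro x ⟨e, he⟩ y
    rw [← he]
    simp
  have hUM' : ∀ x ∈ U, ∀ y, (M x).inverse (M x y) = y := by
    rintro x ⟨e, he⟩ y
    rw [← he]
    simp
  have hTd : ∀ p : X × K, p.1 ∈ U → DifferentiableAt ℝ T p := by
    rintro ⟨x, κ⟩ hx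
    have h1 : ContDiffAt ℝ 1 (fun p : X × K => (M p.1).inverse) (x, κ) := by
      have := ContinuousLinearMap.IsInvertible.contDiffAt_map_inverse (𝕜 := ℝ) (n := 1) hx
      exact this.comp (x, κ) (hMc.contDiffAt.comp (x, κ) contDiffAt_fst)
    have h2 : ContDiffAt ℝ 1 (fun p : X × K => L p.1 (p.2 : P) + ψ p.1) (x, κ) := by
      refine ContDiffAt.add ?_ (hψ.contDiffAt.comp (x, κ) contDiffAt_fst)
      refine ContDiffAt.clm_apply (hL.contDiffAt.comp (x, κ) contDiffAt_fst) ?_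
      exact (K.subtypeL.contDiff.comp contDiff_snd).contDiffAt
    have h3 : ContDiffAt ℝ 1 T (x, κ) := by
      refine ContDiffAt.sub ?_ ?_
      · exact (K.subtypeL.contDiff.comp contDiff_snd).contDiffAt
      · exact Rc.contDiff.contDiffAt.comp (x, κ) (h1.clm_apply h2)
    exact h3.differentiableAt (by simp)
  have hLT : ∀ p : X × K, p.1 ∈ U → L p.1 (T p) + ψ p.1 = 0 := by
    rintro ⟨x, κ⟩ hx
    have := hUM x hx (L x κ + ψ x)
    simp only [hT, map_sub]
    have e : L x (Rc ((M x).inverse (L x κ + ψ x))) = L x κ + ψ x := this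
    rw [e]
    abel
  have hdimK : Module.finrank ℝ (X × K) ≤ Module.finrank ℝ P := by
    have h1 := (L x₀).toLinearMap.finrank_range_add_finrank_ker
    rw [LinearMap.range_eq_top.2 hx₀, finrank_top] at h1
    have h2 : Module.finrank ℝ K = Module.finrank ℝ (LinearMap.ker (L x₀).toLinearMap) := rfl
    rw [Module.finrank_prod, h2]
    omega
  refine ⟨interior U, interior_mem_nhds.2 hU', ?_⟩
  have hnull := addHaar_image_eq_zero_of_not_surjective μ hdimK (f := T) (f' := fun p => fderiv ℝ T p)
    (s := {p | p.1 ∈ interior U ∧ ¬ Function.Surjective (fderiv ℝ T p)})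
    (fun p hp => (hTd p (interior_subset hp.1)).hasFDerivAt) (fun p hp => hp.2)
  rw [ae_iff]
  refine measure_mono_null ?_ hnull
  intro a ha
  simp only [mem_ofPred_eq, not_forall] at ha
  obtain ⟨x, hx, h0, hns⟩ := ha
  have hxU := interior_subset hx
  have hκ : a - Rc (L x₀ a) ∈ K := by
    have := congrArg (fun T : Y →L[ℝ] Y => T (L x₀ a)) hLR
    simp only [ContinuousLinearMap.comp_apply, ContinuousLinearMap.id_apply] at this
    rw [hK, LinearMap.mem_ker]
    simp [this]
  -- Every solution is on the graph: its kernel coordinate is the projection of `a` along the range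
  -- of `Rc`.
  have hTa : T (x, ⟨a - Rc (L x₀ a), hκ⟩) = a := by
    simp only [hT]
    have e : L x (a - Rc (L x₀ a)) + ψ x = M x (-(L x₀ a)) := by
      rw [map_sub, map_neg, sub_add_eq_add_sub, h0]
      simp [hM]
    rw [e, hUM' x hxU]
    simp
  refine ⟨(x, ⟨a - Rc (L x₀ a), hκ⟩), ⟨hx, fun hsurj => hns ?_⟩, hTa⟩
  set p : X × K := (x, ⟨a - Rc (L x₀ a), hκ⟩) with hp
  -- differentiate the identity `L x (T (x, κ)) + ψ x = 0`
  have hd1 : HasFDerivAt (fun q : X × K => L q.1 (T q) + ψ q.1) (0 : X × K →L[ℝ] Y) p := by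
    refine (hasFDerivAt_const (0 : Y) p).congr_of_eventuallyEq ?_
    have : ∀ᶠ q : X × K in 𝓝 p, q.1 ∈ interior U :=
      continuous_fst.continuousAt (isOpen_interior.mem_nhds hx)
    filter_upwards [this] with q hq using hLT q (interior_subset hq)
  have hLd : HasFDerivAt L (fderiv ℝ L x) x := (hL.differentiable (by simp) x).hasFDerivAt
  have hψd : HasFDerivAt ψ (fderiv ℝ ψ x) x := (hψ.differentiable (by simp) x).hasFDerivAt
  have hLd' : HasFDerivAt (fun q : X × K => L q.1) ((fderiv ℝ L x).comp (ContinuousLinearMap.fst ℝ X K)) p :=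
    HasFDerivAt.comp p hLd hasFDerivAt_fst
  have hψd' : HasFDerivAt (fun q : X × K => ψ q.1) ((fderiv ℝ ψ x).comp (ContinuousLinearMap.fst ℝ X K)) p :=
    HasFDerivAt.comp p hψd hasFDerivAt_fst
  have hd2 := (hLd'.clm_apply (hTd p hxU).hasFDerivAt).add hψd'
  have hd3 := (hLd.clm_apply (hasFDerivAt_const a x)).add hψd
  have hd4 : fderiv ℝ (fun x => L x a + ψ x) x = _ := HasFDerivAt.fderiv hd3
  rw [hd4]
  intro y
  -- A tangent vector is chosen whose parameter component is sent to -y by `L x`; the differentiated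
  -- identity then forces its `X`-component to be sent to y.
  obtain ⟨⟨x', κ'⟩, hq⟩ := hsurj (Rc ((M x).inverse (-y)))
  have hb : L x (fderiv ℝ T p (x', κ')) = -y := by
    rw [hq]
    exact hUM x hxU _
  have he := congrArg (fun D : X × K →L[ℝ] Y => D (x', κ')) (hd1.unique hd2)
  refine ⟨x', ?_⟩
  simp only [zero_apply, add_apply, ContinuousLinearMap.comp_apply, ContinuousLinearMap.flip_apply,
    ContinuousLinearMap.coe_fst', hTa] at he
  simp only [add_apply, ContinuousLinearMap.comp_apply, ContinuousLinearMap.flip_apply,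
    zero_apply, map_zero, zero_add]
  have hp1 : p.1 = x := rfl
  rw [hp1, hb] at he
  exact (neg_add_eq_zero.1 (by rw [← add_assoc]; exact he.symm)).symm

/-- Parametric transversality for maps which depend affinely on the parameter. -/
theorem ae_surjective_fderiv {P X Y : Type*} [NormedAddCommGroup P] [NormedSpace ℝ P]
    [FiniteDimensional ℝ P] [MeasurableSpace P] [BorelSpace P] (μ : Measure P) [μ.IsAddHaarMeasure]
    [NormedAddCommGroup X] [NormedSpace ℝ X] [FiniteDimensional ℝ X]
    [NormedAddCommGroup Y] [NormedSpace ℝ Y] [FiniteDimensional ℝ Y]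
    (hdim : Module.finrank ℝ X ≤ Module.finrank ℝ Y)
    {L : X → P →L[ℝ] Y} {ψ : X → Y} (hL : ContDiff ℝ 1 L) (hψ : ContDiff ℝ 1 ψ) :
    ∀ᵐ a ∂μ, ∀ x, Function.Surjective (L x) → L x a + ψ x = 0 →
      Function.Surjective (fderiv ℝ (fun x => L x a + ψ x) x) := by
  have : ∀ x, ∃ U : Set X, Function.Surjective (L x) → U ∈ 𝓝 x ∧ ∀ᵐ a ∂μ, ∀ x ∈ U,
      L x a + ψ x = 0 → Function.Surjective (fderiv ℝ (fun x => L x a + ψ x) x) := by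
    intro x
    by_cases hx : Function.Surjective (L x)
    · obtain ⟨U, hU, h⟩ := exists_nhds_ae_surjective_fderiv μ hdim hL hψ x hx
      exact ⟨U, fun _ => ⟨hU, h⟩⟩
    · exact ⟨univ, fun h => absurd h hx⟩
  choose U hU using this
  -- Countably many of the neighbourhoods cover, so the exceptional null sets may be united.
  obtain ⟨t, hts, htc, hcov⟩ := TopologicalSpace.countable_cover_nhdsWithin (f := U)
    (s := {x | Function.Surjective (L x)}) fun x hx => mem_nhdsWithin_of_mem_nhds (hU x hx).1
  filter_upwards [(ae_ball_iff htc).2 fun x hx => (hU x (hts hx)).2] with a ha x hx h0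
  obtain ⟨y, hy, hxy⟩ := mem_iUnion₂.1 (hcov hx)
  exact ha y hy x hxy h0

theorem linearIndependent_pair_of_surjective {v w : ℂ}
    (h : Function.Surjective ((ContinuousLinearMap.fst ℝ ℝ ℝ).smulRight v -
      (ContinuousLinearMap.snd ℝ ℝ ℝ).smulRight w : ℝ × ℝ →L[ℝ] ℂ)) :
    LinearIndependent ℝ ![v, w] := by
  have hinj : Function.Injective (((ContinuousLinearMap.fst ℝ ℝ ℝ).smulRight v -
      (ContinuousLinearMap.snd ℝ ℝ ℝ).smulRight w : ℝ × ℝ →L[ℝ] ℂ) : ℝ × ℝ →ₗ[ℝ] ℂ) :=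
    (LinearMap.injective_iff_surjective_of_finrank_eq_finrank (by simp)).2 h
  rw [LinearIndependent.pair_iff]
  intro s t hst
  have := (injective_iff_map_eq_zero _).1 hinj (s, -t) (by simpa using hst)
  simpa using this

/-! ### Generic perturbations of families of curves -/

section Perturb
variable {ι : Type*}

/-- The perturbation of a family of curves by polynomials of degree two, with weight `W`. -/
noncomputable def perturbed (E : ι → ℝ → ℂ) (W : ℝ → ℝ) (a : ι → Fin 3 → ℂ) (i : ι) (t : ℝ) : ℂ :=
  E i t + W t * (a i 0 + t * a i 1 + t ^ 2 * a i 2)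

/-- The coefficient functional. -/
noncomputable def coeffCLM (i : ι) (j : Fin 3) : (ι → Fin 3 → ℂ) →L[ℝ] ℂ :=
  (ContinuousLinearMap.proj (R := ℝ) (φ := fun _ : Fin 3 => ℂ) j).comp
    (ContinuousLinearMap.proj (R := ℝ) (φ := fun _ : ι => Fin 3 → ℂ) i)

@[simp] theorem coeffCLM_apply (i : ι) (j : Fin 3) (a : ι → Fin 3 → ℂ) :
    coeffCLM i j a = a i j := rfl

/-- The change at `t` of the curve `i` as a linear function of the perturbation. -/
noncomputable def perturbCLM (W : ℝ → ℝ) (i : ι) (t : ℝ) : (ι → Fin 3 → ℂ) →L[ℝ] ℂ :=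
  W t • (coeffCLM i 0 + t • coeffCLM i 1 + t ^ 2 • coeffCLM i 2)

theorem perturbCLM_apply (W : ℝ → ℝ) (i : ι) (t : ℝ) (a : ι → Fin 3 → ℂ) :
    perturbCLM W i t a = W t * (a i 0 + t * a i 1 + t ^ 2 * a i 2) := by
  simp [perturbCLM]
  ring

theorem perturbed_eq (E : ι → ℝ → ℂ) (W : ℝ → ℝ) (a : ι → Fin 3 → ℂ) (i : ι) (t : ℝ) :
    perturbed E W a i t = perturbCLM W i t a + E i t := by
  rw [perturbCLM_apply, perturbed, add_comm]

theorem contDiff_perturbed {E : ι → ℝ → ℂ} (hE : ∀ i, ContDiff ℝ ∞ (E i)) {W : ℝ → ℝ}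
    (hW : ContDiff ℝ ∞ W) (a : ι → Fin 3 → ℂ) (i : ι) : ContDiff ℝ ∞ (perturbed E W a i) := by
  unfold perturbed
  have h1 : ContDiff ℝ ∞ (fun t => (W t : ℂ)) := Complex.ofRealCLM.contDiff.comp hW
  have h2 : ContDiff ℝ ∞ (fun t : ℝ => (t : ℂ)) := Complex.ofRealCLM.contDiff
  have := hE i
  fun_prop

/-- Degree two is the least that can move one point while fixing two others on the same curve: a
multiple of (x - t')(x - u') works. If another point lies on a different curve, its root is replaced
by the dummy `s + 1`. -/
theorem exists_perturbCLM_eq [DecidableEq ι] {W : ℝ → ℝ} {i j k : ι} {s t u : ℝ} (hs : W s ≠ 0)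
    (h1 : (i, s) ≠ (j, t)) (h2 : (i, s) ≠ (k, u)) (z : ℂ) :
    ∃ a : ι → Fin 3 → ℂ, perturbCLM W i s a = z ∧ perturbCLM W j t a = 0 ∧
      perturbCLM W k u a = 0 := by
  obtain ⟨t', ht', ht⟩ : ∃ t' : ℝ, t' ≠ s ∧ (j = i → t = t') := by
    by_cases h : j = i
    · exact ⟨t, fun h' => h1 (by rw [h, h']), fun _ => rfl⟩
    · exact ⟨s + 1, by simp, fun h' => absurd h' h⟩
  obtain ⟨u', hu', hu⟩ : ∃ t' : ℝ, t' ≠ s ∧ (k = i → u = t') := by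
    by_cases h : k = i
    · exact ⟨u, fun h' => h2 (by rw [h, h']), fun _ => rfl⟩
    · exact ⟨s + 1, by simp, fun h' => absurd h' h⟩
  have e1 : (s : ℂ) - t' ≠ 0 := by
    rw [sub_ne_zero]; exact_mod_cast ht'.symm
  have e2 : (s : ℂ) - u' ≠ 0 := by
    rw [sub_ne_zero]; exact_mod_cast hu'.symm
  have e3 : (W s : ℂ) ≠ 0 := by exact_mod_cast hs
  set c : ℂ := z / (W s * ((s - t') * (s - u'))) with hc
  refine ⟨Pi.single i ![c * (t' * u'), - (c * (t' + u')), c], ?_, ?_, ?_⟩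
  · rw [perturbCLM_apply, Pi.single_eq_same]
    simp only [Matrix.cons_val_zero, Matrix.cons_val_one, Matrix.cons_val]
    have : z = c * (W s * ((s - t') * (s - u'))) := by
      rw [hc, div_mul_cancel₀]
      exact mul_ne_zero e3 (mul_ne_zero e1 e2)
    rw [this]
    ring
  · rw [perturbCLM_apply]
    by_cases h : j = i
    · rw [h, Pi.single_eq_same, ht h]
      simp only [Matrix.cons_val_zero, Matrix.cons_val_one, Matrix.cons_val]
      ring
    · rw [Pi.single_eq_of_ne h]
      simp
  · rw [perturbCLM_apply]
    by_cases h : k = i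
    · rw [h, Pi.single_eq_same, hu h]
      simp only [Matrix.cons_val_zero, Matrix.cons_val_one, Matrix.cons_val]
      ring
    · rw [Pi.single_eq_of_ne h]
      simp

variable [Fintype ι]

theorem contDiff_perturbCLM {W : ℝ → ℝ} (hW : ContDiff ℝ ∞ W) (i : ι) :
    ContDiff ℝ ∞ (perturbCLM W i) := by
  unfold perturbCLM
  fun_prop

theorem not_surjective_of_finrank_lt {A B : Type*} [AddCommGroup A] [Module ℝ A]
    [FiniteDimensional ℝ A] [AddCommGroup B] [Module ℝ B] [FiniteDimensional ℝ B]
    (T : A →ₗ[ℝ] B) (h : Module.finrank ℝ A < Module.finrank ℝ B) : ¬ Function.Surjective T :=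
  fun hs => absurd (LinearMap.finrank_le_finrank_of_surjective hs) (not_le.2 h)

theorem deriv_perturbCLM_apply {W : ℝ → ℝ} (hW : ContDiff ℝ ∞ W) (i : ι) (t : ℝ)
    (a : ι → Fin 3 → ℂ) :
    deriv (perturbCLM W i) t a = deriv (fun t => perturbCLM W i t a) t := by
  have h1 : HasDerivAt (perturbCLM W i) (deriv (perturbCLM W i) t) t :=
    ((contDiff_perturbCLM hW i).differentiable (by simp) t).hasDerivAt
  have h2 := (((ContinuousLinearMap.apply ℝ ℂ a).hasFDerivAt).comp_hasDerivAt t h1).deriv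
  exact h2.symm

theorem deriv_perturbed {E : ι → ℝ → ℂ} (hE : ∀ i, ContDiff ℝ ∞ (E i)) {W : ℝ → ℝ}
    (hW : ContDiff ℝ ∞ W) (i : ι) (t : ℝ) (a : ι → Fin 3 → ℂ) :
    deriv (perturbed E W a i) t = deriv (perturbCLM W i) t a + deriv (E i) t := by
  rw [deriv_perturbCLM_apply hW, funext (perturbed_eq E W a i)]
  have h1 : DifferentiableAt ℝ (fun t => perturbCLM W i t a) t :=
    ((contDiff_perturbCLM hW i).clm_apply contDiff_const).differentiable (by simp) t
  exact deriv_add h1 ((hE i).differentiable (by simp) t)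

/-- A linear polynomial vanishing at t changes the velocity there without a contribution from the
derivative of `W`. -/
theorem surjective_deriv_perturbCLM {W : ℝ → ℝ} (hW : ContDiff ℝ ∞ W) (i : ι) {t : ℝ}
    (ht : W t ≠ 0) : Function.Surjective (deriv (perturbCLM W i) t : (ι → Fin 3 → ℂ) →L[ℝ] ℂ) := by
  intro z
  obtain ⟨b, h0, h1, h2⟩ : ∃ b : ι → Fin 3 → ℂ, b i 0 = -(t * (z / W t)) ∧ b i 1 = z / W t ∧
      b i 2 = 0 := ⟨fun _ => ![- (t * (z / W t)), z / W t, 0], rfl, rfl, rfl⟩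
  refine ⟨b, ?_⟩
  have hWd : HasDerivAt W (deriv W t) t := (hW.differentiable (by simp) t).hasDerivAt
  rw [deriv_perturbCLM_apply hW]
  have h2 : (fun τ => perturbCLM W i τ b) =
      fun τ : ℝ => (W τ : ℂ) * ((τ - t : ℝ) * (z / W t)) := by
    ext τ
    rw [perturbCLM_apply, h0, h1, h2]
    push_cast
    ring
  have h3 : HasDerivAt (fun τ : ℝ => ((τ - t : ℝ) : ℂ) * (z / W t)) (((1 : ℝ) : ℂ) * (z / W t)) t :=
    HasDerivAt.mul_const (((hasDerivAt_id t).sub_const t).ofReal_comp) _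
  have h4 := (hWd.ofReal_comp.fun_mul h3).deriv
  have e3 : (W t : ℂ) ≠ 0 := by exact_mod_cast ht
  rw [h2, h4, sub_self, Complex.ofReal_zero, Complex.ofReal_one, zero_mul, mul_zero, zero_add,
    one_mul, mul_div_cancel₀ _ e3]

variable (μ : Measure (ι → Fin 3 → ℂ)) [μ.IsAddHaarMeasure]

/-- Transversality is applied to the velocity. A map from a line to the plane has no surjective
differential, so generically zero is not attained. -/
theorem ae_deriv_perturbed_ne_zero {E : ι → ℝ → ℂ} (hE : ∀ i, ContDiff ℝ ∞ (E i)) {W : ℝ → ℝ}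
    (hW : ContDiff ℝ ∞ W) :
    ∀ᵐ a ∂μ, ∀ i t, W t ≠ 0 → deriv (perturbed E W a i) t ≠ 0 := by
  rw [ae_all_iff]
  intro i
  have hLd : ContDiff ℝ 1 (deriv (perturbCLM W i)) :=
    ((contDiff_perturbCLM hW i).iterate_deriv 1).of_le (by simp)
  have hEd : ContDiff ℝ 1 (deriv (E i)) := ((hE i).iterate_deriv 1).of_le (by simp)
  filter_upwards [ae_surjective_fderiv μ (X := ℝ) (Y := ℂ) (by simp) hLd hEd] with a ha t ht h0
  rw [deriv_perturbed hE hW] at h0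
  exact not_surjective_of_finrank_lt _ (by simp) (ha t (surjective_deriv_perturbCLM hW i ht) h0)

theorem ae_perturbed_notMem {E : ι → ℝ → ℂ} (hE : ∀ i, ContDiff ℝ ∞ (E i)) {W : ℝ → ℝ}
    (hW : ContDiff ℝ ∞ W) {Q : Set ℂ} (hQ : Q.Finite) :
    ∀ᵐ a ∂μ, ∀ i t, W t ≠ 0 → perturbed E W a i t ∉ Q := by
  classical
  have hL := fun i => (contDiff_perturbCLM (ι := ι) hW i).of_le (show (1 : WithTop ℕ∞) ≤ ∞ by simp)
  have hE1 := fun i => (hE i).of_le (show (1 : WithTop ℕ∞) ≤ ∞ by simp)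
  have : ∀ᵐ a ∂μ, ∀ q ∈ Q, ∀ i t, W t ≠ 0 → perturbed E W a i t ≠ q := by
    rw [ae_ball_iff hQ.countable]
    intro q _
    rw [ae_all_iff]
    intro i
    have hψ : ContDiff ℝ 1 (fun t => E i t - q) := (hE1 i).sub contDiff_const
    filter_upwards [ae_surjective_fderiv μ (X := ℝ) (Y := ℂ) (by simp) (hL i) hψ] with a ha t ht h0
    refine not_surjective_of_finrank_lt _ (by simp) (ha t ?_ ?_)
    · intro z
      obtain ⟨b, hb, -⟩ := exists_perturbCLM_eq (j := i) (k := i) (t := t + 1) (u := t + 1) ht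
        (by simp) (by simp) z
      exact ⟨b, hb⟩
    · rw [← add_sub_assoc, ← perturbed_eq, h0, sub_self]
  filter_upwards [this] with a ha i t ht h using ha _ h i t ht rfl

/-- Here both dimensions are two, and a surjective differential of (s, t) ↦ γ(s) - δ(t) is
transversality. One movable branch suffices, so `t` may lie outside the support of `W`. -/
theorem ae_linearIndependent_deriv_perturbed {E : ι → ℝ → ℂ} (hE : ∀ i, ContDiff ℝ ∞ (E i)) {W : ℝ → ℝ}
    (hW : ContDiff ℝ ∞ W) :
    ∀ᵐ a ∂μ, ∀ i j s t, (i, s) ≠ (j, t) → W s ≠ 0 →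
      perturbed E W a i s = perturbed E W a j t →
        LinearIndependent ℝ ![deriv (perturbed E W a i) s, deriv (perturbed E W a j) t] := by
  classical
  have hL := fun i => (contDiff_perturbCLM (ι := ι) hW i).of_le (show (1 : WithTop ℕ∞) ≤ ∞ by simp)
  have hE1 := fun i => (hE i).of_le (show (1 : WithTop ℕ∞) ≤ ∞ by simp)
  have hd : ∀ a i t, DifferentiableAt ℝ (perturbed E W a i) t := fun a i t =>
    ((contDiff_perturbed hE hW a i).differentiable (by simp)) t
  rw [ae_all_iff]
  intro i
  rw [ae_all_iff]
  intro j
  have hL' : ContDiff ℝ 1 (fun p : ℝ × ℝ => perturbCLM W i p.1 - perturbCLM W j p.2) :=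
    ((hL i).comp contDiff_fst).sub ((hL j).comp contDiff_snd)
  have hψ' : ContDiff ℝ 1 (fun p : ℝ × ℝ => E i p.1 - E j p.2) :=
    ((hE1 i).comp contDiff_fst).sub ((hE1 j).comp contDiff_snd)
  filter_upwards [ae_surjective_fderiv μ (X := ℝ × ℝ) (Y := ℂ) (by simp) hL' hψ'] with
    a ha s t hne hs h0
  have hfun : (fun p : ℝ × ℝ => (perturbCLM W i p.1 - perturbCLM W j p.2) a + (E i p.1 - E j p.2)) =
      fun p : ℝ × ℝ => perturbed E W a i p.1 - perturbed E W a j p.2 := by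
    ext p
    rw [perturbed_eq, perturbed_eq, sub_apply]
    ring
  have := ha (s, t) ?_ ?_
  · rw [hfun, (hasFDerivAt_sub_curves (hd a i s).hasDerivAt (hd a j t).hasDerivAt).fderiv] at this
    exact linearIndependent_pair_of_surjective this
  · intro z
    obtain ⟨b, hb, hb', -⟩ := exists_perturbCLM_eq hs hne hne z
    exact ⟨b, by simp [hb, hb']⟩
  · have := congrFun hfun (s, t)
    simp only at this
    rw [this, h0, sub_self]

/-- Three parameters, four real equations. Two movable branches suffice for surjectivity, so the
third parameter is unrestricted. -/
theorem ae_perturbed_no_triple {E : ι → ℝ → ℂ} (hE : ∀ i, ContDiff ℝ ∞ (E i)) {W : ℝ → ℝ}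
    (hW : ContDiff ℝ ∞ W) :
    ∀ᵐ a ∂μ, ∀ i j k s t u, (i, s) ≠ (j, t) → (i, s) ≠ (k, u) →
      (j, t) ≠ (k, u) → W s ≠ 0 → W t ≠ 0 →
        perturbed E W a i s = perturbed E W a j t →
        perturbed E W a j t ≠ perturbed E W a k u := by
  classical
  have hL := fun i => (contDiff_perturbCLM (ι := ι) hW i).of_le (show (1 : WithTop ℕ∞) ≤ ∞ by simp)
  have hE1 := fun i => (hE i).of_le (show (1 : WithTop ℕ∞) ≤ ∞ by simp)
  rw [ae_all_iff]
  intro i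
  rw [ae_all_iff]
  intro j
  rw [ae_all_iff]
  intro k
  have hL' : ContDiff ℝ 1 (fun p : ℝ × ℝ × ℝ =>
      (ContinuousLinearMap.inl ℝ ℂ ℂ).comp (perturbCLM W i p.1 - perturbCLM W j p.2.1) +
      (ContinuousLinearMap.inr ℝ ℂ ℂ).comp (perturbCLM W j p.2.1 - perturbCLM W k p.2.2)) := by
    have e1 : ContDiff ℝ 1 (fun p : ℝ × ℝ × ℝ => perturbCLM W i p.1) := (hL i).comp contDiff_fst
    have e2 : ContDiff ℝ 1 (fun p : ℝ × ℝ × ℝ => perturbCLM W j p.2.1) :=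
      (hL j).comp contDiff_snd.fst
    have e3 : ContDiff ℝ 1 (fun p : ℝ × ℝ × ℝ => perturbCLM W k p.2.2) :=
      (hL k).comp contDiff_snd.snd
    exact (contDiff_const.clm_comp (e1.sub e2)).add (contDiff_const.clm_comp (e2.sub e3))
  have hψ' : ContDiff ℝ 1 (fun p : ℝ × ℝ × ℝ => (E i p.1 - E j p.2.1, E j p.2.1 - E k p.2.2)) := by
    have e1 := (hE1 i).comp (contDiff_fst (E := ℝ) (F := ℝ × ℝ))
    have e2 := (hE1 j).comp (contDiff_snd (E := ℝ) (F := ℝ × ℝ)).fst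
    have e3 := (hE1 k).comp (contDiff_snd (E := ℝ) (F := ℝ × ℝ)).snd
    exact (e1.sub e2).prodMk (e2.sub e3)
  filter_upwards [ae_surjective_fderiv μ (X := ℝ × ℝ × ℝ) (Y := ℂ × ℂ) (by simp) hL' hψ']
    with a ha s t u h1 h2 h3 hs ht h0 h0'
  refine not_surjective_of_finrank_lt _ (by simp) (ha (s, t, u) ?_ ?_)
  · rintro ⟨y, z⟩
    obtain ⟨b, hb, hb', hb''⟩ := exists_perturbCLM_eq hs h1 h2 (y + z)
    obtain ⟨c, hc, hc', hc''⟩ := exists_perturbCLM_eq ht h1.symm h3 z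
    refine ⟨b + c, ?_⟩
    simp [hb, hb', hb'', hc, hc', hc'']
  · rw [perturbed_eq, perturbed_eq] at h0 h0'
    ext
    · simp
      linear_combination h0
    · simp
      linear_combination h0'

end Perturb

/-- The curves `c e` with `e ∈ S` are generic at the parameters in `T` and avoid `Q` there. -/
structure GenericAt {β : Type*} (c : β → ℝ → ℂ) (S : Set β) (T : Set ℝ) (Q : Set ℂ) : Prop where
  deriv_ne_zero : ∀ e ∈ S, ∀ t ∈ T, deriv (c e) t ≠ 0
  notMem : ∀ e ∈ S, ∀ t ∈ T, c e t ∉ Q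
  transversal : ∀ d ∈ S, ∀ e ∈ S, ∀ s ∈ T, ∀ t, (d, s) ≠ (e, t) → c d s = c e t →
    LinearIndependent ℝ ![deriv (c d) s, deriv (c e) t]
  no_triple : ∀ d ∈ S, ∀ e ∈ S, ∀ h ∈ S, ∀ s ∈ T, ∀ t ∈ T, ∀ u, (d, s) ≠ (e, t) →
    (d, s) ≠ (h, u) → (e, t) ≠ (h, u) → c d s = c e t → c e t ≠ c h u

/-- Two families of curves have a common small generic perturbation. -/
theorem exists_genericAt_perturbed {β : Type*} {S : Set β} (hS : S.Finite) {E E' : β → ℝ → ℂ}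
    (hE : ∀ e, ContDiff ℝ ∞ (E e)) (hE' : ∀ e, ContDiff ℝ ∞ (E' e)) {W : ℝ → ℝ}
    (hW : ContDiff ℝ ∞ W) {Q : Set ℂ} (hQ : Q.Finite) {ε : ℝ} (hε : 0 < ε) :
    ∃ a : β → Fin 3 → ℂ, (∀ e j, ‖a e j‖ < ε) ∧
      GenericAt (perturbed E W a) S {t | W t ≠ 0} Q ∧
      GenericAt (perturbed E' W a) S {t | W t ≠ 0} Q := by
  classical
  have := hS.fintype
  -- The parameter space must be finite-dimensional, so only the finitely many curves in `S` are
  -- perturbed.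
  set ext : (S → Fin 3 → ℂ) → β → Fin 3 → ℂ := fun a e => if h : e ∈ S then a ⟨e, h⟩ else 0
    with hext
  have key : ∀ E : β → ℝ → ℂ, (∀ e, ContDiff ℝ ∞ (E e)) →
      ∀ᵐ a ∂(Measure.addHaar : Measure (S → Fin 3 → ℂ)),
        GenericAt (perturbed E W (ext a)) S {t | W t ≠ 0} Q := by
    intro E hE
    have hE1 : ∀ i : S, ContDiff ℝ ∞ (fun t => E i t) := fun i => hE i
    filter_upwards [ae_deriv_perturbed_ne_zero Measure.addHaar hE1 hW,
      ae_perturbed_notMem Measure.addHaar hE1 hW hQ,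
      ae_linearIndependent_deriv_perturbed Measure.addHaar hE1 hW,
      ae_perturbed_no_triple Measure.addHaar hE1 hW] with a hA hB hC hD
    have e1 : ∀ e (h : e ∈ S), perturbed E W (ext a) e =
        perturbed (fun (i : S) t => E i t) W a ⟨e, h⟩ := by
      intro e h
      funext t
      simp only [perturbed, hext, dif_pos h]
    have hne : ∀ {d e : β} {s t : ℝ} (hd : d ∈ S) (he : e ∈ S), (d, s) ≠ (e, t) →
        ((⟨d, hd⟩ : S), s) ≠ (⟨e, he⟩, t) := by
      intro d e s t hd he h h'
      simp only [Prod.mk.injEq, Subtype.mk.injEq] at h'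
      exact h (by rw [h'.1, h'.2])
    refine ⟨fun e he t ht => ?_, fun e he t ht => ?_, fun d hd e he s hs t hne' => ?_,
      fun d hd e he h hh s hs t ht u h1 h2 h3 => ?_⟩
    · rw [e1 e he]
      exact hA _ _ ht
    · rw [e1 e he]
      exact hB _ _ ht
    · rw [e1 d hd, e1 e he]
      exact hC _ _ _ _ (hne hd he hne') hs
    · rw [e1 d hd, e1 e he, e1 h hh]
      exact hD _ _ _ _ _ _ (hne hd he h1) (hne hd hh h2) (hne he hh h3) hs ht
  -- Parameters that are good for both families have full measure, hence occur arbitrarily close to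
  -- zero.
  have hdense := Measure.dense_of_ae ((key E hE).and (key E' hE'))
  obtain ⟨a, ha, hda⟩ := hdense.exists_dist_lt 0 hε
  rw [dist_comm, dist_zero_right] at hda
  refine ⟨ext a, fun e j => ?_, ha.1, ha.2⟩
  simp only [hext]
  split_ifs with h
  · exact lt_of_le_of_lt ((norm_le_pi_norm _ _).trans (norm_le_pi_norm a _)) hda
  · simpa using hε

/-! ### Finiteness of coincidences -/

/-- A regular curve is locally injective. -/
theorem eventually_injective_of_hasStrictDerivAt {E : Type*} [NormedAddCommGroup E]
    [NormedSpace ℝ E] {γ : ℝ → E} {v : E} {t : ℝ} (h : HasStrictDerivAt γ v t) (hv : v ≠ 0) :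
    ∀ᶠ p : ℝ × ℝ in 𝓝 (t, t), γ p.1 = γ p.2 → p.1 = p.2 := by
  have := h.hasStrictFDerivAt.isLittleO.def (c := ‖v‖ / 2) (by positivity)
  filter_upwards [this] with p hp heq
  rw [heq, sub_self, zero_sub, norm_neg] at hp
  simp only [ContinuousLinearMap.toSpanSingleton_apply, norm_smul] at hp
  by_contra hne
  have h1 : 0 < ‖p.1 - p.2‖ := norm_pos_iff.2 (sub_ne_zero.2 hne)
  have h2 : 0 < ‖v‖ := norm_pos_iff.2 hv
  nlinarith

theorem eventually_sub_ne_zero {E : Type*} [NormedAddCommGroup E] [NormedSpace ℝ E]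
    {γ δ : ℝ → E} {s t : ℝ} {v w : E} (hγ : HasDerivAt γ v s) (hδ : HasDerivAt δ w t)
    (h : LinearIndependent ℝ ![v, w]) : ∀ᶠ p in 𝓝[≠] (s, t), γ p.1 ≠ δ p.2 := by
  have hi := injective_of_linearIndependent_pair h
  obtain ⟨K, hK0, hK⟩ := LinearMap.exists_antilipschitzWith _ (LinearMap.ker_eq_bot.2 hi)
  have := (hasFDerivAt_sub_curves hγ hδ).eventually_ne (c := 0) ⟨K, hK⟩
  filter_upwards [this] with p hp h
  exact hp (sub_eq_zero.2 h)

/-- A pair of curves in general position has finitely many coincidences. -/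
theorem finite_coincidences {γ δ : ℝ → ℂ} (hγ : ContDiff ℝ ∞ γ) (hδ : ContDiff ℝ ∞ δ) (D : Set (ℝ × ℝ))
    (hreg : ∀ s ∈ Ioo (0 : ℝ) 1, ∀ t ∈ Ioo (0 : ℝ) 1, γ s = δ t → (s, t) ∉ D →
      s = t ∧ γ = δ ∧ deriv γ s ≠ 0 ∧ ∀ u, (u, u) ∉ D)
    (htr : ∀ s ∈ Ioo (0 : ℝ) 1, ∀ t ∈ Ioo (0 : ℝ) 1, γ s = δ t → (s, t) ∈ D →
      LinearIndependent ℝ ![deriv γ s, deriv δ t])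
    (hend : ∀ s ∈ Icc (0 : ℝ) 1, ∀ t ∈ Icc (0 : ℝ) 1, γ s = δ t →
      (s ∉ Ioo (0 : ℝ) 1 ∨ t ∉ Ioo (0 : ℝ) 1) →
      ∀ᶠ p in 𝓝 (s, t), p.1 ∈ Ioo (0 : ℝ) 1 → p.2 ∈ Ioo (0 : ℝ) 1 → γ p.1 = δ p.2 → p ∉ D) :
    {p : ℝ × ℝ | p.1 ∈ Ioo (0 : ℝ) 1 ∧ p.2 ∈ Ioo (0 : ℝ) 1 ∧ p ∈ D ∧ γ p.1 = δ p.2}.Finite := by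
  by_contra hinf
  set A := {p : ℝ × ℝ | p.1 ∈ Ioo (0 : ℝ) 1 ∧ p.2 ∈ Ioo (0 : ℝ) 1 ∧ p ∈ D ∧ γ p.1 = δ p.2}
  -- Infinitely many coincidences accumulate in the closed square. This is excluded by
  -- transversality at a double point, by local injectivity on the diagonal of a single curve, and
  -- by `hend` at the boundary.
  obtain ⟨⟨s, t⟩, hst, hacc⟩ := Set.Infinite.exists_accPt_of_subset_isCompact
    (K := Icc (0 : ℝ) 1 ×ˢ Icc (0 : ℝ) 1) hinf (isCompact_Icc.prod isCompact_Icc)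
    (fun p hp => ⟨Ioo_subset_Icc_self hp.1, Ioo_subset_Icc_self hp.2.1⟩)
  rw [accPt_iff_frequently_nhdsNE] at hacc
  have heq : γ s = δ t := by
    have hcl : IsClosed {p : ℝ × ℝ | γ p.1 = δ p.2} :=
      isClosed_eq (hγ.continuous.comp continuous_fst) (hδ.continuous.comp continuous_snd)
    have : (s, t) ∈ closure {p : ℝ × ℝ | γ p.1 = δ p.2} := by
      rw [mem_closure_iff_frequently]
      exact (hacc.filter_mono nhdsWithin_le_nhds).mono fun p hp => hp.2.2.2
    rwa [hcl.closure_eq] at this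
  have hdγ := fun t => (hγ.contDiffAt (x := t)).hasStrictDerivAt (by simp)
  have hdδ := fun t => (hδ.contDiffAt (x := t)).hasStrictDerivAt (by simp)
  by_cases hint : s ∈ Ioo (0 : ℝ) 1 ∧ t ∈ Ioo (0 : ℝ) 1
  · by_cases hD : (s, t) ∈ D
    · have h1 := htr s hint.1 t hint.2 heq hD
      have h2 := eventually_sub_ne_zero (hdγ s).hasDerivAt (hdδ t).hasDerivAt h1
      obtain ⟨p, hp, hp'⟩ := (hacc.and_eventually h2).exists
      exact hp' hp.2.2.2
    · obtain ⟨rfl, rfl, h0, hdiag⟩ := hreg s hint.1 t hint.2 heq hD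
      have h2 := eventually_injective_of_hasStrictDerivAt (hdγ s) h0
      obtain ⟨p, hp, hp'⟩ := (hacc.and_eventually (h2.filter_mono nhdsWithin_le_nhds)).exists
      have h3 := hp' hp.2.2.2
      have h4 := hdiag p.1
      have h5 : p = (p.1, p.1) := Prod.ext rfl h3.symm
      rw [← h5] at h4
      exact h4 hp.2.2.1
  · rw [not_and_or] at hint
    have h2 := hend s hst.1 t hst.2 heq hint
    obtain ⟨p, hp, hp'⟩ := (hacc.and_eventually (h2.filter_mono nhdsWithin_le_nhds)).exists
    exact hp' hp.1 hp.2.1 hp.2.2.2 hp.2.2.1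

/-! ### Star drawings and the immersions they define -/

/-- A drawing of the multigraph `G` by smooth curves, which are straight near the vertices and
generic elsewhere. -/
structure StarDrawing {α β : Type*} (G : Graph α β) (src tgt : β → α) (pos : α → ℂ)
    (dir : β → Bool → ℂ) (c : β → ℝ → ℂ) : Prop where
  link : ∀ e ∈ G.edgeSet, G.IsLink e (src e) (tgt e)
  sep : ∀ u ∈ G.vertexSet, ∀ v ∈ G.vertexSet, u ≠ v → 1 ≤ ‖pos u - pos v‖
  norm_dir : ∀ e ∈ G.edgeSet, ∀ b, ‖dir e b‖ = 1
  dir_inj : ∀ d ∈ G.edgeSet, ∀ e ∈ G.edgeSet, ∀ a b, dir d a = dir e b → d = e ∧ a = b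
  smooth : ∀ e, ContDiff ℝ ∞ (c e)
  start : ∀ e ∈ G.edgeSet, ∀ t ∈ Icc (0 : ℝ) (1 / 4), c e t = pos (src e) + t * dir e false
  finish : ∀ e ∈ G.edgeSet, ∀ t ∈ Icc (3 / 4 : ℝ) 1, c e t = pos (tgt e) + (1 - t) * dir e true
  generic : GenericAt c G.edgeSet (Ioo (1 / 4) (3 / 4)) (pos '' G.vertexSet)

namespace StarDrawing
variable {α β : Type*} {G : Graph α β} {src tgt : β → α} {pos : α → ℂ} {dir : β → Bool → ℂ}
  {c : β → ℝ → ℂ}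

theorem exists_ray (D : StarDrawing G src tgt pos dir c) {e : β} (he : e ∈ G.edgeSet) {t : ℝ}
    (ht : t ∈ Icc (0 : ℝ) 1) (hm : t ∉ Ioo (1 / 4 : ℝ) (3 / 4)) :
    ∃ b : Bool, ∃ r ∈ Icc (0 : ℝ) (1 / 4), ∃ v ∈ G.vertexSet, t = (if b then 1 - r else r) ∧
      v = (if b then tgt e else src e) ∧ c e t = pos v + r * dir e b := by
  rw [mem_Ioo, not_and_or, not_lt, not_lt] at hm
  rcases hm with hm | hm
  · exact ⟨false, t, ⟨ht.1, hm⟩, _, (D.link e he).left_mem, rfl, rfl, D.start e he t ⟨ht.1, hm⟩⟩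
  · refine ⟨true, 1 - t, ⟨by linarith [ht.2], by linarith⟩, _, (D.link e he).right_mem, by simp,
      rfl, ?_⟩
    rw [D.finish e he t ⟨hm, ht.2⟩]
    push_cast
    rfl

/-- Points of the rays near the vertices do not coincide. -/
theorem ray_inj (D : StarDrawing G src tgt pos dir c) {d e : β} (hd : d ∈ G.edgeSet)
    (he : e ∈ G.edgeSet) {s t : ℝ} (hs : s ∈ Ioo (0 : ℝ) 1) (ht : t ∈ Icc (0 : ℝ) 1)
    (hsm : s ∉ Ioo (1 / 4 : ℝ) (3 / 4)) (htm : t ∉ Ioo (1 / 4 : ℝ) (3 / 4)) (h : c d s = c e t) :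
    (d, s) = (e, t) := by
  obtain ⟨a, r, hr, u, hu, hsr, -, h1⟩ := D.exists_ray hd (Ioo_subset_Icc_self hs) hsm
  obtain ⟨b, r', hr', v, hv, htr, -, h2⟩ := D.exists_ray he ht htm
  have hr0 : 0 < r := by
    refine lt_of_le_of_ne hr.1 fun h0 => ?_
    subst h0
    cases a <;> simp at hsr <;> subst hsr <;> simp at hs
  rw [h1, h2] at h
  have hn : ∀ (e : β) (_ : e ∈ G.edgeSet) (b : Bool) (r : ℝ), 0 ≤ r → ‖(r : ℂ) * dir e b‖ = r :=
    fun e he b r hr => by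
      rw [norm_mul, D.norm_dir e he, mul_one, Complex.norm_real, Real.norm_of_nonneg hr]
  -- Rays have length at most 1/4 and distinct vertices have distance at least 1, so only rays at
  -- the same vertex can meet.
  have huv : u = v := by
    by_contra hne
    have h3 := D.sep u hu v hv hne
    have h4 : pos u - pos v = r' * dir e b - r * dir d a := by linear_combination h
    rw [h4] at h3
    have h5 := norm_sub_le ((r' : ℂ) * dir e b) (r * dir d a)
    rw [hn e he b r' hr'.1, hn d hd a r hr.1] at h5
    linarith [hr.2, hr'.2]
  subst huv
  have h6 : (r : ℂ) * dir d a = r' * dir e b := add_left_cancel h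
  have h7 : r = r' := by
    have := congrArg norm h6
    rwa [hn d hd a r hr.1, hn e he b r' hr'.1] at this
  subst h7
  have h8 := D.dir_inj d hd e he a b (mul_left_cancel₀ (by exact_mod_cast hr0.ne') h6)
  rw [hsr, htr, h8.1, h8.2]

theorem ne_pos (D : StarDrawing G src tgt pos dir c) {e : β} (he : e ∈ G.edgeSet) {t : ℝ}
    (ht : t ∈ Ioo (0 : ℝ) 1) {v : α} (hv : v ∈ G.vertexSet) : c e t ≠ pos v := by
  by_cases hm : t ∈ Ioo (1 / 4 : ℝ) (3 / 4)
  · exact fun h => D.generic.notMem e he t hm ⟨v, hv, h.symm⟩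
  · obtain ⟨b, r, hr, u, hu, htr, -, h1⟩ := D.exists_ray he (Ioo_subset_Icc_self ht) hm
    intro h
    rw [h1] at h
    have hn : ‖(r : ℂ) * dir e b‖ = r := by
      rw [norm_mul, D.norm_dir e he, mul_one, Complex.norm_real, Real.norm_of_nonneg hr.1]
    have h4 : pos v - pos u = r * dir e b := by linear_combination -h
    by_cases huv : v = u
    · rw [huv, sub_self] at h4
      have h0 : r = 0 := by rw [← hn, ← h4, norm_zero]
      subst h0
      cases b <;> simp at htr <;> subst htr <;> simp at ht
    · have h3 := D.sep v hv u hu huv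
      rw [h4, hn] at h3
      linarith [hr.2]

theorem deriv_start (D : StarDrawing G src tgt pos dir c) {e : β} (he : e ∈ G.edgeSet) {t : ℝ}
    (ht : t ∈ Icc (0 : ℝ) (1 / 4)) : deriv (c e) t = dir e false := by
  have h1 : HasDerivWithinAt (c e) (deriv (c e) t) (Icc 0 (1 / 4)) t :=
    ((D.smooth e).differentiable (by simp) t).hasDerivAt.hasDerivWithinAt
  have h2 : HasDerivAt (fun t : ℝ => pos (src e) + t * dir e false) (dir e false) t := by
    simpa using ((hasDerivAt_id t).ofReal_comp.mul_const (dir e false)).const_add (pos (src e))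
  have h3 : HasDerivWithinAt (c e) (dir e false) (Icc 0 (1 / 4)) t :=
    h2.hasDerivWithinAt.congr (fun x hx => D.start e he x hx) (D.start e he t ht)
  exact (uniqueDiffOn_Icc (by norm_num) t ht).eq_deriv _ h1 h3

theorem deriv_finish (D : StarDrawing G src tgt pos dir c) {e : β} (he : e ∈ G.edgeSet) {t : ℝ}
    (ht : t ∈ Icc (3 / 4 : ℝ) 1) : deriv (c e) t = -dir e true := by
  have h1 : HasDerivWithinAt (c e) (deriv (c e) t) (Icc (3 / 4) 1) t :=
    ((D.smooth e).differentiable (by simp) t).hasDerivAt.hasDerivWithinAt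
  have h2 : HasDerivAt (fun t : ℝ => pos (tgt e) + (1 - t) * dir e true) (-dir e true) t := by
    simpa using (((hasDerivAt_id t).ofReal_comp.const_sub 1).mul_const (dir e true)).const_add
      (pos (tgt e))
  have h3 : HasDerivWithinAt (c e) (-dir e true) (Icc (3 / 4) 1) t :=
    h2.hasDerivWithinAt.congr (fun x hx => D.finish e he x hx) (D.finish e he t ht)
  exact (uniqueDiffOn_Icc (by norm_num) t ht).eq_deriv _ h1 h3

theorem deriv_ne_zero (D : StarDrawing G src tgt pos dir c) {e : β} (he : e ∈ G.edgeSet) {t : ℝ}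
    (ht : t ∈ Icc (0 : ℝ) 1) : deriv (c e) t ≠ 0 := by
  have hdir : ∀ b, dir e b ≠ 0 := fun b h => by
    have := D.norm_dir e he b
    simp [h] at this
  by_cases hm : t ∈ Ioo (1 / 4 : ℝ) (3 / 4)
  · exact D.generic.deriv_ne_zero e he t hm
  · rw [mem_Ioo, not_and_or, not_lt, not_lt] at hm
    rcases hm with hm | hm
    · rw [D.deriv_start he ⟨ht.1, hm⟩]
      exact hdir _
    · rw [D.deriv_finish he ⟨hm, ht.2⟩]
      exact neg_ne_zero.2 (hdir _)

theorem transversal (D : StarDrawing G src tgt pos dir c) {d e : β} (hd : d ∈ G.edgeSet)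
    (he : e ∈ G.edgeSet) {s t : ℝ} (hs : s ∈ Ioo (0 : ℝ) 1) (ht : t ∈ Ioo (0 : ℝ) 1)
    (hne : (d, s) ≠ (e, t)) (h : c d s = c e t) :
    LinearIndependent ℝ ![deriv (c d) s, deriv (c e) t] := by
  by_cases hsm : s ∈ Ioo (1 / 4 : ℝ) (3 / 4)
  · exact D.generic.transversal d hd e he s hsm t hne h
  by_cases htm : t ∈ Ioo (1 / 4 : ℝ) (3 / 4)
  · have := D.generic.transversal e he d hd t htm s hne.symm h.symm
    rw [LinearIndependent.pair_iff] at *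
    intro x y hxy
    exact (this y x (by rw [add_comm]; exact hxy)).symm
  · exact absurd (D.ray_inj hd he hs (Ioo_subset_Icc_self ht) hsm htm h) hne

/-- Of the three points at most one is on a ray, by `ray_inj`; so two lie in the middle parts, as
required by `GenericAt.no_triple`. -/
theorem no_triple (D : StarDrawing G src tgt pos dir c) {d e f : β} (hd : d ∈ G.edgeSet)
    (he : e ∈ G.edgeSet) (hf : f ∈ G.edgeSet) {s t u : ℝ} (hs : s ∈ Ioo (0 : ℝ) 1)
    (ht : t ∈ Ioo (0 : ℝ) 1) (hu : u ∈ Ioo (0 : ℝ) 1) (h : c d s = c e t) (h' : c e t = c f u) :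
    (d, s) = (e, t) ∨ (e, t) = (f, u) ∨ (d, s) = (f, u) := by
  by_contra! hne
  obtain ⟨h1, h2, h3⟩ := hne
  by_cases hsm : s ∈ Ioo (1 / 4 : ℝ) (3 / 4)
  · by_cases htm : t ∈ Ioo (1 / 4 : ℝ) (3 / 4)
    · exact D.generic.no_triple d hd e he f hf s hsm t htm u h1 h3 h2 h h'
    by_cases hum : u ∈ Ioo (1 / 4 : ℝ) (3 / 4)
    · exact D.generic.no_triple d hd f hf e he s hsm u hum t h3 h1 h2.symm (h.trans h') h'.symm
    exact h2 (D.ray_inj he hf ht (Ioo_subset_Icc_self hu) htm hum h')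
  by_cases htm : t ∈ Ioo (1 / 4 : ℝ) (3 / 4)
  · by_cases hum : u ∈ Ioo (1 / 4 : ℝ) (3 / 4)
    · exact D.generic.no_triple e he f hf d hd t htm u hum s h2 h1.symm h3.symm h'
        (h.trans h').symm
    exact h3 (D.ray_inj hd hf hs (Ioo_subset_Icc_self hu) hsm hum (h.trans h'))
  · exact h1 (D.ray_inj hd he hs (Ioo_subset_Icc_self ht) hsm htm h)

/-- At an end parameter the common point is a vertex, so both parameters are ends; nearby, only rays
occur, and these have no coincidences. -/
theorem finite_crossings (D : StarDrawing G src tgt pos dir c) {d e : β} (hd : d ∈ G.edgeSet)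
    (he : e ∈ G.edgeSet) :
    {p : ℝ × ℝ | p.1 ∈ Ioo (0 : ℝ) 1 ∧ p.2 ∈ Ioo (0 : ℝ) 1 ∧
      p ∈ {p : ℝ × ℝ | (d, p.1) ≠ (e, p.2)} ∧ c d p.1 = c e p.2}.Finite := by
  have hpos : ∀ {e : β}, e ∈ G.edgeSet → ∀ t ∈ Icc (0 : ℝ) 1, t ∉ Ioo (0 : ℝ) 1 →
      (∃ v ∈ G.vertexSet, c e t = pos v) ∧ ∀ᶠ x in 𝓝 t, x ∉ Ioo (1 / 4 : ℝ) (3 / 4) := by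
    intro e he t ht hto
    have h01 : t = 0 ∨ t = 1 := by
      by_contra! hne
      exact hto ⟨lt_of_le_of_ne ht.1 (Ne.symm hne.1), lt_of_le_of_ne ht.2 hne.2⟩
    rcases h01 with rfl | rfl
    · refine ⟨⟨_, (D.link e he).left_mem, by simpa using D.start e he 0 (by norm_num)⟩, ?_⟩
      filter_upwards [Iio_mem_nhds (show (0 : ℝ) < 1 / 4 by norm_num)] with x hx h
      exact lt_asymm h.1 hx
    · refine ⟨⟨_, (D.link e he).right_mem, by simpa using D.finish e he 1 (by norm_num)⟩, ?_⟩
      filter_upwards [Ioi_mem_nhds (show (3 / 4 : ℝ) < 1 by norm_num)] with x hx h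
      exact lt_asymm h.2 hx
  refine finite_coincidences (D.smooth d) (D.smooth e) _ ?_ ?_ ?_
  · intro s hs t ht h hD
    simp only [mem_ofPred_eq, not_not, Prod.mk.injEq] at hD
    obtain ⟨rfl, rfl⟩ := hD
    exact ⟨rfl, rfl, D.deriv_ne_zero hd (Ioo_subset_Icc_self hs), fun u hu => hu rfl⟩
  · intro s hs t ht h hD
    exact D.transversal hd he hs ht hD h
  · intro s hs t ht h hor
    have hs' : s ∉ Ioo (0 : ℝ) 1 := by
      rcases hor with h1 | h1
      · exact h1
      · obtain ⟨⟨v, hv, hv'⟩, -⟩ := hpos he t ht h1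
        exact fun hs => D.ne_pos hd hs hv (h.trans hv')
    have ht' : t ∉ Ioo (0 : ℝ) 1 := by
      obtain ⟨⟨v, hv, hv'⟩, -⟩ := hpos hd s hs hs'
      exact fun ht => D.ne_pos he ht hv (h.symm.trans hv')
    have e1 := (continuous_fst.tendsto (s, t)).eventually (hpos hd s hs hs').2
    have e2 := (continuous_snd.tendsto (s, t)).eventually (hpos he t ht ht').2
    filter_upwards [e1, e2] with p h1 h2 h3 h4 h5 h6
    exact h6 (D.ray_inj hd he h3 (Ioo_subset_Icc_self h4) h1 h2 h5)

theorem deriv_symm_comp {γ : ℝ → ℂ} {t : ℝ} (h : DifferentiableAt ℝ γ t) :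
    deriv (fun t => toC.symm (γ t)) t = toC.symm (deriv γ t) :=
  ((toC.symm.toContinuousLinearEquiv : ℂ →L[ℝ] Plane).hasFDerivAt.comp_hasDerivAt t
    h.hasDerivAt).deriv

theorem eq_inl_of_pointMap_eq (D : StarDrawing G src tgt pos dir c) {v : α} (hv : v ∈ G.vertexSet)
    {p : α ⊕ β × ℝ} (hp : p ∈ pointSet G)
    (h : pointMap (fun v => toC.symm (pos v)) (fun e t => toC.symm (c e t)) p =
      toC.symm (pos v)) : p = Sum.inl v := by
  rcases p with u | ⟨e, t⟩
  · by_contra hne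
    have := D.sep u (GenericImmersion.inl_mem_pointSet.1 hp) v hv fun h => hne (by rw [h])
    have h' : pos u = pos v := toC.symm.injective h
    rw [h'] at this
    norm_num at this
  · rw [GenericImmersion.inr_mem_pointSet] at hp
    exact absurd (toC.symm.injective h) (D.ne_pos hp.1 hp.2 hv)

/-- The generic immersion given by a drawing. -/
noncomputable def toGenericImmersion (D : StarDrawing G src tgt pos dir c)
    (hE : G.edgeSet.Finite) : GenericImmersion G where
  vert v := toC.symm (pos v)
  edge e t := toC.symm (c e t)
  ends e he := ⟨src e, tgt e, D.link e he, by
      rw [D.start e he 0 (by norm_num)]; simp, by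
      rw [D.finish e he 1 (by norm_num)]; simp⟩
  smooth e he := (toC.symm.toContinuousLinearEquiv.contDiff.comp (D.smooth e)).contDiffOn
  regular e he t ht := by
    have hd : DifferentiableAt ℝ (c e) t := (D.smooth e).differentiable (by simp) t
    have hd' : DifferentiableAt ℝ (fun t => toC.symm (c e t)) t :=
      (toC.symm.toContinuousLinearEquiv.contDiff.comp (D.smooth e)).differentiable (by simp) t
    rw [hd'.derivWithin (uniqueDiffOn_Icc zero_lt_one t ht), deriv_symm_comp hd, Ne,
      map_eq_zero_iff _ toC.symm.injective]
    exact D.deriv_ne_zero he ht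
  vertex_simple v hv p hp h := D.eq_inl_of_pointMap_eq hv hp h
  double p hp p' hp' p'' hp'' h h' := by
    rcases p with v | ⟨d, s⟩
    · exact Or.inl (D.eq_inl_of_pointMap_eq (GenericImmersion.inl_mem_pointSet.1 hp) hp' h.symm).symm
    rcases p' with v | ⟨e, t⟩
    · exact Or.inl (D.eq_inl_of_pointMap_eq (GenericImmersion.inl_mem_pointSet.1 hp') hp h)
    rcases p'' with v | ⟨f, u⟩
    · exact Or.inr (Or.inl (D.eq_inl_of_pointMap_eq (GenericImmersion.inl_mem_pointSet.1 hp'') hp' h'))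
    rw [GenericImmersion.inr_mem_pointSet] at hp hp' hp''
    have := D.no_triple hp.1 hp'.1 hp''.1 hp.2 hp'.2 hp''.2 (toC.symm.injective h)
      (toC.symm.injective h')
    simpa using this
  transversal d hd e he s hs t ht hne h := by
    rw [deriv_symm_comp ((D.smooth d).differentiable (by simp) s),
      deriv_symm_comp ((D.smooth e).differentiable (by simp) t)]
    exact (linearIndependent_pair_map (toC.symm.toLinearEquiv : ℂ →ₗ[ℝ] Plane)
      toC.symm.injective).2 (D.transversal hd he hs ht hne (toC.symm.injective h))
  finite_multiplePoints := by
    refine ((hE.prod hE).biUnion (t := fun x : β × β => (fun p : ℝ × ℝ => toC.symm (c x.1 p.1)) ''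
      {p : ℝ × ℝ | p.1 ∈ Ioo (0 : ℝ) 1 ∧ p.2 ∈ Ioo (0 : ℝ) 1 ∧
      p ∈ {p : ℝ × ℝ | (x.1, p.1) ≠ (x.2, p.2)} ∧ c x.1 p.1 = c x.2 p.2})
      fun x hx => (D.finite_crossings hx.1 hx.2).image _).subset ?_
    rintro q ⟨p, hp, p', hp', hne, rfl, h⟩
    rcases p with v | ⟨d, s⟩
    · exact absurd (D.eq_inl_of_pointMap_eq (GenericImmersion.inl_mem_pointSet.1 hp) hp' h).symm hne
    rcases p' with v | ⟨e, t⟩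
    · exact absurd (D.eq_inl_of_pointMap_eq (GenericImmersion.inl_mem_pointSet.1 hp') hp h.symm) hne
    rw [GenericImmersion.inr_mem_pointSet] at hp hp'
    refine mem_iUnion₂.2 ⟨(d, e), ⟨hp.1, hp'.1⟩, (s, t), ⟨hp.2, hp'.2, fun h => hne (by rw [h]),
      (toC.symm.injective h).symm⟩, rfl⟩

end StarDrawing

/-! ### Curves with prescribed winding number about the origin -/

/-- A smooth curve that starts at `p` in direction `A`, winds `k` times along the circle of radius
`1 / 8` about the origin, and ends at `q`, coming from direction `B`. -/
noncomputable def windingCurve (p q A B : ℂ) (k : ℤ) (t : ℝ) : ℂ :=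
  -- The cutoffs act on [1/4, 3/8] (from the first ray to the point 1/8), on [3/8, 5/8] (around the
  -- circle) and on [5/8, 3/4] (back to the last ray), so only the middle interval depends on `k`.
  (1 - (Real.smoothTransition (8 * t - 2) : ℂ)) * (p + t * A) +
    ((Real.smoothTransition (8 * t - 2) : ℂ) - (Real.smoothTransition (8 * t - 5) : ℂ)) *
      (1 / 8 * Complex.exp ((Real.smoothTransition (4 * t - 3 / 2) : ℂ) *
        (2 * Real.pi * Complex.I * k))) +
    (Real.smoothTransition (8 * t - 5) : ℂ) * (q + (1 - t) * B)

section windingCurve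
variable {p q A B : ℂ} {k : ℤ} {t : ℝ}

theorem contDiff_windingCurve (p q A B : ℂ) (k : ℤ) : ContDiff ℝ ∞ (windingCurve p q A B k) := by
  have h1 : ∀ a b : ℝ, ContDiff ℝ ∞ (fun t : ℝ => (Real.smoothTransition (a * t - b) : ℂ)) :=
    fun a b => Complex.ofRealCLM.contDiff.comp
      (Real.smoothTransition.contDiff.comp (by fun_prop))
  have h2 : ContDiff ℝ ∞ (fun t : ℝ => (t : ℂ)) := Complex.ofRealCLM.contDiff
  have h3 := ((h1 4 (3 / 2)).mul (contDiff_const (c := 2 * Real.pi * Complex.I * k))).cexp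
  have h4 := h1 8 2
  have h5 := h1 8 5
  unfold windingCurve
  fun_prop

theorem windingCurve_of_le (ht : t ≤ 3 / 8) : windingCurve p q A B k t =
    (1 - (Real.smoothTransition (8 * t - 2) : ℂ)) * (p + t * A) +
      (Real.smoothTransition (8 * t - 2) : ℂ) * (1 / 8) := by
  rw [windingCurve, Real.smoothTransition.zero_of_nonpos (show 8 * t - 5 ≤ 0 by linarith),
    Real.smoothTransition.zero_of_nonpos (show 4 * t - 3 / 2 ≤ 0 by linarith)]
  simp

theorem windingCurve_of_ge (ht : 5 / 8 ≤ t) : windingCurve p q A B k t =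
    (1 - (Real.smoothTransition (8 * t - 5) : ℂ)) * (1 / 8) +
      (Real.smoothTransition (8 * t - 5) : ℂ) * (q + (1 - t) * B) := by
  rw [windingCurve, Real.smoothTransition.one_of_one_le (show 1 ≤ 8 * t - 2 by linarith),
    Real.smoothTransition.one_of_one_le (show 1 ≤ 4 * t - 3 / 2 by linarith)]
  have : Complex.exp (2 * Real.pi * Complex.I * k) = 1 :=
    Complex.exp_eq_one_iff.2 ⟨k, by ring⟩
  simp [this]

theorem windingCurve_of_mem (ht : t ∈ Icc (3 / 8 : ℝ) (5 / 8)) : windingCurve p q A B k t =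
    1 / 8 * Complex.exp ((Real.smoothTransition (4 * t - 3 / 2) : ℂ) *
        (2 * Real.pi * Complex.I * k)) := by
  rw [windingCurve, Real.smoothTransition.one_of_one_le (show 1 ≤ 8 * t - 2 by linarith [ht.1]),
    Real.smoothTransition.zero_of_nonpos (show 8 * t - 5 ≤ 0 by linarith [ht.2])]
  simp

theorem norm_windingCurve_of_mem (ht : t ∈ Icc (3 / 8 : ℝ) (5 / 8)) :
    ‖windingCurve p q A B k t‖ = 1 / 8 := by
  rw [windingCurve_of_mem ht, norm_mul, show (Real.smoothTransition (4 * t - 3 / 2) : ℂ) *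
    (2 * Real.pi * Complex.I * k) = ((Real.smoothTransition (4 * t - 3 / 2) * (2 * Real.pi * k) : ℝ) : ℂ)
      * Complex.I by push_cast; ring, Complex.norm_exp_ofReal_mul_I]
  norm_num

theorem windingCurve_start (ht : t ≤ 1 / 4) : windingCurve p q A B k t = p + t * A := by
  rw [windingCurve_of_le (by linarith),
    Real.smoothTransition.zero_of_nonpos (show 8 * t - 2 ≤ 0 by linarith)]
  simp

theorem windingCurve_finish (ht : 3 / 4 ≤ t) : windingCurve p q A B k t = q + (1 - t) * B := by
  rw [windingCurve_of_ge (by linarith),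
    Real.smoothTransition.one_of_one_le (show 1 ≤ 8 * t - 5 by linarith)]
  simp

/-- A segment between a point left of `z` and `1 / 8` avoids `z`. -/
theorem segment_ne {z w : ℂ} {x : ℝ} (hx : x ∈ Icc (0 : ℝ) 1)
    (hw : w.re ≤ 1) (hw0 : 0 < w.re) (hs' : x = 0 → w.re < 1 ∨ w ≠ z) (hz : z = 0 ∨ z.re = 1) :
    (1 - (x : ℂ)) * w + (x : ℂ) * (1 / 8) ≠ z := by
  intro h
  have hre := congrArg Complex.re h
  have : ((1 - (x : ℂ)) * w + (x : ℂ) * (1 / 8)).re = (1 - x) * w.re + x / 8 := by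
    rw [show ((1 - (x : ℂ)) * w + (x : ℂ) * (1 / 8)) = ((1 - x : ℝ) : ℂ) * w + ((x / 8 : ℝ) : ℂ) by
      push_cast; ring, Complex.add_re, Complex.re_ofReal_mul, Complex.ofReal_re]
  rw [this] at hre
  rcases hz with rfl | hz
  · rcases hx.1.eq_or_lt with h0 | h0
    · subst h0
      simp at hre
      linarith
    · have := mul_nonneg (sub_nonneg.2 hx.2) hw0.le
      simp at hre
      linarith
  · rcases hx.1.eq_or_lt with h0 | h0
    · subst h0
      rcases hs' rfl with h1 | h1
      · linarith
      · exact h1 (by simpa using h)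
    · nlinarith [mul_le_mul_of_nonneg_left hw (sub_nonneg.2 hx.2)]

theorem windingCurve_ne {z : ℂ} (hp : p.re = 1) (hq : q.re = 1) (hA : A.re < 0) (hA1 : ‖A‖ = 1)
    (hB : B.re < 0) (hB1 : ‖B‖ = 1) (hz : z = 0 ∨ z.re = 1) (hzp : z ≠ p) (hzq : z ≠ q)
    (ht : t ∈ Icc (0 : ℝ) 1) : windingCurve p q A B k t ≠ z := by
  have key : ∀ {p A : ℂ} {s : ℝ}, p.re = 1 → A.re < 0 → ‖A‖ = 1 → 0 ≤ s → s ≤ 3 / 8 → z ≠ p →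
      ∀ x ∈ Icc (0 : ℝ) 1, (1 - (x : ℂ)) * (p + s * A) + (x : ℂ) * (1 / 8) ≠ z := by
    intro p A s hp hA hA1 hs hs' hzp x hx
    have hre : (p + s * A).re = 1 + s * A.re := by
      rw [Complex.add_re, Complex.re_ofReal_mul, hp]
    have hAre := (abs_le.1 (Complex.abs_re_le_norm A)).1
    rw [hA1] at hAre
    refine segment_ne hx ?_ ?_ (fun _ => ?_) hz
    · rw [hre]; nlinarith
    · rw [hre]; nlinarith
    · rcases hs.eq_or_lt with h0 | h0
      · right
        rw [← h0]
        simpa using hzp.symm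
      · left
        rw [hre]; nlinarith
  rcases le_total t (3 / 8) with h1 | h1
  · rw [windingCurve_of_le h1]
    exact key hp hA hA1 ht.1 h1 hzp _
      ⟨Real.smoothTransition.nonneg _, Real.smoothTransition.le_one _⟩
  rcases le_total t (5 / 8) with h2 | h2
  · intro h
    have := norm_windingCurve_of_mem (p := p) (q := q) (A := A) (B := B) (k := k) ⟨h1, h2⟩
    rw [h] at this
    rcases hz with rfl | hz
    · norm_num at this
    · have := Complex.abs_re_le_norm z
      rw [hz] at this
      norm_num at this
      linarith
  · rw [windingCurve_of_ge h2]
    -- The last part has the form of the first one with time reversed.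
    have := key (s := 1 - t) hq hB hB1 (by linarith [ht.2]) (by linarith) hzq
      (1 - Real.smoothTransition (8 * t - 5)) ⟨by linarith [Real.smoothTransition.le_one (8 * t - 5)],
        by linarith [Real.smoothTransition.nonneg (8 * t - 5)]⟩
    push_cast at this
    rw [add_comm]
    convert this using 2
    ring

/-- Curves with different `k` differ only while on the circle of radius 1/8, which contributes 2πik
seen from its centre and nothing seen from a point with real part 1. -/
theorem logVar_windingCurve_sub {z : ℂ} (hp : p.re = 1) (hq : q.re = 1) (hA : A.re < 0)
    (hA1 : ‖A‖ = 1) (hB : B.re < 0) (hB1 : ‖B‖ = 1) (hz : z = 0 ∨ z.re = 1) (hzp : z ≠ p)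
    (hzq : z ≠ q) : logVar (fun t => windingCurve p q A B k t - z) 0 1 -
      logVar (fun t => windingCurve p q A B 0 t - z) 0 1 =
        2 * Real.pi * Complex.I * if z = 0 then (k : ℂ) else 0 := by
  have hc : ∀ k a b, ContinuousOn (fun t => windingCurve p q A B k t - z) (Icc a b) :=
    fun k a b => ((contDiff_windingCurve p q A B k).continuous.sub continuous_const).continuousOn
  have h0 : ∀ k : ℤ, ∀ t ∈ Icc (0 : ℝ) 1, windingCurve p q A B k t - z ≠ 0 := fun k t ht =>
    sub_ne_zero.2 (windingCurve_ne hp hq hA hA1 hB hB1 hz hzp hzq ht)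
  have hsplit : ∀ k : ℤ, logVar (fun t => windingCurve p q A B k t - z) 0 1 =
      logVar (fun t => windingCurve p q A B k t - z) 0 (3 / 8) +
      logVar (fun t => windingCurve p q A B k t - z) (3 / 8) (5 / 8) +
      logVar (fun t => windingCurve p q A B k t - z) (5 / 8) 1 := by
    intro k
    rw [logVar_add (a := 0) (b := 3 / 8) (c := 5 / 8) (by norm_num) (by norm_num) (hc k _ _)
      (fun t ht => h0 k t ⟨ht.1, by linarith [ht.2]⟩),
      logVar_add (by norm_num) (by norm_num) (hc k _ _) (h0 k)]
  have e1 : logVar (fun t => windingCurve p q A B k t - z) 0 (3 / 8) =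
      logVar (fun t => windingCurve p q A B 0 t - z) 0 (3 / 8) :=
    logVar_congr (by norm_num) (hc 0 _ _) (fun t ht => h0 0 t ⟨ht.1, by linarith [ht.2]⟩)
      (fun t ht => by simp only [windingCurve_of_le ht.2])
  have e2 : logVar (fun t => windingCurve p q A B k t - z) (5 / 8) 1 =
      logVar (fun t => windingCurve p q A B 0 t - z) (5 / 8) 1 :=
    logVar_congr (by norm_num) (hc 0 _ _) (fun t ht => h0 0 t ⟨by linarith [ht.1], ht.2⟩)
      (fun t ht => by simp only [windingCurve_of_ge ht.1])
  have e3 : ∀ k : ℤ, logVar (fun t => windingCurve p q A B k t - z) (3 / 8) (5 / 8) =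
      2 * Real.pi * Complex.I * if z = 0 then (k : ℂ) else 0 := by
    intro k
    have hs1 : Real.smoothTransition (4 * (5 / 8) - 3 / 2) = 1 :=
      Real.smoothTransition.one_of_one_le (by norm_num)
    have hs0 : Real.smoothTransition (4 * (3 / 8) - 3 / 2) = 0 :=
      Real.smoothTransition.zero_of_nonpos (by norm_num)
    split_ifs with h
    · have hcont : Continuous fun t : ℝ => Complex.log (1 / 8) +
          (Real.smoothTransition (4 * t - 3 / 2) : ℂ) * (2 * Real.pi * Complex.I * k) :=
        continuous_const.add ((Complex.continuous_ofReal.comp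
          (Real.smoothTransition.continuous.comp (by fun_prop))).mul continuous_const)
      rw [logVar_eq (by norm_num) hcont.continuousOn fun t ht => ?_]
      · simp only [hs1, hs0]
        push_cast
        ring
      · rw [windingCurve_of_mem ht, Complex.exp_add, Complex.exp_log (by norm_num), h, sub_zero]
    · have hz1 : 1 ≤ ‖z‖ := by
        have := Complex.abs_re_le_norm z
        rw [hz.resolve_left h] at this
        simpa using this
      have e4 : ∀ t ∈ Icc (3 / 8 : ℝ) (5 / 8), ‖(windingCurve p q A B k t - z) - (-z)‖ < ‖-z‖ := by
        intro t ht
        rw [sub_neg_eq_add, sub_add_cancel, norm_neg, norm_windingCurve_of_mem ht]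
        linarith
      have hend : windingCurve p q A B k (5 / 8) = windingCurve p q A B k (3 / 8) := by
        rw [windingCurve_of_ge le_rfl, windingCurve_of_le le_rfl,
          Real.smoothTransition.zero_of_nonpos (show (8 * (5 / 8) - 5 : ℝ) ≤ 0 by norm_num),
          Real.smoothTransition.one_of_one_le (show 1 ≤ (8 * (3 / 8) - 2 : ℝ) by norm_num)]
        norm_num
      rw [logVar_eq_of_close (by norm_num) continuousOn_const (hc k _ _) e4, hend, sub_self,
        add_zero, mul_zero]
      exact logVar_const (by norm_num) (neg_ne_zero.2 h)
  rw [hsplit k, hsplit 0, e1, e2, e3 k, e3 0]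
  simp

end windingCurve

/-! ### Drawings with prescribed winding numbers -/

/-- A smooth weight supported on `[1 / 4, 3 / 4]`. -/
noncomputable def middleWeight (t : ℝ) : ℝ := expNegInvGlue ((t - 1 / 4) * (3 / 4 - t))

theorem contDiff_middleWeight : ContDiff ℝ ∞ middleWeight :=
  expNegInvGlue.contDiff.comp (by fun_prop)

theorem middleWeight_ne_zero {t : ℝ} : middleWeight t ≠ 0 ↔ t ∈ Ioo (1 / 4 : ℝ) (3 / 4) := by
  rw [middleWeight, Ne, expNegInvGlue.zero_iff_nonpos, not_le, mem_Ioo]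
  constructor
  · intro h
    constructor <;> nlinarith
  · rintro ⟨h1, h2⟩
    exact mul_pos (by linarith) (by linarith)

theorem middleWeight_mem (t : ℝ) : middleWeight t ∈ Icc (0 : ℝ) 1 := by
  refine ⟨expNegInvGlue.nonneg _, ?_⟩
  rw [middleWeight, expNegInvGlue]
  split_ifs with h
  · exact zero_le_one
  · rw [Real.exp_le_one_iff]
    have := inv_pos.2 (not_le.1 h)
    linarith

/-- Two choices of winding numbers are realized by drawings that agree on the edges with the same
winding number. -/
theorem exists_starDrawing_pair {α β : Type*} {G : Graph α β} (hV : G.vertexSet.Finite)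
    (hE : G.edgeSet.Finite) {src tgt : β → α} {pos : α → ℂ} {dir : β → Bool → ℂ}
    (link : ∀ e ∈ G.edgeSet, G.IsLink e (src e) (tgt e))
    (sep : ∀ u ∈ G.vertexSet, ∀ v ∈ G.vertexSet, u ≠ v → 1 ≤ ‖pos u - pos v‖)
    (norm_dir : ∀ e ∈ G.edgeSet, ∀ b, ‖dir e b‖ = 1)
    (dir_inj : ∀ d ∈ G.edgeSet, ∀ e ∈ G.edgeSet, ∀ a b, dir d a = dir e b → d = e ∧ a = b)
    (k k' : β → ℤ) {η : ℝ} (hη : 0 < η) :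
    ∃ c c' : β → ℝ → ℂ, StarDrawing G src tgt pos dir c ∧ StarDrawing G src tgt pos dir c' ∧
      (∀ e, k e = k' e → c e = c' e) ∧
      (∀ e, ∀ t ∈ Icc (0 : ℝ) 1,
        ‖c e t - windingCurve (pos (src e)) (pos (tgt e)) (dir e false) (dir e true) (k e) t‖ < η) ∧
      ∀ e, ∀ t ∈ Icc (0 : ℝ) 1,
        ‖c' e t - windingCurve (pos (src e)) (pos (tgt e)) (dir e false) (dir e true) (k' e) t‖
          < η := by
  set E : (β → ℤ) → β → ℝ → ℂ := fun k e =>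
    windingCurve (pos (src e)) (pos (tgt e)) (dir e false) (dir e true) (k e) with hEdef
  have hsm : ∀ k e, ContDiff ℝ ∞ (E k e) := fun k e => contDiff_windingCurve _ _ _ _ _
  -- The same perturbation `a` serves both families, which is why edges with equal winding numbers
  -- remain equal. The bound η/3 accounts for the three coefficients.
  obtain ⟨a, ha, h1, h2⟩ := exists_genericAt_perturbed hE (hsm k) (hsm k') contDiff_middleWeight
    (hV.image pos) (show 0 < η / 3 by positivity)
  have hout : ∀ k e t, t ∉ Ioo (1 / 4 : ℝ) (3 / 4) → perturbed (E k) middleWeight a e t = E k e t := by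
    intro k e t ht
    rw [← middleWeight_ne_zero, not_not] at ht
    rw [perturbed, ht]
    simp
  have hset : {t | middleWeight t ≠ 0} = Ioo (1 / 4 : ℝ) (3 / 4) := by
    ext t
    exact middleWeight_ne_zero
  rw [hset] at h1 h2
  have hstar : ∀ k, GenericAt (perturbed (E k) middleWeight a) G.edgeSet (Ioo (1 / 4) (3 / 4))
      (pos '' G.vertexSet) → StarDrawing G src tgt pos dir (perturbed (E k) middleWeight a) :=
    fun k h =>
    { link := link
      sep := sep
      norm_dir := norm_dir
      dir_inj := dir_inj
      smooth := contDiff_perturbed (hsm k) contDiff_middleWeight a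
      start := fun e _ t ht => by
        rw [hout k e t fun h => not_lt.2 ht.2 h.1]
        exact windingCurve_start ht.2
      finish := fun e _ t ht => by
        rw [hout k e t fun h => not_lt.2 ht.1 h.2]
        exact windingCurve_finish ht.1
      generic := h }
  have hclose : ∀ k e, ∀ t ∈ Icc (0 : ℝ) 1, ‖perturbed (E k) middleWeight a e t - E k e t‖ < η := by
    intro k e t ht
    have hw := middleWeight_mem t
    have h0 : ‖a e 0 + t * a e 1 + t ^ 2 * a e 2‖ < η := by
      have ht2 : t ^ 2 ≤ 1 := pow_le_one₀ ht.1 ht.2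
      calc ‖a e 0 + t * a e 1 + t ^ 2 * a e 2‖
          ≤ ‖a e 0‖ + ‖(t : ℂ) * a e 1‖ + ‖(t : ℂ) ^ 2 * a e 2‖ := norm_add₃_le
        _ = ‖a e 0‖ + t * ‖a e 1‖ + t ^ 2 * ‖a e 2‖ := by
          rw [norm_mul, norm_mul, norm_pow, Complex.norm_real, Real.norm_of_nonneg ht.1]
        _ ≤ ‖a e 0‖ + ‖a e 1‖ + ‖a e 2‖ := by
          gcongr
          · exact mul_le_of_le_one_left (norm_nonneg _) ht.2
          · exact mul_le_of_le_one_left (norm_nonneg _) ht2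
        _ < η := by linarith [ha e 0, ha e 1, ha e 2]
    rw [perturbed, add_sub_cancel_left, norm_mul, Complex.norm_real, Real.norm_of_nonneg hw.1]
    exact lt_of_le_of_lt (mul_le_of_le_one_left (norm_nonneg _) hw.2) h0
  refine ⟨_, _, hstar k h1, hstar k' h2, fun e he => ?_, hclose k, hclose k'⟩
  funext t
  simp only [perturbed, hEdef, he]

/-- Directions pointing to the left half plane. -/
noncomputable def leftDir (x : ℝ) : ℂ := -Complex.exp (x * Complex.I)

theorem norm_leftDir (x : ℝ) : ‖leftDir x‖ = 1 := by
  rw [leftDir, norm_neg, Complex.norm_exp_ofReal_mul_I]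

theorem leftDir_re (x : ℝ) : (leftDir x).re = -Real.cos x := by
  rw [leftDir, Complex.neg_re, Complex.exp_ofReal_mul_I_re]

theorem leftDir_re_neg {x : ℝ} (hx : |x| < 1) : (leftDir x).re < 0 := by
  rw [leftDir_re, neg_lt_zero]
  have := Real.pi_gt_three
  exact Real.cos_pos_of_mem_Ioo ⟨by linarith [(abs_lt.1 hx).1], by linarith [(abs_lt.1 hx).2]⟩

theorem leftDir_injOn {x y : ℝ} (hx : |x| < 1) (hy : |y| < 1) (h : leftDir x = leftDir y) :
    x = y := by
  have hpi := Real.pi_gt_three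
  have h1 : Complex.exp (x * Complex.I) = Complex.exp (y * Complex.I) := neg_injective h
  have h2 := Complex.exp_inj_of_neg_pi_lt_of_le_pi (x := x * Complex.I) (y := y * Complex.I)
    (by simp; linarith [(abs_lt.1 hx).1]) (by simp; linarith [(abs_lt.1 hx).2])
    (by simp; linarith [(abs_lt.1 hy).1]) (by simp; linarith [(abs_lt.1 hy).2]) h1
  simpa using h2

/-- Well separated positions of the vertices with `v` in the origin. -/
theorem exists_pos {α : Type*} {V : Set α} (hV : V.Finite) (v : α) :
    ∃ pos : α → ℂ, pos v = 0 ∧ (∀ u, u ≠ v → (pos u).re = 1) ∧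
      ∀ u ∈ V, ∀ w ∈ V, u ≠ w → 1 ≤ ‖pos u - pos w‖ := by
  classical
  obtain ⟨n, hn⟩ := Set.countable_iff_exists_injOn.1 hV.countable
  refine ⟨fun u => if u = v then 0 else 1 + n u * Complex.I, if_pos rfl, fun u hu => ?_,
    fun u hu w hw huw => ?_⟩
  · simp [if_neg hu]
  · by_cases h1 : u = v
    · have h2 : w ≠ v := fun h => huw (h1.trans h.symm)
      have := Complex.abs_re_le_norm (1 + n w * Complex.I)
      simpa only [if_pos h1, if_neg h2, zero_sub, norm_neg, Complex.add_re, Complex.one_re,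
        Complex.mul_I_re, Complex.natCast_im, neg_zero, add_zero, abs_one] using this
    by_cases h2 : w = v
    · have := Complex.abs_re_le_norm (1 + n u * Complex.I - 0)
      simpa only [if_pos h2, if_neg h1, Complex.sub_re, Complex.add_re, Complex.zero_re,
        Complex.one_re, Complex.mul_I_re, Complex.natCast_im, neg_zero, add_zero, sub_zero,
        abs_neg, abs_one] using this
    · simp only [if_neg h1, if_neg h2]
      rw [show 1 + (n u : ℂ) * Complex.I - (1 + n w * Complex.I) = ((n u - n w : ℤ) : ℂ) * Complex.I by
        push_cast; ring, norm_mul, Complex.norm_I, mul_one, Complex.norm_intCast]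
      have h3 : (n u : ℤ) - n w ≠ 0 := sub_ne_zero.2 fun h => huw (hn hu hw (by exact_mod_cast h))
      exact_mod_cast Int.one_le_abs h3

/-- Distinct angles for the ends of the edges. -/
theorem exists_angles {β : Type*} {S : Set β} (hS : S.Finite) :
    ∃ ang : β → Bool → ℝ, (∀ f b, 0 < ang f b ∧ ang f b < 1) ∧
      ∀ f ∈ S, ∀ f' ∈ S, ∀ b b', ang f b = ang f' b' → f = f' ∧ b = b' := by
  obtain ⟨n, hn⟩ := Set.countable_iff_exists_injOn.1 hS.countable
  -- Even and odd integers separate the two ends of an edge, in particular those of a loop.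
  refine ⟨fun f b => 1 / (((2 * n f + if b then 1 else 0 : ℕ) : ℝ) + 2), fun f b => ⟨by positivity, ?_⟩,
    fun f hf f' hf' b b' h => ?_⟩
  · rw [div_lt_one (by positivity)]
    have : (0 : ℝ) ≤ (2 * n f + if b then 1 else 0 : ℕ) := by positivity
    linarith
  · simp only [one_div, inv_inj, add_left_inj, Nat.cast_inj] at h
    have h1 : n f = n f' := by
      split_ifs at h <;> omega
    refine ⟨hn hf hf' h1, ?_⟩
    simp only [h1] at h
    cases b <;> cases b' <;> simp at h ⊢

/-- Distinct angles for the ends of the edges, two of which are prescribed. -/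
theorem exists_angles_of_ne {β : Type*} {S : Set β} (hS : S.Finite) {d e : β} (hde : d ≠ e) :
    ∃ ang : β → Bool → ℝ, (∀ f b, |ang f b| < 1) ∧ ang e false = -(3 / 4) ∧
      ang d false = -(1 / 2) ∧
      (∀ f b, (f, b) ≠ (e, false) → (f, b) ≠ (d, false) → 0 < ang f b) ∧
      ∀ f ∈ S, ∀ f' ∈ S, ∀ b b', ang f b = ang f' b' → f = f' ∧ b = b' := by
  classical
  obtain ⟨g, hg, hinj⟩ := exists_angles hS
  -- All other angles are positive, so the two prescribed ends are neighbours wherever they share a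
  -- vertex.
  refine ⟨fun f b => if (f, b) = (e, false) then -(3 / 4) else if (f, b) = (d, false) then -(1 / 2)
    else g f b, fun f b => ?_, if_pos rfl, ?_, fun f b h1 h2 => ?_, fun f hf f' hf' b b' h => ?_⟩
  · simp only
    split_ifs
    · rw [abs_neg]; norm_num
    · rw [abs_neg]; norm_num
    · rw [abs_of_pos (hg f b).1]
      exact (hg f b).2
  · simp [hde]
  · simp only [if_neg h1, if_neg h2]
    exact (hg f b).1
  · have hfb := (hg f b).1
    have hfb' := (hg f' b').1
    have : (f, b) = (f', b') := by
      simp only at h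
      split_ifs at h with h1 h2 h3 h4 h5 h6
      · rw [h1, h2]
      · norm_num at h
      · linarith
      · norm_num at h
      · rw [h4, h6]
      · linarith
      · linarith
      · linarith
      · have := hinj f hf f' hf' b b' h
        rw [this.1, this.2]
    simpa using this

/-- The edges can be oriented such that all edges incident to `v` start at `v`. -/
theorem exists_orientation {α β : Type*} (G : Graph α β) (v : α) : ∃ src tgt : β → α,
    (∀ e ∈ G.edgeSet, G.IsLink e (src e) (tgt e)) ∧ ∀ e, G.Inc e v → src e = v := by
  classical
  have : ∀ e, ∃ x y, (e ∈ G.edgeSet → G.IsLink e x y) ∧ (G.Inc e v → x = v) := by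
    intro e
    by_cases hv : G.Inc e v
    · obtain ⟨y, hy⟩ := hv
      exact ⟨v, y, fun _ => hy, fun _ => rfl⟩
    by_cases he : e ∈ G.edgeSet
    · obtain ⟨x, y, hxy⟩ := (G.edge_mem_iff_exists_isLink e).1 he
      exact ⟨x, y, fun _ => hxy, fun h => absurd h hv⟩
    · exact ⟨v, v, fun h => absurd h he, fun h => absurd h hv⟩
  choose src tgt h using this
  exact ⟨src, tgt, fun e => (h e).1, fun e => (h e).2⟩

theorem StarDrawing.edgeVar_eq {α β : Type*} {G : Graph α β} {src tgt : β → α} {pos : α → ℂ}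
    {dir : β → Bool → ℂ} {c : β → ℝ → ℂ} (D : StarDrawing G src tgt pos dir c)
    (hE : G.edgeSet.Finite) {e : β} (he : e ∈ G.edgeSet) (u : α) :
    (D.toGenericImmersion hE).edgeVar src tgt e u = logVar (fun t => c e t - pos u) 0 1 := by
  rw [GenericImmersion.edgeVar, GenericImmersion.orientedEdge_of]
  · simp [toGenericImmersion]
  · simp only [toGenericImmersion]
    rw [D.start e he 0 (by norm_num)]
    simp
  · simp only [toGenericImmersion]
    rw [D.finish e he 1 (by norm_num)]
    simp

/-! ### Necessity of the vertex-edge condition -/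

/-- The condition for a vertex and an edge not incident to it is necessary. -/
theorem dvd_sum_endsAt_of_not_inc {α β : Type*} {G : Graph α β} (hV : G.vertexSet.Finite)
    (hE : G.edgeSet.Finite) (Λ : Finset (Graph α β)) (hΛ : ∀ H ∈ Λ, H ≤ G) (m : ℕ)
    (hA : ∀ f g : GenericImmersion G,
      ∑ H ∈ Λ, f.crossingNumber H ≡ ∑ H ∈ Λ, g.crossingNumber H [MOD m])
    (h1 : ∀ e ∈ G.edgeSet, m ∣ countContaining Λ e e)
    (h2 : ∀ d ∈ G.edgeSet, ∀ e ∈ G.edgeSet, d ≠ e → m ∣ 2 * countContaining Λ d e)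
    (h4 : ∀ d ∈ G.edgeSet, ∀ e ∈ G.edgeSet, AdjacentEdges G d e → m ∣ countContaining Λ d e)
    {v : α} (hv : v ∈ G.vertexSet) {e : β} (he : e ∈ G.edgeSet) (hev : ¬ G.Inc e v) :
    m ∣ ∑ e' ∈ hE.toFinset, endsAt G v e' * countContaining Λ e e' := by
  classical
  obtain ⟨pos, hpv, hpos, sep⟩ := exists_pos hV v
  obtain ⟨src, tgt, link, -⟩ := exists_orientation G v
  obtain ⟨ang, hang, hinj⟩ := exists_angles hE
  have hang' : ∀ f b, |ang f b| < 1 := fun f b => by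
    rw [abs_of_pos (hang f b).1]
    exact (hang f b).2
  -- The edge `e` winds once around `v` in the first drawing and not at all in the second; all other
  -- edges are the same curves in both.
  set k : β → ℤ := fun d => if d = e then 1 else 0 with hk
  set E : ℤ → ℝ → ℂ := windingCurve (pos (src e)) (pos (tgt e)) (leftDir (ang e false))
    (leftDir (ang e true)) with hEdef
  have hsrc : src e ≠ v := fun h => hev (h ▸ (link e he).inc_left)
  have htgt : tgt e ≠ v := fun h => hev (h ▸ (link e he).inc_right)
  have hp := hpos _ hsrc
  have hq := hpos _ htgt
  have hside : ∀ u, pos u = 0 ∨ (pos u).re = 1 := fun u => by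
    by_cases h : u = v
    · exact Or.inl (by rw [h, hpv])
    · exact Or.inr (hpos u h)
  have hposne : ∀ u ∈ G.vertexSet, ∀ w ∈ G.vertexSet, u ≠ w → pos u ≠ pos w := by
    intro u hu w hw huw h
    have := sep u hu w hw huw
    rw [h, sub_self, norm_zero] at this
    norm_num at this
  have hzp : ∀ u ∈ G.vertexSet, ¬ G.Inc e u → pos u ≠ pos (src e) := fun u hu hi =>
    hposne u hu _ (link e he).left_mem fun h => hi (h ▸ (link e he).inc_left)
  have hzq : ∀ u ∈ G.vertexSet, ¬ G.Inc e u → pos u ≠ pos (tgt e) := fun u hu hi =>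
    hposne u hu _ (link e he).right_mem fun h => hi (h ▸ (link e he).inc_right)
  have hEcont : ∀ k, Continuous (E k) := fun k => (contDiff_windingCurve _ _ _ _ k).continuous
  have havoid : ∀ k, ∀ u ∈ G.vertexSet, ¬ G.Inc e u → ∀ t ∈ Icc (0 : ℝ) 1, E k t - pos u ≠ 0 :=
    fun k u hu hi t ht => sub_ne_zero.2 (windingCurve_ne hp hq (leftDir_re_neg (hang' _ _))
      (norm_leftDir _) (leftDir_re_neg (hang' _ _)) (norm_leftDir _) (hside u) (hzp u hu hi)
      (hzq u hu hi) ht)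
  -- A perturbation smaller than the distance to every other vertex does not change the variations
  -- of `e`.
  have hmin : ∀ k, ∀ u ∈ G.vertexSet, ∀ᶠ η in 𝓝[>] (0 : ℝ), ¬ G.Inc e u →
      ∀ t ∈ Icc (0 : ℝ) 1, η < ‖E k t - pos u‖ := by
    intro k u hu
    by_cases hi : G.Inc e u
    · exact Eventually.of_forall fun _ h => absurd hi h
    obtain ⟨t0, ht0, hmin⟩ := isCompact_Icc.exists_isMinOn (nonempty_Icc.2 zero_le_one)
      ((hEcont k).sub (continuous_const (y := pos u))).norm.continuousOn
    filter_upwards [Ioo_mem_nhdsGT (norm_pos_iff.2 (havoid k u hu hi t0 ht0))] with η hη _ t ht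
    exact hη.2.trans_le (hmin ht)
  obtain ⟨η, ⟨hη1, hη0⟩, hη⟩ := (((eventually_all_finite hV).2 (hmin 1)).and
    ((eventually_all_finite hV).2 (hmin 0))).and self_mem_nhdsWithin |>.exists
  obtain ⟨c, c', D, D', hcc, hc, hc'⟩ := exists_starDrawing_pair (dir := fun f b => leftDir (ang f b))
    hV hE link sep (fun _ _ _ => norm_leftDir _)
    (fun d hd f hf a b h => hinj d hd f hf a b (leftDir_injOn (hang' _ _) (hang' _ _) h))
    k (fun _ => 0) hη
  have hvar : ∀ {c : β → ℝ → ℂ} (k : ℤ), StarDrawing G src tgt pos (fun f b => leftDir (ang f b)) c →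
      (∀ t ∈ Icc (0 : ℝ) 1, ‖c e t - E k t‖ < η) →
      (∀ u ∈ G.vertexSet, ¬ G.Inc e u → ∀ t ∈ Icc (0 : ℝ) 1, η < ‖E k t - pos u‖) →
      ∀ u ∈ G.vertexSet, ¬ G.Inc e u → logVar (fun t => c e t - pos u) 0 1 =
        logVar (fun t => E k t - pos u) 0 1 := by
    intro c k D hc hη u hu hi
    rw [logVar_eq_of_close (γ := fun t => E k t - pos u)
      (δ := fun t => c e t - pos u) zero_le_one
      ((hEcont k).sub continuous_const).continuousOn
      ((D.smooth e).continuous.sub continuous_const).continuousOn fun t ht => ?_]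
    · have e0 : c e 0 = E k 0 := by
        rw [D.start e he 0 (by norm_num), hEdef, windingCurve_start (by norm_num)]
      have e1 : c e 1 = E k 1 := by
        rw [D.finish e he 1 (by norm_num), hEdef, windingCurve_finish (by norm_num)]
      rw [e0, e1, div_self (havoid k u hu hi 0 (by norm_num)),
        div_self (havoid k u hu hi 1 (by norm_num)), sub_self, add_zero]
    · rw [sub_sub_sub_cancel_right]
      exact (hc t ht).trans (hη u hu hi t ht)
  -- The vertices have the same positions in both drawings, so θ = 0; φ is the indicator of (e, v),
  -- and a single term of the double sum survives.
  have key := GenericImmersion.sum_crossingNumber_sub hV hE Λ hΛ m h1 h2 h4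
    (D.toGenericImmersion hE) (D'.toGenericImmersion hE) link (fun _ _ => 0) (fun _ _ _ _ => rfl)
    (fun d u => if d = e ∧ u = v then 1 else 0) fun d hd u hu hi => by
      rw [D.edgeVar_eq hE hd, D'.edgeVar_eq hE hd]
      by_cases hde : d = e
      · subst hde
        have hc1 : ∀ t ∈ Icc (0 : ℝ) 1, ‖c d t - E 1 t‖ < η := fun t ht => by
          have := hc d t ht
          rwa [show k d = 1 from if_pos rfl] at this
        rw [hvar 1 D hc1 hη1 u hu hi, hvar 0 D' (hc' d) hη0 u hu hi]
        have := logVar_windingCurve_sub (k := 1) hp hq (leftDir_re_neg (hang' d false))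
          (norm_leftDir _) (leftDir_re_neg (hang' d true)) (norm_leftDir _) (hside u) (hzp u hu hi)
          (hzq u hu hi)
        rw [hEdef, this]
        have hu0 : pos u = 0 ↔ u = v := by
          constructor
          · intro h
            by_contra huv
            have := hpos u huv
            rw [h] at this
            norm_num at this
          · rintro rfl
            exact hpv
        by_cases huv : u = v
        · simp [huv, hpv]
        · simp [huv, hu0.not.2 huv]
      · rw [hcc d (by rw [hk]; exact if_neg hde)]
        simp [hde]
  have hmod := (ZMod.natCast_eq_natCast_iff _ _ m).2
    (hA (D.toGenericImmersion hE) (D'.toGenericImmersion hE))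
  rw [sub_eq_zero.2 hmod, Finset.sum_eq_single_of_mem e (hE.mem_toFinset.2 he),
    Finset.sum_eq_single_of_mem v (hV.mem_toFinset.2 hv)] at key
  · rw [← ZMod.natCast_eq_zero_iff, key]
    simp
  · intro u _ hu
    simp [hu]
  · intro d _ hd
    simp [hd]

/-! ### Surgery on an arc of an edge -/

/-- The points of the edge `e` with parameter in `O` are multiple points only for the parameters
`t ∈ N`, and then the other branch is `d` at the parameter `σ t`. -/
structure CrossesAlong {α β : Type*} (G : Graph α β) (vert : α → Plane) (edge : β → ℝ → Plane)
    (d e : β) (O N : Set ℝ) (σ : ℝ → ℝ) : Prop where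
  subset : N ⊆ O
  mem : ∀ t ∈ N, σ t ∈ Ioo (0 : ℝ) 1 ∧ (d, σ t) ≠ (e, t)
  iff : ∀ t ∈ O, ∀ p ∈ pointSet G, p ≠ Sum.inr (e, t) →
    (pointMap vert edge p = edge e t ↔ t ∈ N ∧ p = Sum.inr (d, σ t))

/-- The multiple points that do not involve the points of the edge `e` with parameter in `O`. -/
def multiplePointsOff {α β : Type*} (vert : α → Plane) (edge : β → ℝ → Plane) (H : Graph α β)
    (e : β) (O : Set ℝ) : Set Plane :=
  {q | ∃ p ∈ pointSet H, ∃ p' ∈ pointSet H, (∀ t ∈ O, p ≠ Sum.inr (e, t)) ∧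
    (∀ t ∈ O, p' ≠ Sum.inr (e, t)) ∧
    p ≠ p' ∧ pointMap vert edge p = q ∧ pointMap vert edge p' = q}

namespace GenericImmersion
variable {α β : Type*} {G : Graph α β}

/-- A crossing either avoids the arc or is one of the prescribed crossings with `d`, seen by H
exactly when both edges are in H. The two kinds are disjoint, as there are no triple points. -/
theorem crossingNumber_eq_off [DecidableEq β] (f : GenericImmersion G) {d e : β} (he : e ∈ G.edgeSet)
    {O N : Set ℝ} {σ : ℝ → ℝ} (hO : O ⊆ Ioo 0 1) (hN : N.Finite)
    (h : CrossesAlong G f.vert f.edge d e O N σ) {H : Graph α β} (hH : H ≤ G)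
    [Decidable (d ∈ H.edgeSet ∧ e ∈ H.edgeSet)] :
    f.crossingNumber H = (multiplePointsOff f.vert f.edge H e O).ncard +
      if d ∈ H.edgeSet ∧ e ∈ H.edgeSet then (f.edge e '' N).ncard else 0 := by
  have hsub : multiplePointsOff f.vert f.edge H e O ⊆ multiplePoints f.vert f.edge H := by
    rintro q ⟨p, hp, p', hp', -, -, hq⟩
    exact ⟨p, hp, p', hp', hq⟩
  have hG : multiplePoints f.vert f.edge H ⊆ multiplePoints f.vert f.edge G := by
    rintro q ⟨p, hp, p', hp', hq⟩
    exact ⟨p, pointSet_mono hH hp, p', pointSet_mono hH hp', hq⟩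
  have hfin := f.finite_multiplePoints.subset (hsub.trans hG)
  have hcase : ∀ t ∈ O, Sum.inr (e, t) ∈ pointSet H → ∀ p ∈ pointSet H, p ≠ Sum.inr (e, t) →
      pointMap f.vert f.edge p = f.edge e t →
        t ∈ N ∧ d ∈ H.edgeSet ∧ e ∈ H.edgeSet := by
    intro t ht hpt p hp hne hpe
    obtain ⟨htN, rfl⟩ := (h.iff t ht p (pointSet_mono hH hp) hne).1 hpe
    exact ⟨htN, (inr_mem_pointSet.1 hp).1, (inr_mem_pointSet.1 hpt).1⟩
  have hsplit : ∀ q ∈ multiplePoints f.vert f.edge H, q ∈ multiplePointsOff f.vert f.edge H e O ∨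
      (q ∈ f.edge e '' N ∧ d ∈ H.edgeSet ∧ e ∈ H.edgeSet) := by
    rintro q ⟨p, hp, p', hp', hne, hq, hq'⟩
    by_cases h1 : ∃ t ∈ O, p = Sum.inr (e, t)
    · obtain ⟨t, ht, rfl⟩ := h1
      obtain ⟨a, b⟩ := hcase t ht hp p' hp' hne.symm (hq'.trans hq.symm)
      exact Or.inr ⟨⟨t, a, hq⟩, b⟩
    by_cases h2 : ∃ t ∈ O, p' = Sum.inr (e, t)
    · obtain ⟨t, ht, rfl⟩ := h2
      obtain ⟨a, b⟩ := hcase t ht hp' p hp hne (hq.trans hq'.symm)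
      exact Or.inr ⟨⟨t, a, hq'⟩, b⟩
    push Not at h1 h2
    exact Or.inl ⟨p, hp, p', hp', h1, h2, hne, hq, hq'⟩
  rw [crossingNumber]
  split_ifs with hde
  · rw [← ncard_union_eq _ hfin (hN.image _)]
    · congr 1
      refine Subset.antisymm (fun q hq => ?_) (union_subset hsub ?_)
      · exact (hsplit q hq).imp_right fun h => h.1
      · rintro q ⟨t, ht, rfl⟩
        have hp : (Sum.inr (d, σ t) : α ⊕ β × ℝ) ∈ pointSet H :=
          inr_mem_pointSet.2 ⟨hde.1, (h.mem t ht).1⟩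
        have hne : (Sum.inr (d, σ t) : α ⊕ β × ℝ) ≠ Sum.inr (e, t) := fun hh =>
          (h.mem t ht).2 (Sum.inr_injective hh)
        exact ⟨_, inr_mem_pointSet.2 ⟨hde.2, hO (h.subset ht)⟩, _, hp, hne.symm, rfl,
          (h.iff t (h.subset ht) _ (pointSet_mono hH hp) hne).2 ⟨ht, rfl⟩⟩
    · rw [Set.disjoint_left]
      rintro q ⟨p, hp, p', hp', h1, h2, hne, hq, hq'⟩ ⟨t, ht, rfl⟩
      have ht' := h.subset ht
      rcases f.double p (pointSet_mono hH hp) p' (pointSet_mono hH hp') (Sum.inr (e, t))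
        (inr_mem_pointSet.2 ⟨he, hO ht'⟩) (hq.trans hq'.symm) hq' with h3 | h3 | h3
      · exact hne h3
      · exact h2 t ht' h3
      · exact h1 t ht' h3
  · rw [add_zero]
    congr 1
    exact Subset.antisymm (fun q hq => (hsplit q hq).resolve_right fun h => hde h.2) hsub

theorem sum_crossingNumber_eq_off (f : GenericImmersion G) {d e : β} (he : e ∈ G.edgeSet)
    {O N : Set ℝ} {σ : ℝ → ℝ} (hO : O ⊆ Ioo 0 1) (hN : N.Finite)
    (h : CrossesAlong G f.vert f.edge d e O N σ) (Λ : Finset (Graph α β)) (hΛ : ∀ H ∈ Λ, H ≤ G) :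
    ∑ H ∈ Λ, f.crossingNumber H = ∑ H ∈ Λ, (multiplePointsOff f.vert f.edge H e O).ncard +
      (f.edge e '' N).ncard * countContaining Λ d e := by
  classical
  rw [Finset.sum_congr rfl fun H hH => f.crossingNumber_eq_off he hO hN h (hΛ H hH),
    Finset.sum_add_distrib, ← Finset.sum_filter, Finset.sum_const, smul_eq_mul, mul_comm]
  congr 2
  rw [countContaining, ← ncard_coe_finset]
  congr 1
  ext H
  simp

/-- Replacing a piece of an edge of a generic immersion. -/
theorem exists_surgery [DecidableEq β] (f : GenericImmersion G) {d e : β} (he : e ∈ G.edgeSet)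
    {O N N' : Set ℝ} {σ σ' : ℝ → ℝ} (hO : O ⊆ Ioo 0 1) (hN : N.Finite)
    (h : CrossesAlong G f.vert f.edge d e O N σ) {γ : ℝ → Plane}
    (smooth : ContDiffOn ℝ ∞ γ (Icc 0 1))
    (regular : ∀ t ∈ Icc (0 : ℝ) 1, derivWithin γ (Icc 0 1) t ≠ 0)
    (hoff : ∀ t ∈ Icc (0 : ℝ) 1, t ∉ O → γ t = f.edge e t)
    (hoff' : ∀ t ∈ Ioo (0 : ℝ) 1, t ∉ O → deriv γ t = deriv (f.edge e) t)
    (hN' : N'.Finite) (h' : CrossesAlong G f.vert (Function.update f.edge e γ) d e O N' σ')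
    (htr : ∀ t ∈ N', LinearIndependent ℝ
      ![deriv γ t, deriv (Function.update f.edge e γ d) (σ' t)])
    (Λ : Finset (Graph α β)) (hΛ : ∀ H ∈ Λ, H ≤ G) :
    ∃ g : GenericImmersion G, ∑ H ∈ Λ, f.crossingNumber H + (γ '' N').ncard * countContaining Λ d e =
      ∑ H ∈ Λ, g.crossingNumber H + (f.edge e '' N).ncard * countContaining Λ d e := by
  set edge' := Function.update f.edge e γ with hedge'
  have hself : edge' e = γ := Function.update_self _ _ _
  have hother : ∀ x, x ≠ e → edge' x = f.edge x := fun x hx => Function.update_of_ne hx _ _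
  have hmap : ∀ p ∈ pointSet G, (∀ t ∈ O, p ≠ Sum.inr (e, t)) →
      pointMap f.vert edge' p = pointMap f.vert f.edge p := by
    rintro (v | ⟨x, t⟩) hp hpO
    · rfl
    · rw [inr_mem_pointSet] at hp
      change edge' x t = f.edge x t
      by_cases hx : x = e
      · subst hx
        rw [hself]
        exact hoff t (Ioo_subset_Icc_self hp.2) fun ht => hpO t ht rfl
      · rw [hother x hx]
  have hderiv : ∀ x ∈ G.edgeSet, ∀ t ∈ Ioo (0 : ℝ) 1, (∀ s ∈ O, (x, t) ≠ (e, s)) →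
      deriv (edge' x) t = deriv (f.edge x) t := by
    intro x _ t ht htO
    by_cases hxe : x = e
    · subst hxe
      rw [hself]
      exact hoff' t ht fun h => htO t h rfl
    · rw [hother x hxe]
  have hO0 : ∀ t, t = 0 ∨ t = 1 → t ∉ O := by
    rintro t (rfl | rfl) ht
    · exact lt_irrefl _ (hO ht).1
    · exact lt_irrefl _ (hO ht).2
  have hinO : ∀ t ∈ O, ∀ p ∈ pointSet G, pointMap f.vert edge' p = edge' e t →
      p = Sum.inr (e, t) ∨ (t ∈ N' ∧ p = Sum.inr (d, σ' t)) := by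
    intro t ht p hp hpt
    by_cases hpe : p = Sum.inr (e, t)
    · exact Or.inl hpe
    · exact Or.inr ((h'.iff t ht p hp hpe).1 hpt)
  -- The only possible second preimage of a point of the new arc is `(d, σ' t)`, so no triple point
  -- arises. Points off the arc are governed by `f`.
  have htriple : ∀ t ∈ O, ∀ p ∈ pointSet G, ∀ p' ∈ pointSet G,
      pointMap f.vert edge' p = edge' e t → pointMap f.vert edge' p' = edge' e t →
        p = Sum.inr (e, t) ∨ p' = Sum.inr (e, t) ∨ p = p' := by
    intro t ht p hp p' hp' h1 h2
    rcases hinO t ht p hp h1 with h3 | h3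
    · exact Or.inl h3
    rcases hinO t ht p' hp' h2 with h4 | h4
    · exact Or.inr (Or.inl h4)
    · exact Or.inr (Or.inr (h3.2.trans h4.2.symm))
  let g : GenericImmersion G :=
  { vert := f.vert
    edge := edge'
    ends := fun x hx => by
      obtain ⟨y, z, hyz, h0, h1⟩ := f.ends x hx
      refine ⟨y, z, hyz, ?_⟩
      by_cases hxe : x = e
      · subst hxe
        rw [hself, hoff 0 (by norm_num) (hO0 0 (Or.inl rfl)),
          hoff 1 (by norm_num) (hO0 1 (Or.inr rfl))]
        exact ⟨h0, h1⟩
      · rw [hother x hxe]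
        exact ⟨h0, h1⟩
    smooth := fun x hx => by
      by_cases hxe : x = e
      · rw [hxe, hself]
        exact smooth
      · rw [hother x hxe]
        exact f.smooth x hx
    regular := fun x hx => by
      by_cases hxe : x = e
      · rw [hxe, hself]
        exact regular
      · rw [hother x hxe]
        exact f.regular x hx
    finite_multiplePoints := by
      refine (f.finite_multiplePoints.union (hN'.image γ)).subset ?_
      rintro q ⟨p, hp, p', hp', hne, hq, hq'⟩
      by_cases h1 : ∃ t ∈ O, p = Sum.inr (e, t)
      · obtain ⟨t, ht, rfl⟩ := h1
        have h2 := (h'.iff t ht p' hp' hne.symm).1 (hq'.trans hq.symm)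
        exact Or.inr ⟨t, h2.1, by rw [← hq]; exact congrFun hself.symm t⟩
      by_cases h2 : ∃ t ∈ O, p' = Sum.inr (e, t)
      · obtain ⟨t, ht, rfl⟩ := h2
        have h2 := (h'.iff t ht p hp hne).1 (hq.trans hq'.symm)
        exact Or.inr ⟨t, h2.1, by rw [← hq']; exact congrFun hself.symm t⟩
      push Not at h1 h2
      rw [hmap p hp h1] at hq
      rw [hmap p' hp' h2] at hq'
      exact Or.inl ⟨p, hp, p', hp', hne, hq, hq'⟩
    double := fun p hp p' hp' p'' hp'' h1 h2 => by
      by_cases c1 : ∃ t ∈ O, p = Sum.inr (e, t)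
      · obtain ⟨t, ht, rfl⟩ := c1
        rcases htriple t ht p' hp' p'' hp'' h1.symm (h1.trans h2).symm with h3 | h3 | h3
        · exact Or.inl h3.symm
        · exact Or.inr (Or.inr h3.symm)
        · exact Or.inr (Or.inl h3)
      by_cases c2 : ∃ t ∈ O, p' = Sum.inr (e, t)
      · obtain ⟨t, ht, rfl⟩ := c2
        rcases htriple t ht p hp p'' hp'' h1 h2.symm with h3 | h3 | h3
        · exact Or.inl h3
        · exact Or.inr (Or.inl h3.symm)
        · exact Or.inr (Or.inr h3)
      by_cases c3 : ∃ t ∈ O, p'' = Sum.inr (e, t)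
      · obtain ⟨t, ht, rfl⟩ := c3
        rcases htriple t ht p hp p' hp' (h1.trans h2) h2 with h3 | h3 | h3
        · exact Or.inr (Or.inr h3)
        · exact Or.inr (Or.inl h3)
        · exact Or.inl h3
      push Not at c1 c2 c3
      rw [hmap p hp c1, hmap p' hp' c2] at h1
      rw [hmap p' hp' c2, hmap p'' hp'' c3] at h2
      exact f.double p hp p' hp' p'' hp'' h1 h2
    vertex_simple := fun v hv p hp hpv => by
      by_cases c1 : ∃ t ∈ O, p = Sum.inr (e, t)
      · obtain ⟨t, ht, rfl⟩ := c1
        rcases hinO t ht (Sum.inl v) (inl_mem_pointSet.2 hv) hpv.symm with h3 | h3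
        · exact absurd h3 (by simp)
        · exact absurd h3.2 (by simp)
      push Not at c1
      rw [hmap p hp c1] at hpv
      exact f.vertex_simple v hv p hp hpv
    transversal := fun x hx y hy s hs t ht hne hst => by
      by_cases c1 : ∃ r ∈ O, (x, s) = (e, r)
      · obtain ⟨r, hr, hxr⟩ := c1
        obtain ⟨rfl, rfl⟩ := Prod.mk.injEq _ _ _ _ ▸ hxr
        obtain ⟨h1, h2⟩ := (h'.iff s hr (Sum.inr (y, t)) (inr_mem_pointSet.2 ⟨hy, ht⟩)
          fun hh => hne (Sum.inr_injective hh).symm).1 hst.symm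
        obtain ⟨rfl, rfl⟩ := Prod.mk.injEq _ _ _ _ ▸ Sum.inr_injective h2
        rw [hself]
        exact htr s h1
      by_cases c2 : ∃ r ∈ O, (y, t) = (e, r)
      · obtain ⟨r, hr, hyr⟩ := c2
        obtain ⟨rfl, rfl⟩ := Prod.mk.injEq _ _ _ _ ▸ hyr
        obtain ⟨h1, h2⟩ := (h'.iff t hr (Sum.inr (x, s)) (inr_mem_pointSet.2 ⟨hx, hs⟩)
          fun hh => hne (Sum.inr_injective hh)).1 hst
        obtain ⟨rfl, rfl⟩ := Prod.mk.injEq _ _ _ _ ▸ Sum.inr_injective h2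
        rw [hself]
        exact LinearIndependent.pair_symm_iff.1 (htr t h1)
      push Not at c1 c2
      rw [hderiv x hx s hs c1, hderiv y hy t ht c2]
      refine f.transversal x hx y hy s hs t ht hne ?_
      have e1 := hmap (Sum.inr (x, s)) (inr_mem_pointSet.2 ⟨hx, hs⟩)
        fun r hr hh => c1 r hr (Sum.inr_injective hh)
      have e2 := hmap (Sum.inr (y, t)) (inr_mem_pointSet.2 ⟨hy, ht⟩)
        fun r hr hh => c2 r hr (Sum.inr_injective hh)
      exact e1.symm.trans (Eq.trans hst e2) }
  refine ⟨g, ?_⟩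
  rw [f.sum_crossingNumber_eq_off he hO hN h Λ hΛ,
    g.sum_crossingNumber_eq_off he hO hN' h' Λ hΛ]
  -- Crossings away from the arc are common to both immersions, so only the prescribed ones enter
  -- the comparison.
  have hrest : ∀ H ∈ Λ, multiplePointsOff g.vert g.edge H e O =
      multiplePointsOff f.vert f.edge H e O := by
    intro H hH
    ext q
    constructor
    · rintro ⟨p, hp, p', hp', h1, h2, hne, hq, hq'⟩
      exact ⟨p, hp, p', hp', h1, h2, hne, (hmap p (pointSet_mono (hΛ H hH) hp) h1).symm.trans hq,
        (hmap p' (pointSet_mono (hΛ H hH) hp') h2).symm.trans hq'⟩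
    · rintro ⟨p, hp, p', hp', h1, h2, hne, hq, hq'⟩
      exact ⟨p, hp, p', hp', h1, h2, hne, (hmap p (pointSet_mono (hΛ H hH) hp) h1).trans hq,
        (hmap p' (pointSet_mono (hΛ H hH) hp') h2).trans hq'⟩
  have hsum : ∑ H ∈ Λ, (multiplePointsOff g.vert g.edge H e O).ncard =
      ∑ H ∈ Λ, (multiplePointsOff f.vert f.edge H e O).ncard :=
    Finset.sum_congr rfl fun H hH => by rw [hrest H hH]
  rw [hsum, show g.edge e = γ from hself]
  ring

end GenericImmersion

/-! ### Charts near a point of an edge -/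

/-- Points of the graph with image near `q` are near the preimages of `q`. -/
theorem GenericImmersion.exists_isolating {α β : Type*} {G : Graph α β} (hV : G.vertexSet.Finite)
    (hE : G.edgeSet.Finite) (f : GenericImmersion G) (q : Plane) {η : ℝ} (hη : 0 < η) :
    ∃ r > 0, ∀ p ∈ pointSet G, dist (pointMap f.vert f.edge p) q < r →
      (∃ v ∈ G.vertexSet, p = Sum.inl v ∧ f.vert v = q) ∨
      ∃ e ∈ G.edgeSet, ∃ s ∈ Ioo (0 : ℝ) 1, p = Sum.inr (e, s) ∧
        ∃ t ∈ Icc (0 : ℝ) 1, |s - t| < η ∧ f.edge e t = q := by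
  have h1 : ∀ v ∈ G.vertexSet, ∀ᶠ r in 𝓝[>] (0 : ℝ), dist (f.vert v) q < r → f.vert v = q := by
    intro v _
    by_cases h : f.vert v = q
    · exact Eventually.of_forall fun _ _ => h
    · filter_upwards [Ioo_mem_nhdsGT (dist_pos.2 h)] with r hr hlt
      exact absurd hlt (not_lt.2 hr.2.le)
  have h2 : ∀ e ∈ G.edgeSet, ∀ᶠ r in 𝓝[>] (0 : ℝ), ∀ s ∈ Icc (0 : ℝ) 1,
      dist (f.edge e s) q < r → ∃ t ∈ Icc (0 : ℝ) 1, |s - t| < η ∧ f.edge e t = q := by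
    intro e he
    -- The parameters that are not near any preimage form a compact set, on which the distance to
    -- `q` has a positive minimum.
    set K := Icc (0 : ℝ) 1 ∩ ⋂ t ∈ {t ∈ Icc (0 : ℝ) 1 | f.edge e t = q}, {s | η ≤ |s - t|} with hK
    have hKc : IsCompact K := isCompact_Icc.inter_right (isClosed_biInter fun t _ =>
      isClosed_le continuous_const (by fun_prop))
    have hKout : ∀ s ∈ Icc (0 : ℝ) 1, s ∉ K →
        ∃ t ∈ Icc (0 : ℝ) 1, |s - t| < η ∧ f.edge e t = q := by
      intro s hs hsK
      by_contra! h
      refine hsK ⟨hs, mem_iInter₂.2 fun t ht => ?_⟩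
      by_contra hlt
      exact h t ht.1 (not_le.1 hlt) ht.2
    rcases K.eq_empty_or_nonempty with hemp | hne
    · exact Eventually.of_forall fun r s hs _ => hKout s hs (by rw [hemp]; exact notMem_empty s)
    · obtain ⟨s0, hs0, hmin⟩ := hKc.exists_isMinOn hne
        (f := fun s => dist (f.edge e s) q) (continuous_dist.comp_continuousOn
          (((f.smooth e he).continuousOn.mono inter_subset_left).prodMk continuousOn_const))
      have hpos : 0 < dist (f.edge e s0) q := by
        refine dist_pos.2 fun h => ?_
        have := mem_iInter₂.1 hs0.2 s0 ⟨hs0.1, h⟩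
        simp at this
        linarith
      filter_upwards [Ioo_mem_nhdsGT hpos] with r hr s hs hlt
      exact hKout s hs fun hsK => absurd (hmin hsK) (not_le.2 (hlt.trans hr.2))
  obtain ⟨r, ⟨hr1, hr2⟩, hr⟩ := (((eventually_all_finite hV).2 h1).and
    ((eventually_all_finite hE).2 h2)).and self_mem_nhdsWithin |>.exists
  refine ⟨r, hr, ?_⟩
  rintro (v | ⟨e, s⟩) hp hlt
  · have hv := GenericImmersion.inl_mem_pointSet.1 hp
    exact Or.inl ⟨v, hv, rfl, hr1 v hv hlt⟩
  · have hp' := GenericImmersion.inr_mem_pointSet.1 hp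
    exact Or.inr ⟨e, hp'.1, s, hp'.2, rfl, hr2 e hp'.1 s (Ioo_subset_Icc_self hp'.2) hlt⟩

/-- Two transversal curves define a chart near their crossing. -/
theorem exists_chart {E : Type*} [NormedAddCommGroup E] [NormedSpace ℝ E] {φ δ : ℝ → E} {a t₀ : ℝ}
    (ha : 0 < a) (hφ : ContDiffOn ℝ ∞ φ (Ioo (t₀ - a) (t₀ + a)))
    (hδ : ContDiffOn ℝ ∞ δ (Ioo (-a) a)) (h : LinearIndependent ℝ ![deriv φ t₀, deriv δ 0]) :
    ∃ ρ ∈ Ioc 0 a, (∀ x y x' y', |x| < ρ → |y| < ρ → |x'| < ρ → |y'| < ρ →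
        φ (t₀ + y) + δ x = φ (t₀ + y') + δ x' → x = x' ∧ y = y') ∧
      ∀ x y, |x| < ρ → |y| < ρ → LinearIndependent ℝ ![deriv φ (t₀ + y), deriv δ x] := by
  have ht0 : t₀ ∈ Ioo (t₀ - a) (t₀ + a) := ⟨by linarith, by linarith⟩
  have h0 : (0 : ℝ) ∈ Ioo (-a) a := ⟨by linarith, ha⟩
  have hst1 : HasStrictDerivAt φ (deriv φ t₀) t₀ :=
    (hφ.contDiffAt (Ioo_mem_nhds ht0.1 ht0.2)).hasStrictDerivAt (by simp)
  have hst2 : HasStrictDerivAt δ (deriv δ 0) 0 :=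
    (hδ.contDiffAt (Ioo_mem_nhds h0.1 h0.2)).hasStrictDerivAt (by simp)
  have hc1 : ContinuousAt (deriv φ) t₀ :=
    (hφ.continuousOn_deriv_of_isOpen isOpen_Ioo (by simp)).continuousAt (Ioo_mem_nhds ht0.1 ht0.2)
  have hc2 : ContinuousAt (deriv δ) 0 :=
    (hδ.continuousOn_deriv_of_isOpen isOpen_Ioo (by simp)).continuousAt (Ioo_mem_nhds h0.1 h0.2)
  -- the differential of the chart
  have hstrict : HasStrictFDerivAt (fun p : ℝ × ℝ => φ (t₀ + p.2) + δ p.1)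
      ((ContinuousLinearMap.snd ℝ ℝ ℝ).smulRight (deriv φ t₀) +
        (ContinuousLinearMap.fst ℝ ℝ ℝ).smulRight (deriv δ 0)) (0, 0) := by
    have e1 : HasStrictFDerivAt (fun p : ℝ × ℝ => φ (t₀ + p.2))
        ((ContinuousLinearMap.snd ℝ ℝ ℝ).smulRight (deriv φ t₀)) (0, 0) := by
      have e3 : HasStrictFDerivAt (fun p : ℝ × ℝ => t₀ + p.2) (ContinuousLinearMap.snd ℝ ℝ ℝ) (0, 0) :=
        hasStrictFDerivAt_snd.const_add t₀
      have e4 : HasStrictDerivAt φ (deriv φ t₀) (t₀ + ((0, 0) : ℝ × ℝ).2) := by simpa using hst1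
      convert! e4.hasStrictFDerivAt.comp (0, 0) e3 using 1
    have e2 : HasStrictFDerivAt (fun p : ℝ × ℝ => δ p.1)
        ((ContinuousLinearMap.fst ℝ ℝ ℝ).smulRight (deriv δ 0)) (0, 0) := by
      have e3 : HasStrictFDerivAt (fun p : ℝ × ℝ => p.1) (ContinuousLinearMap.fst ℝ ℝ ℝ) (0, 0) :=
        hasStrictFDerivAt_fst
      have e4 : HasStrictDerivAt δ (deriv δ 0) ((0, 0) : ℝ × ℝ).1 := hst2
      convert! e4.hasStrictFDerivAt.comp (0, 0) e3 using 1
    exact e1.add e2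
  set L : ℝ × ℝ →L[ℝ] E := (ContinuousLinearMap.snd ℝ ℝ ℝ).smulRight (deriv φ t₀) +
        (ContinuousLinearMap.fst ℝ ℝ ℝ).smulRight (deriv δ 0) with hL
  have hker : (L : ℝ × ℝ →ₗ[ℝ] E).ker = ⊥ := by
    rw [LinearMap.ker_eq_bot, injective_iff_map_eq_zero]
    rintro ⟨x, y⟩ hxy
    have hxy' : y • deriv φ t₀ + x • deriv δ 0 = 0 := by simpa [hL] using hxy
    have := LinearIndependent.pair_iff.1 h y x hxy'
    rw [this.1, this.2]
    rfl
  -- Injectivity alone is needed here, and it follows from strict differentiability with an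
  -- injective differential; no inverse function is constructed.
  obtain ⟨K, hK, hanti⟩ := (L : ℝ × ℝ →ₗ[ℝ] E).exists_antilipschitzWith hker
  have hinj : ∀ᶠ p : (ℝ × ℝ) × (ℝ × ℝ) in 𝓝 ((0, 0), (0, 0)),
      φ (t₀ + p.1.2) + δ p.1.1 = φ (t₀ + p.2.2) + δ p.2.1 → p.1 = p.2 := by
    have hK' : (0 : ℝ) < K := hK
    have := hstrict.isLittleO.def (c := (2 * (K : ℝ))⁻¹) (by positivity)
    filter_upwards [this] with p hp heq
    rw [heq, sub_self, zero_sub, norm_neg] at hp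
    have h2 := hanti.le_mul_dist p.1 p.2
    rw [dist_eq_norm, dist_eq_norm, ← map_sub] at h2
    have h3 : ‖p.1 - p.2‖ ≤ K * ((2 * (K : ℝ))⁻¹ * ‖p.1 - p.2‖) :=
      h2.trans (mul_le_mul_of_nonneg_left hp hK'.le)
    have h4 : K * ((2 * (K : ℝ))⁻¹ * ‖p.1 - p.2‖) = ‖p.1 - p.2‖ / 2 := by
      field_simp
    rw [h4] at h3
    have h5 := norm_nonneg (p.1 - p.2)
    exact sub_eq_zero.1 (norm_eq_zero.1 (by linarith))
  have hLI : ∀ᶠ p : ℝ × ℝ in 𝓝 (0, 0), LinearIndependent ℝ ![deriv φ (t₀ + p.2), deriv δ p.1] := by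
    have hopen : IsOpen {v : Fin 2 → E | LinearIndependent ℝ v} := isOpen_setOfPred_linearIndependent
    have hct : Tendsto (fun p : ℝ × ℝ => ![deriv φ (t₀ + p.2), deriv δ p.1]) (𝓝 (0, 0))
        (𝓝 ![deriv φ t₀, deriv δ 0]) := by
      refine tendsto_pi_nhds.2 fun i => ?_
      fin_cases i
      · have : Tendsto (fun p : ℝ × ℝ => t₀ + p.2) (𝓝 (0, 0)) (𝓝 t₀) := by
          have : Continuous fun p : ℝ × ℝ => t₀ + p.2 := by fun_prop
          simpa using this.tendsto (0, 0)
        exact hc1.tendsto.comp this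
      · exact hc2.tendsto.comp (continuous_fst.tendsto ((0 : ℝ), (0 : ℝ)))
    exact hct (hopen.mem_nhds h)
  obtain ⟨ρ₁, hρ₁, hb1⟩ := Metric.eventually_nhds_iff.1 hinj
  obtain ⟨ρ₂, hρ₂, hb2⟩ := Metric.eventually_nhds_iff.1 hLI
  refine ⟨min a (min ρ₁ ρ₂), ⟨by positivity, min_le_left _ _⟩, ?_, ?_⟩
  · intro x y x' y' hx hy hx' hy' heq
    have := hb1 (y := ((x, y), (x', y'))) (by
      simp only [Prod.dist_eq, Real.dist_eq, sub_zero, max_lt_iff]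
      simp only [lt_min_iff] at hx hy hx' hy'
      tauto) heq
    simpa using this
  · intro x y hx hy
    exact hb2 (y := (x, y)) (by
      simp only [Prod.dist_eq, Real.dist_eq, sub_zero, max_lt_iff]
      simp only [lt_min_iff] at hx hy
      tauto)

/-! ### Bump function and local moves of an edge in a chart -/

/-- An even smooth bump function, which is one in `0` and zero outside `(-1, 1)`. -/
noncomputable def bump (x : ℝ) : ℝ := Real.exp 1 * expNegInvGlue (1 - x ^ 2)

theorem contDiff_bump : ContDiff ℝ ∞ bump :=
  contDiff_const.mul (expNegInvGlue.contDiff.comp (by fun_prop))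

theorem bump_neg (x : ℝ) : bump (-x) = bump x := by rw [bump, bump, neg_sq]

theorem bump_zero : bump 0 = 1 := by
  rw [bump, expNegInvGlue, if_neg (by norm_num), ← Real.exp_add]
  norm_num

theorem bump_nonneg (x : ℝ) : 0 ≤ bump x := mul_nonneg (Real.exp_pos 1).le (expNegInvGlue.nonneg _)

theorem bump_eq_zero {x : ℝ} : bump x = 0 ↔ 1 ≤ |x| := by
  rw [bump, mul_eq_zero, or_iff_right (Real.exp_pos 1).ne', expNegInvGlue.zero_iff_nonpos,
    sub_nonpos, one_le_sq_iff_one_le_abs]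

theorem deriv_bump_eq_zero {x : ℝ} (hx : 1 ≤ |x|) : deriv bump x = 0 := by
  refine IsLocalMin.deriv_eq_zero (Eventually.of_forall fun y => ?_)
  rw [bump_eq_zero.2 hx]
  exact bump_nonneg y

theorem deriv_bump_neg {x : ℝ} (hx : x ∈ Ioo (0 : ℝ) 1) : deriv bump x < 0 := by
  have hpos : 0 < 1 - x ^ 2 := by nlinarith [hx.1, hx.2]
  have hev : bump =ᶠ[𝓝 x] fun y => Real.exp 1 * Real.exp (-(1 - y ^ 2)⁻¹) := by
    have : ∀ᶠ y in 𝓝 x, 0 < 1 - y ^ 2 :=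
      (show Continuous fun y : ℝ => 1 - y ^ 2 by fun_prop).continuousAt.eventually (lt_mem_nhds hpos)
    filter_upwards [this] with y hy
    rw [bump, expNegInvGlue, if_neg (not_le.2 hy)]
  have h1 : HasDerivAt (fun y : ℝ => 1 - y ^ 2) (-(2 * x)) x := by
    simpa using (hasDerivAt_pow 2 x).const_sub 1
  have h2 := ((h1.inv hpos.ne').neg.exp).const_mul (Real.exp 1)
  have h3 : HasDerivAt (fun y : ℝ => Real.exp 1 * Real.exp (-(1 - y ^ 2)⁻¹)) _ x := h2
  rw [hev.deriv_eq, h3.deriv]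
  have h4 : 0 < Real.exp (-(1 - x ^ 2)⁻¹) := Real.exp_pos _
  have h5 : 0 < 2 * x / (1 - x ^ 2) ^ 2 := div_pos (by linarith [hx.1]) (by positivity)
  have h6 : -(- -(2 * x) / (1 - x ^ 2) ^ 2) < 0 := by
    rw [neg_neg]
    linarith
  exact mul_neg_of_pos_of_neg (Real.exp_pos 1) (mul_neg_of_pos_of_neg h4 h6)

theorem strictAntiOn_bump : StrictAntiOn bump (Icc 0 1) := by
  refine strictAntiOn_of_deriv_neg (convex_Icc 0 1) contDiff_bump.continuous.continuousOn ?_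
  intro x hx
  rw [interior_Icc] at hx
  exact deriv_bump_neg hx

theorem bump_abs (x : ℝ) : bump |x| = bump x := by
  rcases abs_choice x with h | h <;> rw [h]
  exact bump_neg x

theorem bump_le_one (x : ℝ) : bump x ≤ 1 := by
  rcases le_total 1 |x| with h | h
  · rw [bump_eq_zero.2 h]
    exact zero_le_one
  · rw [← bump_abs, ← bump_zero]
    exact strictAntiOn_bump.antitoneOn ⟨le_rfl, zero_le_one⟩ ⟨abs_nonneg x, h⟩ (abs_nonneg x)

theorem abs_eq_of_bump_eq {x y : ℝ} (hx : |x| < 1) (h : bump x = bump y) : |x| = |y| := by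
  have hy : |y| < 1 := by
    by_contra hy
    rw [bump_eq_zero.2 (not_lt.1 hy), bump_eq_zero] at h
    exact absurd hx (not_lt.2 h)
  refine strictAntiOn_bump.injOn ⟨abs_nonneg x, hx.le⟩ ⟨abs_nonneg y, hy.le⟩ ?_
  rw [bump_abs, bump_abs, h]

theorem deriv_bump_zero_iff {x : ℝ} : deriv bump x = 0 ↔ x = 0 ∨ 1 ≤ |x| := by
  have hodd : ∀ x, deriv bump (-x) = -deriv bump x := fun x => by
    have := deriv_comp_neg (f := bump) x
    rw [show (fun x => bump (-x)) = bump from funext bump_neg] at this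
    rw [this, neg_neg]
  constructor
  · intro h
    by_contra! hx
    rcases lt_or_gt_of_ne hx.1 with h0 | h0
    · have := deriv_bump_neg (x := -x) ⟨by linarith, by rw [abs_of_neg h0] at hx; exact hx.2⟩
      rw [hodd, h] at this
      simp at this
    · have := deriv_bump_neg (x := x) ⟨h0, by rw [abs_of_pos h0] at hx; exact hx.2⟩
      exact this.ne h
  · rintro (rfl | h)
    · have := hodd 0
      rw [neg_zero] at this
      linarith
    · exact deriv_bump_eq_zero h

theorem exists_bump_eq_half : ∃ x ∈ Ioo (0 : ℝ) 1, bump x = 1 / 2 := by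
  obtain ⟨x, hx, h⟩ := intermediate_value_Icc' zero_le_one contDiff_bump.continuous.continuousOn
    (show (1 / 2 : ℝ) ∈ Icc (bump 1) (bump 0) by
      rw [bump_zero, bump_eq_zero.2 (by simp)]
      norm_num)
  refine ⟨x, ⟨lt_of_le_of_ne hx.1 ?_, lt_of_le_of_ne hx.2 ?_⟩, h⟩
  · rintro rfl
    rw [bump_zero] at h
    norm_num at h
  · rintro rfl
    rw [bump_eq_zero.2 (by simp)] at h
    norm_num at h

/-- A regular curve `(X, Y)` which follows the second axis outside the unit square. -/
structure IsLocalMove (X Y : ℝ → ℝ) : Prop where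
  smooth_fst : ContDiff ℝ ∞ X
  smooth_snd : ContDiff ℝ ∞ Y
  outside : ∀ x, 1 ≤ |x| → X x = 0 ∧ Y x = x ∧ deriv X x = 0 ∧ deriv Y x = 1
  inside : ∀ x, |x| ≤ 1 → |X x| ≤ 1 ∧ |Y x| ≤ 1
  regular : ∀ x, deriv X x = 0 → deriv Y x ≠ 0

/-- The curve `φ`, moved near `t₀` in the direction of the curve `δ`. -/
noncomputable def movedCurve {E : Type*} [AddCommGroup E] (φ δ : ℝ → E) (X Y : ℝ → ℝ) (t₀ ε t : ℝ) : E :=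
  φ (t₀ + ε * Y ((t - t₀) / ε)) + δ (ε * X ((t - t₀) / ε))

section movedCurve
variable {E : Type*} [NormedAddCommGroup E] {φ δ : ℝ → E} {X Y : ℝ → ℝ}
  {t₀ ρ ε : ℝ}

theorem abs_div_lt_one_iff (hε : 0 < ε) {t : ℝ} :
    |(t - t₀) / ε| < 1 ↔ t ∈ Ioo (t₀ - ε) (t₀ + ε) := by
  rw [abs_div, abs_of_pos hε, div_lt_one hε, abs_lt, mem_Ioo]
  constructor <;> rintro ⟨h1, h2⟩ <;> constructor <;> linarith

theorem IsLocalMove.box (h : IsLocalMove X Y) (hε : 0 < ε) {t : ℝ}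
    (ht : t ∈ Ioo (t₀ - ε) (t₀ + ε)) :
    |ε * X ((t - t₀) / ε)| ≤ ε ∧ |ε * Y ((t - t₀) / ε)| ≤ ε := by
  have := h.inside _ ((abs_div_lt_one_iff hε).2 ht).le
  rw [abs_mul, abs_mul, abs_of_pos hε]
  exact ⟨mul_le_of_le_one_right hε.le this.1, mul_le_of_le_one_right hε.le this.2⟩

theorem IsLocalMove.movedCurve_off (h : IsLocalMove X Y) (hδ0 : δ 0 = 0) (hε : 0 < ε) {t : ℝ}
    (ht : t ∉ Ioo (t₀ - ε) (t₀ + ε)) : movedCurve φ δ X Y t₀ ε t = φ t := by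
  obtain ⟨h1, h2, -⟩ := h.outside _ (not_lt.1 ((abs_div_lt_one_iff hε).not.2 ht))
  rw [movedCurve, h1, h2, mul_zero, hδ0, add_zero, mul_div_cancel₀ _ hε.ne', add_sub_cancel]

variable [NormedSpace ℝ E]

theorem hasDerivAt_rescale {Z : ℝ → ℝ} (hZ : ContDiff ℝ ∞ Z) (hε : 0 < ε) (t : ℝ) :
    HasDerivAt (fun t => ε * Z ((t - t₀) / ε)) (deriv Z ((t - t₀) / ε)) t := by
  have h1 : HasDerivAt (fun t => (t - t₀) / ε) (1 / ε) t :=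
    ((hasDerivAt_id t).sub_const t₀).div_const ε
  have h2 := ((hZ.differentiable (by simp) ((t - t₀) / ε)).hasDerivAt.comp t h1).const_mul ε
  convert! h2 using 1
  field_simp

theorem IsLocalMove.hasDerivAt_movedCurve (h : IsLocalMove X Y) (hε : 0 < ε) {t : ℝ}
    (hφ : DifferentiableAt ℝ φ (t₀ + ε * Y ((t - t₀) / ε)))
    (hδ : DifferentiableAt ℝ δ (ε * X ((t - t₀) / ε))) :
    HasDerivAt (movedCurve φ δ X Y t₀ ε)
      (deriv Y ((t - t₀) / ε) • deriv φ (t₀ + ε * Y ((t - t₀) / ε)) +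
        deriv X ((t - t₀) / ε) • deriv δ (ε * X ((t - t₀) / ε))) t :=
  HasDerivAt.add
    (HasDerivAt.scomp t hφ.hasDerivAt ((hasDerivAt_rescale h.smooth_snd hε t).const_add t₀))
    (HasDerivAt.scomp t hδ.hasDerivAt (hasDerivAt_rescale h.smooth_fst hε t))

theorem IsLocalMove.snd_mem (h : IsLocalMove X Y) (hε : 0 < ε) (h0 : 0 ≤ t₀ - ε) (h1 : t₀ + ε ≤ 1)
    {t : ℝ} (ht : t ∈ Icc (0 : ℝ) 1) : t₀ + ε * Y ((t - t₀) / ε) ∈ Icc (0 : ℝ) 1 := by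
  by_cases hO : t ∈ Ioo (t₀ - ε) (t₀ + ε)
  · have := abs_le.1 (h.box hε hO).2
    constructor <;> linarith
  · obtain ⟨-, h2, -⟩ := h.outside _ (not_lt.1 ((abs_div_lt_one_iff hε).not.2 hO))
    rw [h2, mul_div_cancel₀ _ hε.ne', add_sub_cancel]
    exact ht

theorem IsLocalMove.fst_mem (h : IsLocalMove X Y) (hε : 0 < ε) (hερ : ε < ρ) (t : ℝ) :
    ε * X ((t - t₀) / ε) ∈ Ioo (-ρ) ρ := by
  by_cases hO : t ∈ Ioo (t₀ - ε) (t₀ + ε)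
  · exact abs_lt.1 ((h.box hε hO).1.trans_lt hερ)
  · obtain ⟨h2, -⟩ := h.outside _ (not_lt.1 ((abs_div_lt_one_iff hε).not.2 hO))
    rw [h2, mul_zero]
    constructor <;> linarith

theorem IsLocalMove.contDiffOn_movedCurve (h : IsLocalMove X Y) (hφ : ContDiffOn ℝ ∞ φ (Icc 0 1))
    (hδ : ContDiffOn ℝ ∞ δ (Ioo (-ρ) ρ)) (hε : 0 < ε) (hερ : ε < ρ) (h0 : 0 ≤ t₀ - ε)
    (h1 : t₀ + ε ≤ 1) : ContDiffOn ℝ ∞ (movedCurve φ δ X Y t₀ ε) (Icc 0 1) := by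
  have e1 : ∀ {Z : ℝ → ℝ}, ContDiff ℝ ∞ Z → ContDiff ℝ ∞ fun t => ε * Z ((t - t₀) / ε) :=
    fun hZ => contDiff_const.mul (hZ.comp (by fun_prop))
  exact (hφ.comp (contDiff_const.add (e1 h.smooth_snd)).contDiffOn fun t ht =>
    h.snd_mem hε h0 h1 ht).add
    (hδ.comp (e1 h.smooth_fst).contDiffOn fun t _ => h.fst_mem hε hερ t)

end movedCurve

namespace GenericImmersion
variable {α β : Type*} {G : Graph α β} {X Y : ℝ → ℝ} {d e : β} {t₀ ρ ε : ℝ} {δ : ℝ → Plane}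

theorem differentiableAt_edge (f : GenericImmersion G) (he : e ∈ G.edgeSet) {t : ℝ}
    (ht : t ∈ Ioo (0 : ℝ) 1) : DifferentiableAt ℝ (f.edge e) t :=
  (f.hasStrictDerivAt_edge he ht).hasDerivAt.differentiableAt

/-- A local move of an edge in a chart changes the number of crossings as it does in the chart. -/
theorem exists_localMove [DecidableEq β] (f : GenericImmersion G)
    (he : e ∈ G.edgeSet) (h : IsLocalMove X Y) (hδ : ContDiffOn ℝ ∞ δ (Ioo (-ρ) ρ)) (hδ0 : δ 0 = 0)
    (hLI : ∀ x y, |x| < ρ → |y| < ρ →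
      LinearIndependent ℝ ![deriv (f.edge e) (t₀ + y), deriv δ x])
    (hε : 0 < ε) (hερ : ε < ρ) (h0 : 0 < t₀ - ρ) (h1 : t₀ + ρ < 1) {N N' : Set ℝ} (hN : N.Finite)
    (hN' : N'.Finite) {σ σ' : ℝ → ℝ}
    (hc : CrossesAlong G f.vert f.edge d e (Ioo (t₀ - ε) (t₀ + ε)) N σ)
    (hc' : CrossesAlong G f.vert (Function.update f.edge e (movedCurve (f.edge e) δ X Y t₀ ε)) d e
      (Ioo (t₀ - ε) (t₀ + ε)) N' σ')
    (htr : ∀ t ∈ N', LinearIndependent ℝ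
      ![deriv Y ((t - t₀) / ε) • deriv (f.edge e) (t₀ + ε * Y ((t - t₀) / ε)) +
        deriv X ((t - t₀) / ε) • deriv δ (ε * X ((t - t₀) / ε)),
        deriv (Function.update f.edge e (movedCurve (f.edge e) δ X Y t₀ ε) d) (σ' t)])
    (Λ : Finset (Graph α β)) (hΛ : ∀ H ∈ Λ, H ≤ G) :
    ∃ g : GenericImmersion G, ∑ H ∈ Λ, f.crossingNumber H +
        (movedCurve (f.edge e) δ X Y t₀ ε '' N').ncard * countContaining Λ d e =
      ∑ H ∈ Λ, g.crossingNumber H + (f.edge e '' N).ncard * countContaining Λ d e := by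
  have hO : Ioo (t₀ - ε) (t₀ + ε) ⊆ Ioo 0 1 := Ioo_subset_Ioo (by linarith) (by linarith)
  have hδd : ∀ t, DifferentiableAt ℝ δ (ε * X ((t - t₀) / ε)) := fun t => by
    have := h.fst_mem (t₀ := t₀) hε hερ t
    exact (hδ.contDiffAt (Ioo_mem_nhds this.1 this.2)).differentiableAt (by simp)
  have hin : ∀ t ∈ Ioo (0 : ℝ) 1, t₀ + ε * Y ((t - t₀) / ε) ∈ Ioo (0 : ℝ) 1 := by
    intro t ht
    by_cases htO : t ∈ Ioo (t₀ - ε) (t₀ + ε)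
    · have := abs_le.1 (h.box hε htO).2
      constructor <;> linarith
    · obtain ⟨-, h2, -⟩ := h.outside _ (not_lt.1 ((abs_div_lt_one_iff hε).not.2 htO))
      rw [h2, mul_div_cancel₀ _ hε.ne', add_sub_cancel]
      exact ht
  have hder : ∀ t ∈ Ioo (0 : ℝ) 1, HasDerivAt (movedCurve (f.edge e) δ X Y t₀ ε)
      (deriv Y ((t - t₀) / ε) • deriv (f.edge e) (t₀ + ε * Y ((t - t₀) / ε)) +
        deriv X ((t - t₀) / ε) • deriv δ (ε * X ((t - t₀) / ε))) t := fun t ht =>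
    h.hasDerivAt_movedCurve hε (f.differentiableAt_edge he (hin t ht)) (hδd t)
  have hoff' : ∀ t ∈ Ioo (0 : ℝ) 1, t ∉ Ioo (t₀ - ε) (t₀ + ε) →
      deriv (movedCurve (f.edge e) δ X Y t₀ ε) t = deriv (f.edge e) t := by
    intro t ht htO
    obtain ⟨-, h2, h3, h4⟩ := h.outside _ (not_lt.1 ((abs_div_lt_one_iff hε).not.2 htO))
    rw [(hder t ht).deriv, h2, h3, h4, mul_div_cancel₀ _ hε.ne', add_sub_cancel, one_smul,
      zero_smul, add_zero]
  refine f.exists_surgery he hO hN hc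
    (h.contDiffOn_movedCurve (f.smooth e he) hδ hε hερ (by linarith) (by linarith)) ?_
    (fun t _ ht => h.movedCurve_off hδ0 hε ht) hoff' hN' hc' ?_ Λ hΛ
  · intro t ht
    by_cases hto : t ∈ Ioo (0 : ℝ) 1
    · have hu := uniqueDiffOn_Icc (zero_lt_one' ℝ) t ht
      rw [(hder t hto).differentiableAt.derivWithin hu]
      by_cases htO : t ∈ Ioo (t₀ - ε) (t₀ + ε)
      · rw [(hder t hto).deriv]
        have hb := h.box hε htO
        -- In the chart basis the velocity has coordinates (Y', X'), which do not vanish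
        -- simultaneously.
        intro hz
        have := LinearIndependent.pair_iff.1 (hLI _ _ (hb.1.trans_lt hερ) (hb.2.trans_lt hερ)) _ _ hz
        exact h.regular _ this.2 this.1
      · rw [hoff' t hto htO, ← (f.differentiableAt_edge he hto).derivWithin hu]
        exact f.regular e he t ht
    -- At an end of the edge the move has no effect on a whole neighbourhood.
    · have hev : movedCurve (f.edge e) δ X Y t₀ ε =ᶠ[𝓝[Icc 0 1] t] f.edge e := by
        have : ∀ᶠ x in 𝓝 t, x ∉ Icc (t₀ - ε) (t₀ + ε) := by
          refine isClosed_Icc.isOpen_compl.mem_nhds fun hmem => hto ?_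
          exact ⟨by linarith [hmem.1], by linarith [hmem.2]⟩
        filter_upwards [mem_nhdsWithin_of_mem_nhds this] with x hx
        exact h.movedCurve_off hδ0 hε fun hh => hx (Ioo_subset_Icc_self hh)
      rw [hev.derivWithin_eq (hev.self_of_nhdsWithin ht)]
      exact f.regular e he t ht
  · intro t ht
    rw [(hder t (hO (hc'.subset ht))).deriv]
    exact htr t ht

/-- A chart in which the edge `e` is an axis, with control on the graph near its centre. -/
theorem exists_good_chart (hV : G.vertexSet.Finite) (hE : G.edgeSet.Finite) (f : GenericImmersion G)
    (he : e ∈ G.edgeSet) (ht₀ : t₀ ∈ Ioo (0 : ℝ) 1) {a : ℝ} (ha : 0 < a)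
    (hδ : ContDiffOn ℝ ∞ δ (Ioo (-a) a)) (hδ0 : δ 0 = 0)
    (hLI : LinearIndependent ℝ ![deriv (f.edge e) t₀, deriv δ 0]) :
    ∃ ρ ∈ Ioc 0 a, ∃ ε ∈ Ioo 0 ρ, 0 < t₀ - ρ ∧ t₀ + ρ < 1 ∧
      (∀ x y x' y', |x| < ρ → |y| < ρ → |x'| < ρ → |y'| < ρ →
        f.edge e (t₀ + y) + δ x = f.edge e (t₀ + y') + δ x' → x = x' ∧ y = y') ∧
      (∀ x y, |x| < ρ → |y| < ρ →
        LinearIndependent ℝ ![deriv (f.edge e) (t₀ + y), deriv δ x]) ∧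
      ∀ p ∈ pointSet G, ∀ x y, |x| ≤ ε → |y| ≤ ε →
        pointMap f.vert f.edge p = f.edge e (t₀ + y) + δ x →
        ∃ d ∈ G.edgeSet, ∃ s ∈ Ioo (0 : ℝ) 1, p = Sum.inr (d, s) ∧
          ∃ t ∈ Ioo (0 : ℝ) 1, |s - t| < ρ ∧ f.edge d t = f.edge e t₀ := by
  -- The halves leave a margin, so that the parameters stay strictly inside (0, 1).
  set a' := min (a / 2) (min (t₀ / 2) ((1 - t₀) / 2)) with ha'
  have ha'0 : 0 < a' := by
    have := ht₀.1
    have := sub_pos.2 ht₀.2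
    positivity
  have l1 : a' ≤ a / 2 := min_le_left _ _
  have l2 : a' ≤ t₀ / 2 := (min_le_right _ _).trans (min_le_left _ _)
  have l3 : a' ≤ (1 - t₀) / 2 := (min_le_right _ _).trans (min_le_right _ _)
  obtain ⟨ρ, ⟨hρ0, hρa⟩, hinj, hli⟩ := exists_chart (φ := f.edge e) (δ := δ) (t₀ := t₀) ha'0
    ((f.smooth e he).mono fun t ht => ⟨by linarith [ht.1, ht₀.1], by linarith [ht.2, ht₀.2]⟩)
    (hδ.mono (Ioo_subset_Ioo (by linarith) (by linarith))) hLI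
  obtain ⟨r, hr, hiso⟩ := f.exists_isolating hV hE (f.edge e t₀) hρ0
  have hcont : ContinuousAt (fun p : ℝ × ℝ => f.edge e (t₀ + p.2) + δ p.1) (0, 0) := by
    have h1 : ContinuousAt (f.edge e) (t₀ + ((0, 0) : ℝ × ℝ).2) := by
      simpa using (f.differentiableAt_edge he ht₀).continuousAt
    have h2 : ContinuousAt δ ((0, 0) : ℝ × ℝ).1 :=
      (hδ.continuousOn).continuousAt (Ioo_mem_nhds (by simpa using ha) ha)
    exact (h1.comp (f := fun p : ℝ × ℝ => t₀ + p.2) (by fun_prop)).add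
      (h2.comp (f := fun p : ℝ × ℝ => p.1) (by fun_prop))
  obtain ⟨ε', hε', hball⟩ := Metric.continuousAt_iff.1 hcont r hr
  refine ⟨ρ, ⟨hρ0, by linarith⟩, min (ε' / 2) (ρ / 2), ⟨by positivity, ?_⟩, by linarith [ht₀.1],
    by linarith [ht₀.2], hinj, hli, ?_⟩
  · exact (min_le_right _ _).trans_lt (by linarith)
  · intro p hp x y hx hy heq
    have hdist : dist (pointMap f.vert f.edge p) (f.edge e t₀) < r := by
      rw [heq]
      have := @hball (x, y) (by
        simp only [Prod.dist_eq, Real.dist_eq, sub_zero, max_lt_iff]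
        have := min_le_left (ε' / 2) (ρ / 2)
        constructor <;> linarith)
      simpa [hδ0] using this
    have hmem : (Sum.inr (e, t₀) : α ⊕ β × ℝ) ∈ pointSet G := inr_mem_pointSet.2 ⟨he, ht₀⟩
    rcases hiso p hp hdist with ⟨v, hv, rfl, hv'⟩ | ⟨d, hd, s, hs, rfl, t, ht, hst, htq⟩
    · exact absurd (f.vertex_simple v hv _ hmem hv'.symm) (by simp)
    · refine ⟨d, hd, s, hs, rfl, t, ?_, hst, htq⟩
      by_contra hto
      have h01 : t = 0 ∨ t = 1 := by
        by_contra! hne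
        exact hto ⟨lt_of_le_of_ne ht.1 (Ne.symm hne.1), lt_of_le_of_ne ht.2 hne.2⟩
      obtain ⟨x', y', hxy, e0, e1⟩ := f.ends d hd
      rcases h01 with rfl | rfl
      · exact absurd (f.vertex_simple x' hxy.left_mem _ hmem (htq.symm.trans e0)) (by simp)
      · exact absurd (f.vertex_simple y' hxy.right_mem _ hmem (htq.symm.trans e1)) (by simp)

end GenericImmersion

/-! ### Adding a kink and tripling a crossing -/

/-- These are the velocities of the two branches at the double point of a kink, which are mirror
images of each other in the chart. -/
theorem linearIndependent_add_sub {E : Type*} [AddCommGroup E] [Module ℝ E] {A B : E} {p q : ℝ}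
    (h : LinearIndependent ℝ ![A, B]) (hp : p ≠ 0) (hq : q ≠ 0) :
    LinearIndependent ℝ ![p • A + q • B, p • A + (-q) • B] := by
  rw [LinearIndependent.pair_iff] at h ⊢
  intro s t hst
  have h1 := h ((s + t) * p) ((s - t) * q) (by rw [← hst]; module)
  have h2 := (mul_eq_zero.1 h1.1).resolve_right hp
  have h3 := (mul_eq_zero.1 h1.2).resolve_right hq
  constructor <;> linarith

theorem linearIndependent_add_right {E : Type*} [AddCommGroup E] [Module ℝ E] {A B : E} {p : ℝ}
    (h : LinearIndependent ℝ ![A, B]) (hp : p ≠ 0) (q : ℝ) :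
    LinearIndependent ℝ ![p • A + q • B, B] := by
  rw [LinearIndependent.pair_iff] at h ⊢
  intro s t hst
  have h1 := h (s * p) (s * q + t) (by rw [← hst]; module)
  have h2 := (mul_eq_zero.1 h1.1).resolve_right hp
  have h3 := h1.2
  rw [h2, zero_mul, zero_add] at h3
  exact ⟨h2, h3⟩

theorem bump_hasDerivAt (x : ℝ) : HasDerivAt bump (deriv bump x) x :=
  (contDiff_bump.differentiable (by simp) x).hasDerivAt

/-- The second coordinate of a local move: it has the three zeros `0` and `±x` with
`bump x = 1 / 2`. -/
noncomputable def zigzag (x : ℝ) : ℝ := x * (1 - 2 * bump x)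

theorem zigzag_neg (x : ℝ) : zigzag (-x) = -zigzag x := by
  rw [zigzag, zigzag, bump_neg]
  ring

theorem contDiff_zigzag : ContDiff ℝ ∞ zigzag := by
  have := contDiff_bump
  unfold zigzag
  fun_prop

theorem deriv_zigzag (x : ℝ) : deriv zigzag x = 1 - 2 * bump x - 2 * x * deriv bump x := by
  have : HasDerivAt (fun x => x * (1 - 2 * bump x))
      (1 * (1 - 2 * bump x) + x * (-(2 * deriv bump x))) x :=
    (hasDerivAt_id x).fun_mul (((bump_hasDerivAt x).const_mul 2).const_sub 1)
  rw [show zigzag = fun x => x * (1 - 2 * bump x) from rfl, this.deriv]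
  ring

theorem zigzag_eq_zero {x : ℝ} : zigzag x = 0 ↔ x = 0 ∨ bump x = 1 / 2 := by
  rw [zigzag, mul_eq_zero]
  constructor <;> rintro (h | h)
  · exact Or.inl h
  · right; linarith
  · exact Or.inl h
  · right; linarith

theorem abs_lt_one_of_bump_eq_half {x : ℝ} (h : bump x = 1 / 2) : |x| < 1 := by
  by_contra hx
  rw [bump_eq_zero.2 (not_lt.1 hx)] at h
  norm_num at h

theorem ne_zero_of_bump_eq_half {x : ℝ} (h : bump x = 1 / 2) : x ≠ 0 := by
  rintro rfl
  rw [bump_zero] at h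
  norm_num at h

theorem deriv_bump_ne_zero_of_eq_half {x : ℝ} (h : bump x = 1 / 2) : deriv bump x ≠ 0 := by
  rw [Ne, deriv_bump_zero_iff, not_or, not_le]
  exact ⟨ne_zero_of_bump_eq_half h, abs_lt_one_of_bump_eq_half h⟩

theorem deriv_zigzag_ne_zero_of_eq_half {x : ℝ} (h : bump x = 1 / 2) : deriv zigzag x ≠ 0 := by
  rw [deriv_zigzag, h]
  have h1 := mul_ne_zero (ne_zero_of_bump_eq_half h) (deriv_bump_ne_zero_of_eq_half h)
  intro h2
  exact h1 (by linarith)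

theorem abs_zigzag_le {x : ℝ} (hx : |x| ≤ 1) : |zigzag x| ≤ 1 := by
  rw [zigzag, abs_mul]
  refine mul_le_one₀ hx (abs_nonneg _) (abs_le.2 ⟨?_, ?_⟩)
  · linarith [bump_le_one x]
  · linarith [bump_nonneg x]

/-- The first coordinate is even and the second odd, so the curve is symmetric. A double point needs
parameters x and -x with x ≠ 0 and `zigzag x = 0`, that is `bump x = 1 / 2`: there is exactly one.
-/
theorem isLocalMove_kink : IsLocalMove bump zigzag where
  smooth_fst := contDiff_bump
  smooth_snd := contDiff_zigzag
  outside x hx := by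
    rw [deriv_zigzag, deriv_bump_eq_zero hx, zigzag, bump_eq_zero.2 hx]
    simp
  inside x hx := ⟨by rw [abs_of_nonneg (bump_nonneg x)]; exact bump_le_one x, abs_zigzag_le hx⟩
  regular x hx := by
    rw [deriv_zigzag, hx]
    rcases deriv_bump_zero_iff.1 hx with rfl | h
    · rw [bump_zero]; norm_num
    · rw [bump_eq_zero.2 h]; norm_num

theorem deriv_mul_bump (x : ℝ) : deriv (fun x => x * bump x) x = bump x + x * deriv bump x := by
  have : HasDerivAt (fun x => x * bump x) (1 * bump x + x * deriv bump x) x :=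
    (hasDerivAt_id x).fun_mul (bump_hasDerivAt x)
  rw [this.deriv, one_mul]

/-- Here Y + 2X = x, so the curve is regular and injective; it meets the axis Y = 0 inside the unit
square at the three zeros of `zigzag`. -/
theorem isLocalMove_swerve : IsLocalMove (fun x => x * bump x) zigzag where
  smooth_fst := by
    have := contDiff_bump
    fun_prop
  smooth_snd := contDiff_zigzag
  outside x hx := by
    rw [deriv_zigzag, deriv_mul_bump, deriv_bump_eq_zero hx, zigzag, bump_eq_zero.2 hx]
    simp
  inside x hx := by
    refine ⟨?_, abs_zigzag_le hx⟩
    rw [abs_mul, abs_of_nonneg (bump_nonneg x)]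
    exact mul_le_one₀ hx (bump_nonneg x) (bump_le_one x)
  regular x hx := by
    rw [deriv_mul_bump] at hx
    rw [deriv_zigzag]
    intro h
    linarith

theorem setOf_bump_eq_half {x t₀ ε : ℝ} (hε : 0 < ε)
    (hb : bump x = 1 / 2) : {t | bump ((t - t₀) / ε) = 1 / 2} = {t₀ + ε * x, t₀ - ε * x} := by
  ext t
  simp only [mem_ofPred_eq, mem_insert_iff, mem_singleton_iff]
  constructor
  · intro h
    have h1 := abs_eq_of_bump_eq (abs_lt_one_of_bump_eq_half h) (h.trans hb.symm)
    rcases abs_eq_abs.1 h1 with h2 | h2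
    · left
      rw [div_eq_iff hε.ne'] at h2
      linarith
    · right
      rw [div_eq_iff hε.ne'] at h2
      linarith
  · rintro (rfl | rfl)
    · rw [add_sub_cancel_left, mul_div_cancel_left₀ _ hε.ne', hb]
    · rw [sub_sub_cancel_left, neg_div, mul_div_cancel_left₀ _ hε.ne', bump_neg, hb]

namespace GenericImmersion
variable {α β : Type*} {G : Graph α β} {d e : β}

theorem edge_deriv_ne_zero (f : GenericImmersion G) (he : e ∈ G.edgeSet) {t : ℝ}
    (ht : t ∈ Ioo (0 : ℝ) 1) : deriv (f.edge e) t ≠ 0 := by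
  have ht' := Ioo_subset_Icc_self ht
  rw [← (f.differentiableAt_edge he ht).derivWithin (uniqueDiffOn_Icc zero_lt_one t ht')]
  exact f.regular e he t ht'

/-- Local injectivity at the midpoint gives infinitely many image points, of which only finitely
many are multiple points. -/
theorem exists_simple_point (f : GenericImmersion G) (he : e ∈ G.edgeSet) :
    ∃ t ∈ Ioo (0 : ℝ) 1, f.edge e t ∉ multiplePoints f.vert f.edge G := by
  have hhalf : (1 / 2 : ℝ) ∈ Ioo (0 : ℝ) 1 := by norm_num
  have hinj := eventually_injective_of_hasStrictDerivAt (f.hasStrictDerivAt_edge he hhalf)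
    (f.edge_deriv_ne_zero he hhalf)
  rw [nhds_prod_eq] at hinj
  obtain ⟨U, hU, hUinj⟩ := (eventually_prod_self_iff
    (r := fun x y => f.edge e x = f.edge e y → x = y)).1 hinj
  have hmem : U ∩ Ioo (0 : ℝ) 1 ∈ 𝓝 (1 / 2 : ℝ) := inter_mem hU (Ioo_mem_nhds hhalf.1 hhalf.2)
  have hinf : (f.edge e '' (U ∩ Ioo (0 : ℝ) 1)).Infinite := by
    refine (infinite_of_mem_nhds _ hmem).image fun x hx y hy hxy => ?_
    exact hUinj x hx.1 y hy.1 hxy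
  obtain ⟨q, ⟨t, ht, rfl⟩, hq⟩ := hinf.exists_notMem_finite f.finite_multiplePoints
  exact ⟨t, ht.2, hq⟩

/-- Adding a kink to an edge. -/
theorem exists_kink (hV : G.vertexSet.Finite) (hE : G.edgeSet.Finite) (f : GenericImmersion G)
    (he : e ∈ G.edgeSet) (Λ : Finset (Graph α β)) (hΛ : ∀ H ∈ Λ, H ≤ G) :
    ∃ g : GenericImmersion G, ∑ H ∈ Λ, f.crossingNumber H + countContaining Λ e e =
      ∑ H ∈ Λ, g.crossingNumber H := by
  classical
  obtain ⟨t₀, ht₀, hsimple⟩ := f.exists_simple_point he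
  obtain ⟨n, hn⟩ := exists_linearIndependent_pair_of_one_lt_finrank (R := ℝ) (M := Plane)
    (by simp) (f.edge_deriv_ne_zero he ht₀)
  set δ : ℝ → Plane := fun x => x • n with hδ
  have hδsm : ContDiff ℝ ∞ δ := contDiff_id.smul contDiff_const
  have hδ' : ∀ x, deriv δ x = n := fun x => by
    have : HasDerivAt (fun x : ℝ => x • n) ((1 : ℝ) • n) x := (hasDerivAt_id x).smul_const n
    rw [hδ, this.deriv, one_smul]
  have hδ0 : δ 0 = 0 := zero_smul _ _
  obtain ⟨ρ, ⟨hρ, -⟩, ε, ⟨hε, hερ⟩, hρ0, hρ1, hinj, hLI, hnear⟩ := f.exists_good_chart hV hE he ht₀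
    one_pos hδsm.contDiffOn hδ0 (by rw [hδ']; exact hn)
  have hmem₀ : (Sum.inr (e, t₀) : α ⊕ β × ℝ) ∈ pointSet G := inr_mem_pointSet.2 ⟨he, ht₀⟩
  have hchart : ∀ p ∈ pointSet G, ∀ x y, |x| ≤ ε → |y| ≤ ε →
      pointMap f.vert f.edge p = f.edge e (t₀ + y) + δ x → x = 0 ∧ p = Sum.inr (e, t₀ + y) := by
    intro p hp x y hx hy hpxy
    obtain ⟨d, hd, s, hs, rfl, t, ht, hst, hdt⟩ := hnear p hp x y hx hy hpxy
    have h1 : (d, t) = (e, t₀) := by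
      by_contra hne
      exact hsimple ⟨_, hmem₀, Sum.inr (d, t), inr_mem_pointSet.2 ⟨hd, ht⟩,
        fun h => hne (Sum.inr_injective h).symm, rfl, hdt⟩
    obtain ⟨rfl, rfl⟩ := Prod.mk.injEq _ _ _ _ ▸ h1
    have h2 : f.edge d (t + y) + δ x = f.edge d (t + (s - t)) + δ 0 := by
      rw [hδ0, add_zero, add_sub_cancel]
      exact hpxy.symm
    have h3 := hinj _ _ _ _ (hx.trans_lt hερ) (hy.trans_lt hερ) (by simpa using hρ) hst h2
    refine ⟨h3.1, ?_⟩
    rw [h3.2, add_sub_cancel]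
  obtain ⟨τ, hτ, hbτ⟩ := exists_bump_eq_half
  set O := Ioo (t₀ - ε) (t₀ + ε) with hO
  set γ := movedCurve (f.edge e) δ bump zigzag t₀ ε with hγ
  set N := {t | bump ((t - t₀) / ε) = 1 / 2} with hN
  have hNeq := setOf_bump_eq_half (t₀ := t₀) hε hbτ
  have hNO : N ⊆ O := fun t ht => (abs_div_lt_one_iff hε).1 (abs_lt_one_of_bump_eq_half ht)
  have hrefl : ∀ t : ℝ, (2 * t₀ - t - t₀) / ε = -((t - t₀) / ε) := fun t => by ring
  have hsymm : ∀ t ∈ N, γ (2 * t₀ - t) = γ t := by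
    intro t ht
    have h0 : zigzag ((t - t₀) / ε) = 0 := zigzag_eq_zero.2 (Or.inr ht)
    simp only [hγ, movedCurve, hrefl, bump_neg, zigzag_neg, h0, neg_zero]
  have hmove : ∀ s ∈ O, ∀ t ∈ O, s ≠ t → γ s = γ t → t ∈ N ∧ s = 2 * t₀ - t := by
    intro s hs t ht hst h
    have bs := isLocalMove_kink.box hε hs
    have bt := isLocalMove_kink.box hε ht
    obtain ⟨h1, h2⟩ := hinj _ _ _ _ (bs.1.trans_lt hερ) (bs.2.trans_lt hερ) (bt.1.trans_lt hερ)
      (bt.2.trans_lt hερ) h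
    have h1 := mul_left_cancel₀ hε.ne' h1
    have h2 := mul_left_cancel₀ hε.ne' h2
    have hne : (s - t₀) / ε ≠ (t - t₀) / ε := fun h => hst (by
      have := (div_left_inj' hε.ne').1 h
      linarith)
    have h4 := (abs_eq_abs.1 (abs_eq_of_bump_eq ((abs_div_lt_one_iff hε).2 hs) h1)).resolve_left hne
    rw [h4, zigzag_neg] at h2
    have h5 : zigzag ((t - t₀) / ε) = 0 := by linarith
    refine ⟨(zigzag_eq_zero.1 h5).resolve_left fun h6 => hne (by rw [h4, h6, neg_zero]), ?_⟩
    rw [← hrefl, div_left_inj' hε.ne'] at h4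
    linarith
  -- The moved arc leaves the axis X = 0, which contains all of the old graph near this point, so
  -- the kink meets nothing but itself.
  have hpos : ∀ t ∈ O, ε * bump ((t - t₀) / ε) ≠ 0 := fun t ht =>
    mul_ne_zero hε.ne' (bump_eq_zero.not.2 (not_le.2 ((abs_div_lt_one_iff hε).2 ht)))
  have hrO : ∀ t ∈ O, 2 * t₀ - t ∈ O := fun t ht => ⟨by linarith [ht.2], by linarith [ht.1]⟩
  have hO01 : O ⊆ Ioo 0 1 := Ioo_subset_Ioo (by linarith) (by linarith)
  have hNne : ∀ t ∈ N, 2 * t₀ - t ≠ t := fun t ht h => ne_zero_of_bump_eq_half ht (by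
    rw [show t - t₀ = 0 by linarith, zero_div])
  have hup : Function.update f.edge e γ e = γ := Function.update_self _ _ _
  obtain ⟨g, hg⟩ := f.exists_localMove (d := e) he isLocalMove_kink hδsm.contDiffOn hδ0 hLI hε hερ
    hρ0 hρ1 (N := ∅) (N' := N) finite_empty (by rw [hN, hNeq]; exact toFinite _) (σ := id)
    (σ' := fun t => 2 * t₀ - t)
    { subset := empty_subset _
      mem := fun t ht => absurd ht (notMem_empty t)
      iff := fun t ht p hp hne => by
        refine ⟨fun h => absurd ?_ hne, fun h => absurd h.1 (notMem_empty t)⟩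
        have := (hchart p hp 0 (t - t₀) (by simpa using hε.le) (abs_le.2 ⟨by linarith [ht.1],
          by linarith [ht.2]⟩) (by rw [hδ0, add_zero, add_sub_cancel]; exact h)).2
        rwa [add_sub_cancel] at this }
    { subset := hNO
      mem := fun t ht => ⟨hO01 (hrO t (hNO ht)), fun h => hNne t ht (congrArg Prod.snd h)⟩
      iff := fun t ht p hp hne => by
        change _ = Function.update f.edge e γ e t ↔ _
        rw [hup]
        constructor
        · intro h
          by_cases hpO : ∃ s ∈ O, p = Sum.inr (e, s)
          · obtain ⟨s, hs, rfl⟩ := hpO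
            change Function.update f.edge e γ e s = _ at h
            rw [hup] at h
            have := hmove s hs t ht (fun hst => hne (by rw [hst])) h
            exact ⟨this.1, by rw [this.2]⟩
          · have hpf : pointMap f.vert (Function.update f.edge e γ) p = pointMap f.vert f.edge p := by
              rcases p with v | ⟨c, s⟩
              · rfl
              · change Function.update f.edge e γ c s = f.edge c s
                by_cases hc : c = e
                · subst hc
                  rw [hup]
                  exact isLocalMove_kink.movedCurve_off hδ0 hε fun hs => hpO ⟨s, hs, rfl⟩
                · rw [Function.update_of_ne hc]
            rw [hpf] at h
            have bt := isLocalMove_kink.box hε ht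
            exact absurd (hchart p hp _ _ bt.1 bt.2 h).1 (hpos t ht)
        · rintro ⟨htN, rfl⟩
          change Function.update f.edge e γ e _ = _
          rw [hup]
          exact hsymm t htN }
    (fun t ht => by
      change LinearIndependent ℝ ![_, deriv (Function.update f.edge e γ e) (2 * t₀ - t)]
      have h0 : zigzag ((t - t₀) / ε) = 0 := zigzag_eq_zero.2 (Or.inr ht)
      have hz : ε * zigzag ((2 * t₀ - t - t₀) / ε) = 0 := by rw [hrefl, zigzag_neg, h0]; simp
      have hd := isLocalMove_kink.hasDerivAt_movedCurve (φ := f.edge e) (δ := δ) (t₀ := t₀) hε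
        (t := 2 * t₀ - t) (by rw [hz, add_zero]; exact f.differentiableAt_edge he ht₀)
        (hδsm.differentiable (by simp) _)
      have hbodd : deriv bump (-((t - t₀) / ε)) = -deriv bump ((t - t₀) / ε) := by
        have := deriv_comp_neg (f := bump) ((t - t₀) / ε)
        rw [show (fun x => bump (-x)) = bump from funext bump_neg] at this
        rw [this, neg_neg]
      have hzeven : deriv zigzag (-((t - t₀) / ε)) = deriv zigzag ((t - t₀) / ε) := by
        rw [deriv_zigzag, deriv_zigzag, bump_neg, hbodd]
        ring
      rw [hup, hd.deriv, hδ', hδ', hz, hrefl, hbodd, hzeven, h0, mul_zero]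
      refine linearIndependent_add_sub ?_ (deriv_zigzag_ne_zero_of_eq_half ht)
        (deriv_bump_ne_zero_of_eq_half ht)
      rw [add_zero]
      exact hn) Λ hΛ
  refine ⟨g, ?_⟩
  have himg : γ '' N = {γ (t₀ + ε * τ)} := by
    have h1 : t₀ + ε * τ ∈ N := by rw [hN, hNeq]; simp
    rw [hN, hNeq, image_insert_eq, image_singleton, ← hsymm _ h1]
    rw [show 2 * t₀ - (t₀ + ε * τ) = t₀ - ε * τ by ring]
    simp
  rw [himg] at hg
  simpa using hg

end GenericImmersion

namespace GenericImmersion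
variable {α β : Type*} {G : Graph α β} {d e : β}

/-- Replacing a crossing of two edges by three crossings. -/
theorem exists_swerve (hV : G.vertexSet.Finite) (hE : G.edgeSet.Finite) (f : GenericImmersion G)
    (hd : d ∈ G.edgeSet) (he : e ∈ G.edgeSet) (hde : d ≠ e) {s₀ t₀ : ℝ} (hs₀ : s₀ ∈ Ioo (0 : ℝ) 1)
    (ht₀ : t₀ ∈ Ioo (0 : ℝ) 1) (hst : f.edge d s₀ = f.edge e t₀)
    (Λ : Finset (Graph α β)) (hΛ : ∀ H ∈ Λ, H ≤ G) :
    ∃ g : GenericImmersion G, ∑ H ∈ Λ, f.crossingNumber H + 2 * countContaining Λ d e =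
      ∑ H ∈ Λ, g.crossingNumber H := by
  classical
  set a := min s₀ (1 - s₀) with ha
  have ha0 : 0 < a := lt_min hs₀.1 (by linarith [hs₀.2])
  have hin : ∀ x ∈ Ioo (-a) a, s₀ + x ∈ Ioo (0 : ℝ) 1 := fun x hx => by
    have h1 : a ≤ s₀ := min_le_left _ _
    have h2 : a ≤ 1 - s₀ := min_le_right _ _
    exact ⟨by linarith [hx.1], by linarith [hx.2]⟩
  set δ : ℝ → Plane := fun x => f.edge d (s₀ + x) - f.edge d s₀ with hδ
  have hδsm : ContDiffOn ℝ ∞ δ (Ioo (-a) a) :=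
    ((f.smooth d hd).comp (contDiff_const.add contDiff_id).contDiffOn
      fun x hx => Ioo_subset_Icc_self (hin x hx)).sub contDiffOn_const
  have hδ' : ∀ x, deriv δ x = deriv (f.edge d) (s₀ + x) := fun x => by
    rw [hδ, deriv_sub_const, deriv_comp_const_add]
  have hδ0 : δ 0 = 0 := by simp [hδ]
  obtain ⟨ρ, ⟨hρ, hρa⟩, ε, ⟨hε, hερ⟩, hρ0, hρ1, hinj, hLI, hnear⟩ := f.exists_good_chart hV hE he ht₀
    ha0 hδsm hδ0 (by
      rw [hδ', add_zero]
      exact f.transversal e he d hd t₀ ht₀ s₀ hs₀ (fun h => hde (congrArg Prod.fst h).symm) hst.symm)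
  -- There is no third branch through the crossing, so in the chart the graph is contained in the
  -- two axes, `e` on x = 0 and `d` on y = 0.
  have hchart : ∀ p ∈ pointSet G, ∀ x y, |x| ≤ ε → |y| ≤ ε →
      pointMap f.vert f.edge p = f.edge e (t₀ + y) + δ x →
        (x = 0 ∧ p = Sum.inr (e, t₀ + y)) ∨ (y = 0 ∧ p = Sum.inr (d, s₀ + x)) := by
    intro p hp x y hx hy hpxy
    obtain ⟨c, hc, s, hs, rfl, t, ht, hst', hct⟩ := hnear p hp x y hx hy hpxy
    have hρ' : |(0 : ℝ)| < ρ := by simpa using hρ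
    have h1 := f.double (Sum.inr (e, t₀)) (inr_mem_pointSet.2 ⟨he, ht₀⟩) (Sum.inr (d, s₀))
      (inr_mem_pointSet.2 ⟨hd, hs₀⟩) (Sum.inr (c, t)) (inr_mem_pointSet.2 ⟨hc, ht⟩) hst.symm
      (hst.trans hct.symm)
    rcases h1 with h1 | h1 | h1
    · exact absurd (congrArg Prod.fst (Sum.inr_injective h1)).symm hde
    · obtain ⟨rfl, rfl⟩ := Prod.mk.injEq _ _ _ _ ▸ Sum.inr_injective h1
      have h2 : f.edge e (t₀ + y) + δ x = f.edge e (t₀ + 0) + δ (s - s₀) := by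
        rw [add_zero, ← hst, hδ]
        simp only [add_sub_cancel]
        exact hpxy.symm
      have h3 := hinj _ _ _ _ (hx.trans_lt hερ) (hy.trans_lt hερ) hst' hρ' h2
      refine Or.inr ⟨h3.2, ?_⟩
      rw [h3.1, add_sub_cancel]
    · obtain ⟨rfl, rfl⟩ := Prod.mk.injEq _ _ _ _ ▸ Sum.inr_injective h1
      have h2 : f.edge e (t₀ + y) + δ x = f.edge e (t₀ + (s - t₀)) + δ 0 := by
        rw [hδ0, add_zero, add_sub_cancel]
        exact hpxy.symm
      have h3 := hinj _ _ _ _ (hx.trans_lt hερ) (hy.trans_lt hερ) hρ' hst' h2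
      refine Or.inl ⟨h3.1, ?_⟩
      rw [h3.2, add_sub_cancel]
  obtain ⟨τ, hτ, hbτ⟩ := exists_bump_eq_half
  set X : ℝ → ℝ := fun x => x * bump x with hX
  have hmove : IsLocalMove X zigzag := isLocalMove_swerve
  set O := Ioo (t₀ - ε) (t₀ + ε) with hO
  have ht₀O : t₀ ∈ O := ⟨by linarith, by linarith⟩
  set γ := movedCurve (f.edge e) δ X zigzag t₀ ε with hγ
  set N : Set ℝ := {t₀, t₀ + ε * τ, t₀ - ε * τ} with hN
  have hNz : ∀ t, t ∈ N ↔ zigzag ((t - t₀) / ε) = 0 := by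
    intro t
    rw [zigzag_eq_zero, hN, mem_insert_iff, ← setOf_bump_eq_half (t₀ := t₀) hε hbτ, mem_ofPred_eq,
      div_eq_zero_iff, or_iff_left hε.ne', sub_eq_zero]
  have hNO : N ⊆ O := fun t ht => (abs_div_lt_one_iff hε).1 (by
    rcases zigzag_eq_zero.1 ((hNz t).1 ht) with h | h
    · rw [h, abs_zero]; exact one_pos
    · exact abs_lt_one_of_bump_eq_half h)
  have hO01 : O ⊆ Ioo 0 1 := Ioo_subset_Ioo (by linarith) (by linarith)
  have hγinj : InjOn γ O := by
    intro s hs t ht h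
    have bs := hmove.box hε hs
    have bt := hmove.box hε ht
    obtain ⟨h1, h2⟩ := hinj _ _ _ _ (bs.1.trans_lt hερ) (bs.2.trans_lt hερ) (bt.1.trans_lt hερ)
      (bt.2.trans_lt hερ) h
    have h1 : (s - t₀) / ε * bump ((s - t₀) / ε) = (t - t₀) / ε * bump ((t - t₀) / ε) :=
      mul_left_cancel₀ hε.ne' h1
    have h2 := mul_left_cancel₀ hε.ne' h2
    rw [zigzag, zigzag] at h2
    have h3 : (s - t₀) / ε = (t - t₀) / ε := by linear_combination h2 + 2 * h1
    have := (div_left_inj' hε.ne').1 h3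
    linarith
  have hX0 : ∀ t ∈ O, ε * X ((t - t₀) / ε) = 0 → t = t₀ := by
    intro t ht h
    have h1 := (mul_eq_zero.1 h).resolve_left hε.ne'
    have h2 := (mul_eq_zero.1 h1).resolve_right
      (bump_eq_zero.not.2 (not_le.2 ((abs_div_lt_one_iff hε).2 ht)))
    exact sub_eq_zero.1 ((div_eq_zero_iff.1 h2).resolve_right hε.ne')
  have hup : Function.update f.edge e γ e = γ := Function.update_self _ _ _
  have hupd : Function.update f.edge e γ d = f.edge d := Function.update_of_ne hde _ _
  have hfst : ∀ t, s₀ + ε * X ((t - t₀) / ε) ∈ Ioo (0 : ℝ) 1 := fun t =>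
    hin _ (hmove.fst_mem hε (hερ.trans_le hρa) t)
  have hzero : ∀ t ∈ N, ε * zigzag ((t - t₀) / ε) = 0 := fun t ht => by rw [(hNz t).1 ht, mul_zero]
  obtain ⟨g, hg⟩ := f.exists_localMove (d := d) he hmove
    (hδsm.mono (Ioo_subset_Ioo (by linarith) hρa)) hδ0 hLI hε hερ
    hρ0 hρ1 (N := {t₀}) (N' := N) (finite_singleton _) (toFinite _) (σ := fun _ => s₀)
    (σ' := fun t => s₀ + ε * X ((t - t₀) / ε))
    { subset := singleton_subset_iff.2 ht₀O
      mem := fun t ht => ⟨hs₀, fun h => hde (congrArg Prod.fst h)⟩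
      iff := fun t ht p hp hne => by
        constructor
        · intro h
          have := hchart p hp 0 (t - t₀) (by simpa using hε.le) (abs_le.2 ⟨by linarith [ht.1],
            by linarith [ht.2]⟩) (by rw [hδ0, add_zero, add_sub_cancel]; exact h)
          rw [add_sub_cancel, add_zero] at this
          rcases this with h1 | h1
          · exact absurd h1.2 hne
          · exact ⟨sub_eq_zero.1 h1.1, h1.2⟩
        · rintro ⟨rfl, rfl⟩
          exact hst }
    { subset := hNO
      mem := fun t ht => ⟨hfst t, fun h => hde (congrArg Prod.fst h)⟩
      iff := fun t ht p hp hne => by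
        change _ = Function.update f.edge e γ e t ↔ _
        rw [hup]
        have bt := hmove.box hε ht
        constructor
        · intro h
          by_cases hpO : ∃ s ∈ O, p = Sum.inr (e, s)
          · obtain ⟨s, hs, rfl⟩ := hpO
            change Function.update f.edge e γ e s = _ at h
            rw [hup] at h
            exact absurd (by rw [hγinj hs ht h]) hne
          · have hpf : pointMap f.vert (Function.update f.edge e γ) p = pointMap f.vert f.edge p := by
              rcases p with v | ⟨c, s⟩
              · rfl
              · change Function.update f.edge e γ c s = f.edge c s
                by_cases hc : c = e
                · subst hc
                  rw [hup]
                  exact hmove.movedCurve_off hδ0 hε fun hs => hpO ⟨s, hs, rfl⟩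
                · rw [Function.update_of_ne hc]
            rw [hpf] at h
            rcases hchart p hp _ _ bt.1 bt.2 h with h1 | h1
            -- Meeting the old edge `e` would require X = 0, hence t = t₀, a parameter that was
            -- replaced.
            · have ht0 := hX0 t ht h1.1
              subst ht0
              refine absurd ⟨_, ht₀O, h1.2.trans ?_⟩ hpO
              simp [zigzag]
            · exact ⟨(hNz t).2 ((mul_eq_zero.1 h1.1).resolve_left hε.ne'), h1.2⟩
        · rintro ⟨htN, rfl⟩
          change Function.update f.edge e γ d _ = _
          rw [hupd, hγ, movedCurve, hzero t htN, add_zero, ← hst, hδ]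
          simp }
    (fun t ht => by
      change LinearIndependent ℝ ![_, deriv (Function.update f.edge e γ d) _]
      rw [hupd, ← hδ']
      have bt := hmove.box hε (hNO ht)
      refine linearIndependent_add_right (hLI _ _ (bt.1.trans_lt hερ) (bt.2.trans_lt hερ)) ?_ _
      rcases zigzag_eq_zero.1 ((hNz t).1 ht) with h | h
      · rw [h, deriv_zigzag, bump_zero]
        norm_num
      · exact deriv_zigzag_ne_zero_of_eq_half h) Λ hΛ
  refine ⟨g, ?_⟩
  have hετ : 0 < ε * τ := mul_pos hε hτ.1
  have hcard : (γ '' N).ncard = 3 := by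
    rw [(hγinj.mono hNO).ncard_image, hN, ncard_eq_three]
    exact ⟨_, _, _, by linarith, by linarith, by linarith, rfl⟩
  rw [hcard] at hg
  simp only [image_singleton, ncard_singleton, one_mul] at hg
  linarith

end GenericImmersion

/-! ### Interchanging two edge ends at a vertex -/

theorem leftDir_mul_exp (x y : ℝ) : leftDir x * Complex.exp (y * Complex.I) = leftDir (x + y) := by
  rw [leftDir, leftDir, neg_mul, ← Complex.exp_add]
  push_cast
  ring_nf

theorem leftDir_ne_zero (x : ℝ) : leftDir x ≠ 0 := fun h => by
  have := norm_leftDir x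
  rw [h, norm_zero] at this
  norm_num at this

/-- A curve rotated about `P`, with an angle that depends on the parameter. -/
noncomputable def twistedCurve (P : ℂ) (c : ℝ → ℂ) (ε t : ℝ) : ℂ :=
  P + (c t - P) * Complex.exp ((bump (t / ε) / 2 : ℝ) * Complex.I)

section twistedCurve
variable {P : ℂ} {c : ℝ → ℂ} {ε t : ℝ}

theorem contDiff_twistedCurve (hc : ContDiff ℝ ∞ c) : ContDiff ℝ ∞ (twistedCurve P c ε) := by
  have h1 : ContDiff ℝ ∞ fun t : ℝ => ((bump (t / ε) / 2 : ℝ) : ℂ) :=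
    Complex.ofRealCLM.contDiff.comp ((contDiff_bump.comp (contDiff_id.div_const ε)).div_const 2)
  exact contDiff_const.add ((hc.sub contDiff_const).mul (h1.mul contDiff_const).cexp)

theorem hasDerivAt_twistedCurve (hc : ContDiff ℝ ∞ c) : HasDerivAt (twistedCurve P c ε)
    ((deriv c t + (c t - P) * ((deriv bump (t / ε) / ε / 2 : ℝ) * Complex.I)) *
      Complex.exp ((bump (t / ε) / 2 : ℝ) * Complex.I)) t := by
  have h1 : HasDerivAt c (deriv c t) t := (hc.differentiable (by simp) t).hasDerivAt
  have h2 : HasDerivAt (fun t => bump (t / ε) / 2) (deriv bump (t / ε) / ε / 2) t := by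
    have h3 : HasDerivAt (fun t => t / ε) (1 / ε) t := (hasDerivAt_id t).div_const ε
    have h4 : HasDerivAt (fun t => bump (t / ε)) (deriv bump (t / ε) * (1 / ε)) t :=
      HasDerivAt.comp (h₂ := bump) t (bump_hasDerivAt (t / ε)) h3
    rw [mul_one_div] at h4
    exact h4.div_const 2
  have h3 := (h1.sub_const P).fun_mul (h2.ofReal_comp.mul_const Complex.I).cexp
  have h4 : HasDerivAt (twistedCurve P c ε) _ t := h3.const_add P
  convert h4 using 1
  ring

theorem twistedCurve_of_ge (hε : 0 < ε) (ht : ε ≤ t) : twistedCurve P c ε t = c t := by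
  have : bump (t / ε) = 0 := bump_eq_zero.2 (by
    rw [abs_of_nonneg (div_nonneg (hε.le.trans ht) hε.le)]
    exact (one_le_div hε).2 ht)
  rw [twistedCurve, this]
  simp

theorem deriv_twistedCurve_of_ge (hc : ContDiff ℝ ∞ c) (hε : 0 < ε) (ht : ε ≤ t) :
    deriv (twistedCurve P c ε) t = deriv c t := by
  have h1 : 1 ≤ |t / ε| := by
    rw [abs_of_nonneg (div_nonneg (hε.le.trans ht) hε.le)]
    exact (one_le_div hε).2 ht
  rw [(hasDerivAt_twistedCurve hc).deriv, bump_eq_zero.2 h1, deriv_bump_eq_zero h1]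
  simp

end twistedCurve

namespace StarDrawing
variable {α β : Type*} {G : Graph α β} {src tgt : β → α} {pos : α → ℂ} {ang : β → Bool → ℝ}
  {c : β → ℝ → ℂ}

/-- Near a vertex, there are only the rays. -/
theorem exists_rays_near (D : StarDrawing G src tgt pos (fun e b => leftDir (ang e b)) c)
    (hV : G.vertexSet.Finite) (hE : G.edgeSet.Finite) (hang : ∀ e b, |ang e b| < 1) {v : α}
    (hv : v ∈ G.vertexSet) :
    ∃ ε ∈ Ioc (0 : ℝ) (1 / 4), ∀ p ∈ pointSet G, ∀ t ∈ Ioo 0 ε, ∀ θ : ℝ, |θ| < 1 →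
      pointMap (D.toGenericImmersion hE).vert (D.toGenericImmersion hE).edge p =
        toC.symm (pos v + t * leftDir θ) →
      ∃ e ∈ G.edgeSet, ∃ b : Bool, p = Sum.inr (e, if b then 1 - t else t) ∧ θ = ang e b := by
  set f := D.toGenericImmersion hE with hf
  -- Parameters within 1/4 of an end belong to the straight parts.
  obtain ⟨r, hr, hiso⟩ := f.exists_isolating hV hE (f.vert v) (show (0 : ℝ) < 1 / 4 by norm_num)
  refine ⟨min (1 / 4) r, ⟨by positivity, min_le_left _ _⟩, ?_⟩
  intro p hp t ht θ hθ hpt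
  have ht4 : t < 1 / 4 := ht.2.trans_le (min_le_left _ _)
  have hfv : f.vert v = toC.symm (pos v) := rfl
  have hnorm : ∀ (r x : ℝ), 0 ≤ r → ‖(r : ℂ) * leftDir x‖ = r := fun r x hr => by
    rw [norm_mul, norm_leftDir, mul_one, Complex.norm_real, Real.norm_of_nonneg hr]
  have hd : dist (pointMap f.vert f.edge p) (f.vert v) < r := by
    rw [hpt, hfv, toC.symm.dist_map, dist_eq_norm, add_sub_cancel_left, hnorm _ _ ht.1.le]
    exact ht.2.trans_le (min_le_right _ _)
  rcases hiso p hp hd with ⟨u, hu, rfl, huv⟩ | ⟨e, he, s, hs, rfl, t', ht', hst, htv⟩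
  · have h1 : toC.symm (pos v) = toC.symm (pos v + t * leftDir θ) := by
      rw [← hfv, ← huv]
      exact hpt
    have h2 := toC.symm.injective h1
    rw [left_eq_add] at h2
    have h3 := hnorm t θ ht.1.le
    rw [h2, norm_zero] at h3
    exact absurd h3 ht.1.ne
  · obtain ⟨h01, -⟩ := f.edge_eq_vert he hv ht' htv
    have hsm : s ∉ Ioo (1 / 4 : ℝ) (3 / 4) := by
      rintro ⟨h1, h2⟩
      rw [abs_lt] at hst
      rcases h01 with rfl | rfl <;> linarith
    obtain ⟨b, ρ, hρ, u, hu, hsρ, -, hce⟩ := D.exists_ray he (Ioo_subset_Icc_self hs) hsm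
    have h1 : c e s = pos v + t * leftDir θ := toC.symm.injective hpt
    rw [hce] at h1
    have huv : u = v := by
      by_contra hne
      have h2 := D.sep u hu v hv hne
      rw [show pos u - pos v = t * leftDir θ - ρ * leftDir (ang e b) by linear_combination h1] at h2
      have h3 := norm_sub_le ((t : ℂ) * leftDir θ) (ρ * leftDir (ang e b))
      rw [hnorm _ _ ht.1.le, hnorm _ _ hρ.1] at h3
      linarith [hρ.2]
    subst huv
    have h2 : (ρ : ℂ) * leftDir (ang e b) = t * leftDir θ := add_left_cancel h1
    have h3 : ρ = t := by
      have := congrArg norm h2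
      rwa [hnorm _ _ hρ.1, hnorm _ _ ht.1.le] at this
    subst h3
    have h4 := mul_left_cancel₀ (by exact_mod_cast ht.1.ne') h2
    exact ⟨e, he, b, by rw [hsρ], (leftDir_injOn (hang e b) hθ h4).symm⟩

/-- Interchanging two neighbouring edge ends at a vertex. -/
theorem exists_twist (D : StarDrawing G src tgt pos (fun e b => leftDir (ang e b)) c)
    (hV : G.vertexSet.Finite) (hE : G.edgeSet.Finite) (hang : ∀ e b, |ang e b| < 1) {d e : β}
    (hd : d ∈ G.edgeSet) (he : e ∈ G.edgeSet) (hde : d ≠ e) (hsrc : src d = src e)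
    (hae : ang e false = -(3 / 4)) (had : ang d false = -(1 / 2))
    (hpos : ∀ f b, (f, b) ≠ (e, false) → (f, b) ≠ (d, false) → 0 < ang f b)
    (Λ : Finset (Graph α β)) (hΛ : ∀ H ∈ Λ, H ≤ G) :
    ∃ g : GenericImmersion G,
      ∑ H ∈ Λ, (D.toGenericImmersion hE).crossingNumber H + countContaining Λ d e =
        ∑ H ∈ Λ, g.crossingNumber H := by
  classical
  obtain ⟨ε, ⟨hε, hε4⟩, hnear⟩ := D.exists_rays_near hV hE hang (D.link e he).left_mem
  set f := D.toGenericImmersion hE with hf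
  set P := pos (src e) with hP
  set γ := twistedCurve P (c e) ε with hγ
  have hfe : ∀ x t, f.edge x t = toC.symm (c x t) := fun _ _ => rfl
  have hce : ∀ t ∈ Icc (0 : ℝ) (1 / 4), c e t = P + t * leftDir (-(3 / 4)) := fun t ht => by
    rw [D.start e he t ht, hae]
  have hcd : ∀ t ∈ Icc (0 : ℝ) (1 / 4), c d t = P + t * leftDir (-(1 / 2)) := fun t ht => by
    rw [D.start d hd t ht, had, hsrc]
  -- The new end of `e` leaves at angle -1/4 and turns back to -3/4, passing the angle -1/2 of `d`
  -- once, where the bump is 1/2. All other ends have positive angles and are not met.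
  have hγt : ∀ t ∈ Icc (0 : ℝ) (1 / 4), γ t = P + t * leftDir (-(3 / 4) + bump (t / ε) / 2) := by
    intro t ht
    rw [hγ, twistedCurve, hce t ht, add_sub_cancel_left, mul_assoc, leftDir_mul_exp]
  have hO4 : ∀ t ∈ Ioo 0 ε, t ∈ Icc (0 : ℝ) (1 / 4) := fun t ht => ⟨ht.1.le, by linarith [ht.2]⟩
  have hO01 : Ioo 0 ε ⊆ Ioo (0 : ℝ) 1 := Ioo_subset_Ioo le_rfl (by linarith)
  have hdiv : ∀ t ∈ Ioo 0 ε, t / ε ∈ Ioo (0 : ℝ) 1 := fun t ht =>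
    ⟨div_pos ht.1 hε, (div_lt_one hε).2 ht.2⟩
  have hbpos : ∀ t ∈ Ioo 0 ε, 0 < bump (t / ε) := fun t ht =>
    lt_of_le_of_ne (bump_nonneg _) fun h => by
      have h1 := bump_eq_zero.1 h.symm
      rw [abs_of_pos (hdiv t ht).1] at h1
      exact absurd (hdiv t ht).2 (not_lt.2 h1)
  have hc := D.smooth e
  have hnorm : ∀ (r x : ℝ), 0 ≤ r → ‖(r : ℂ) * leftDir x‖ = r := fun r x hr => by
    rw [norm_mul, norm_leftDir, mul_one, Complex.norm_real, Real.norm_of_nonneg hr]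
  have hγsm : ContDiff ℝ ∞ γ := contDiff_twistedCurve hc
  have hderiv4 : ∀ t ∈ Icc (0 : ℝ) (1 / 4), deriv γ t = leftDir (-(3 / 4) + bump (t / ε) / 2) *
      (1 + (t * (deriv bump (t / ε) / ε / 2) : ℝ) * Complex.I) := by
    intro t ht
    rw [hγ, (hasDerivAt_twistedCurve hc).deriv, D.deriv_start he ht, hce t ht, hae,
      ← leftDir_mul_exp]
    push_cast
    ring
  set δ : ℝ → Plane := fun t => toC.symm (γ t) with hδ
  have hδsm : ContDiff ℝ ∞ δ := toC.symm.toContinuousLinearEquiv.contDiff.comp hγsm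
  have hδ' : ∀ t, deriv δ t = toC.symm (deriv γ t) := fun t =>
    deriv_symm_comp (hγsm.differentiable (by simp) t)
  have hfe' : ∀ x t, deriv (f.edge x) t = toC.symm (deriv (c x) t) := fun x t =>
    deriv_symm_comp ((D.smooth x).differentiable (by simp) t)
  have hup : Function.update f.edge e δ e = δ := Function.update_self _ _ _
  have hupd : Function.update f.edge e δ d = f.edge d := Function.update_of_ne hde _ _
  have hoff : ∀ t ∈ Icc (0 : ℝ) 1, t ∉ Ioo 0 ε → δ t = f.edge e t := by
    intro t ht htO
    rw [hfe]
    change toC.symm (γ t) = _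
    rcases ht.1.eq_or_lt with rfl | h0
    · rw [hγt 0 (by norm_num), hce 0 (by norm_num)]
      simp
    · rw [hγ, twistedCurve_of_ge hε (not_lt.1 fun h => htO ⟨h0, h⟩)]
  have hne : ∀ b, (e, b) ≠ (d, false) := fun b h => hde (congrArg Prod.fst h).symm
  obtain ⟨τ, hτ, hbτ⟩ := exists_bump_eq_half
  -- The parameter is the distance from the vertex on both branches, since rotation preserves it; so
  -- the crossing has the same parameter on `d` and σ' is the identity.
  obtain ⟨g, hg⟩ := f.exists_surgery (d := d) he hO01 (N := ∅) (N' := {ε * τ}) finite_empty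
    (σ := id) (σ' := id) (γ := δ)
    { subset := empty_subset _
      mem := fun t ht => absurd ht (notMem_empty t)
      iff := fun t ht p hp hpe => by
        refine ⟨fun h => absurd ?_ hpe, fun h => absurd h.1 (notMem_empty t)⟩
        rw [hfe, hce t (hO4 t ht)] at h
        obtain ⟨x, -, b, rfl, hb⟩ := hnear p hp t ht _ (by rw [abs_neg]; norm_num) h
        by_cases h1 : (x, b) = (e, false)
        · obtain ⟨rfl, rfl⟩ := Prod.mk.injEq _ _ _ _ ▸ h1
          simp
        by_cases h2 : (x, b) = (d, false)
        · obtain ⟨rfl, rfl⟩ := Prod.mk.injEq _ _ _ _ ▸ h2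
          rw [had] at hb
          norm_num at hb
        · have := hpos x b h1 h2
          linarith }
    hδsm.contDiffOn
    (fun t ht => by
      rw [(hδsm.differentiable (by simp) t).derivWithin (uniqueDiffOn_Icc zero_lt_one t ht), hδ', Ne,
        map_eq_zero_iff _ toC.symm.injective]
      rcases le_total t (1 / 4) with h4 | h4
      · rw [hderiv4 t ⟨ht.1, h4⟩]
        refine mul_ne_zero (leftDir_ne_zero _) fun h => ?_
        have := congrArg Complex.re h
        rw [Complex.add_re, Complex.re_ofReal_mul] at this
        simp at this
      · rw [hγ, deriv_twistedCurve_of_ge hc hε (hε4.trans h4)]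
        exact D.deriv_ne_zero he ht)
    hoff
    (fun t ht htO => by
      rw [hδ', hfe', hγ, deriv_twistedCurve_of_ge hc hε (not_lt.1 fun h => htO ⟨ht.1, h⟩)])
    (finite_singleton _)
    { subset := by
        rintro t rfl
        exact ⟨mul_pos hε hτ.1, mul_lt_of_lt_one_right hε hτ.2⟩
      mem := by
        rintro t rfl
        exact ⟨hO01 ⟨mul_pos hε hτ.1, mul_lt_of_lt_one_right hε hτ.2⟩,
          fun h => hde (congrArg Prod.fst h)⟩
      iff := fun t ht p hp hpe => by
        rw [hup]
        change _ = toC.symm (γ t) ↔ _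
        rw [hγt t (hO4 t ht)]
        have hb0 := hbpos t ht
        have hb1 := bump_le_one (t / ε)
        have hiff : t ∈ ({ε * τ} : Set ℝ) ↔ bump (t / ε) = 1 / 2 := by
          rw [mem_singleton_iff, ← hbτ]
          constructor
          · rintro rfl
            rw [mul_div_cancel_left₀ _ hε.ne']
          · intro h
            have := strictAntiOn_bump.injOn (Ioo_subset_Icc_self (hdiv t ht))
              (Ioo_subset_Icc_self hτ) h
            rw [div_eq_iff hε.ne'] at this
            linarith
        constructor
        · intro h
          by_cases hpO : ∃ s ∈ Ioo 0 ε, p = Sum.inr (e, s)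
          · obtain ⟨s, hs, rfl⟩ := hpO
            change Function.update f.edge e δ e s = _ at h
            rw [hup] at h
            change toC.symm (γ s) = _ at h
            have h1 := toC.symm.injective h
            rw [hγt s (hO4 s hs)] at h1
            have h2 := congrArg norm (add_left_cancel h1)
            rw [hnorm _ _ hs.1.le, hnorm _ _ ht.1.le] at h2
            exact absurd (by rw [h2]) hpe
          · have hpf : pointMap f.vert (Function.update f.edge e δ) p = pointMap f.vert f.edge p := by
              rcases p with v | ⟨x, s⟩
              · rfl
              · change Function.update f.edge e δ x s = f.edge x s
                by_cases hx : x = e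
                · subst hx
                  rw [hup]
                  exact hoff s (Ioo_subset_Icc_self (GenericImmersion.inr_mem_pointSet.1 hp).2)
                    fun hs => hpO ⟨s, hs, rfl⟩
                · rw [Function.update_of_ne hx]
            rw [hpf] at h
            obtain ⟨x, -, b, rfl, hb⟩ := hnear p hp t ht _
              (abs_lt.2 ⟨by linarith, by linarith⟩) h
            by_cases h1 : (x, b) = (e, false)
            · obtain ⟨rfl, rfl⟩ := Prod.mk.injEq _ _ _ _ ▸ h1
              exact absurd (by simp) hpe
            by_cases h2 : (x, b) = (d, false)
            · obtain ⟨rfl, rfl⟩ := Prod.mk.injEq _ _ _ _ ▸ h2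
              rw [had] at hb
              exact ⟨hiff.2 (by linarith), by simp⟩
            · have := hpos x b h1 h2
              linarith
        · rintro ⟨htN, rfl⟩
          change Function.update f.edge e δ d t = _
          rw [hupd, hfe, hcd t (hO4 t ht), hiff.1 htN]
          norm_num }
    (by
      rintro t rfl
      have ht : ε * τ ∈ Ioo 0 ε := ⟨mul_pos hε hτ.1, mul_lt_of_lt_one_right hε hτ.2⟩
      rw [hupd, hδ', hfe']
      refine (linearIndependent_pair_map (toC.symm.toLinearEquiv : ℂ →ₗ[ℝ] Plane)
        toC.symm.injective).2 ?_
      rw [id, hderiv4 _ (hO4 _ ht), D.deriv_start hd (hO4 _ ht), mul_div_cancel_left₀ _ hε.ne', hbτ,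
        had, show -(3 / 4 : ℝ) + 1 / 2 / 2 = -(1 / 2) by norm_num]
      rw [LinearIndependent.pair_iff]
      intro x y hxy
      set z : ℝ := ε * τ * (deriv bump τ / ε / 2) with hz
      -- The angle of `e` moves with nonzero speed when it passes `d`, which is transversality.
      have hz0 : z ≠ 0 := mul_ne_zero ht.1.ne' (div_ne_zero (div_ne_zero
        (deriv_bump_neg hτ).ne hε.ne') two_ne_zero)
      have h1 : leftDir (-(1 / 2)) * (((x + y : ℝ) : ℂ) + ((x * z : ℝ) : ℂ) * Complex.I) = 0 := by
        rw [← hxy, Complex.real_smul, Complex.real_smul]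
        push_cast
        ring
      have h2 := (mul_eq_zero.1 h1).resolve_left (leftDir_ne_zero _)
      have h3 := congrArg Complex.re h2
      have h4 := congrArg Complex.im h2
      simp at h3 h4
      rcases h4 with h4 | h4
      · exact ⟨h4, by linarith⟩
      · exact absurd h4 hz0)
    Λ hΛ
  refine ⟨g, ?_⟩
  simpa using hg

end StarDrawing

/-! ### Forcing a crossing between two given edges -/

theorem smoothTransition_surj {y : ℝ} (hy : y ∈ Ioo (0 : ℝ) 1) :
    ∃ t ∈ Ioo (3 / 8 : ℝ) (5 / 8), Real.smoothTransition (4 * t - 3 / 2) = y := by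
  have hc : Continuous fun t : ℝ => Real.smoothTransition (4 * t - 3 / 2) :=
    Real.smoothTransition.continuous.comp (by fun_prop)
  have h0 : Real.smoothTransition (4 * (3 / 8) - 3 / 2) = 0 :=
    Real.smoothTransition.zero_of_nonpos (by norm_num)
  have h1 : Real.smoothTransition (4 * (5 / 8) - 3 / 2) = 1 :=
    Real.smoothTransition.one_of_one_le (by norm_num)
  exact intermediate_value_Ioo (by norm_num) hc.continuousOn (by rwa [h0, h1])

/-- An edge that winds around the starting vertex of another edge crosses this edge. -/
theorem StarDrawing.exists_crossing {α β : Type*} {G : Graph α β} {src tgt : β → α} {pos : α → ℂ}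
    {ang : β → Bool → ℝ} {c : β → ℝ → ℂ}
    (D : StarDrawing G src tgt pos (fun e b => leftDir (ang e b)) c) {d e : β}
    (hd : d ∈ G.edgeSet) (hang : |ang d false| < 1) (hpos : pos (src d) = 0) {p q A B : ℂ}
    (hclose : ∀ t ∈ Icc (0 : ℝ) 1, ‖c e t - windingCurve p q A B 1 t‖ < 1 / 64) :
    ∃ s ∈ Ioo (0 : ℝ) 1, ∃ t ∈ Ioo (0 : ℝ) 1, c d s = c e t := by
  set M := leftDir (ang d false) with hM
  have hMre : M.re ≤ -(1 / 2) := by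
    rw [hM, leftDir_re]
    have h1 := Real.one_sub_sq_div_two_le_cos (x := ang d false)
    have h2 : ang d false ^ 2 ≤ 1 := by
      rw [sq_le_one_iff_abs_le_one]
      exact hang.le
    linarith
  have hMn : ‖M‖ = 1 := norm_leftDir _
  have hMM : starRingEnd ℂ M * M = 1 := by
    rw [mul_comm, Complex.mul_conj, Complex.normSq_eq_norm_sq, hMn]
    norm_num
  -- At a quarter and three quarters of the turn the unperturbed curve is at i/8 and -i/8, and in
  -- between in the left half plane, into which the ray of `d` points.
  obtain ⟨t₁, ht₁, h₁⟩ := smoothTransition_surj (y := 1 / 4) (by norm_num)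
  obtain ⟨t₂, ht₂, h₂⟩ := smoothTransition_surj (y := 3 / 4) (by norm_num)
  have hmono : Monotone fun t : ℝ => Real.smoothTransition (4 * t - 3 / 2) := fun x y hxy =>
    Real.smoothTransition.monotone (by linarith)
  have h12 : t₁ ≤ t₂ := (hmono.reflect_lt (by simp only [h₁, h₂]; norm_num)).le
  have hI : ∀ t ∈ Icc t₁ t₂, t ∈ Icc (3 / 8 : ℝ) (5 / 8) := fun t ht =>
    ⟨ht₁.1.le.trans ht.1, ht.2.trans ht₂.2.le⟩
  have hI' : ∀ t ∈ Icc t₁ t₂, t ∈ Icc (0 : ℝ) 1 := fun t ht =>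
    ⟨by linarith [(hI t ht).1], by linarith [(hI t ht).2]⟩
  set E := windingCurve p q A B 1 with hE
  have hEt : ∀ t ∈ Icc t₁ t₂, E t = 1 / 8 *
      Complex.exp ((Real.smoothTransition (4 * t - 3 / 2) * (2 * Real.pi) : ℝ) * Complex.I) := by
    intro t ht
    rw [hE, windingCurve_of_mem (hI t ht)]
    push_cast
    ring_nf
  have hdiff : ∀ t ∈ Icc t₁ t₂,
      |(c e t * starRingEnd ℂ M).im - (E t * starRingEnd ℂ M).im| < 1 / 64 := by
    intro t ht
    rw [← Complex.sub_im, ← sub_mul]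
    refine (Complex.abs_im_le_norm _).trans_lt ?_
    rw [norm_mul, Complex.norm_conj, hMn, mul_one]
    exact hclose t (hI' t ht)
  have hval₁ : (c e t₁ * starRingEnd ℂ M).im ≤ 0 := by
    have h3 := (abs_lt.1 (hdiff t₁ ⟨le_rfl, h12⟩)).2
    have h4 : E t₁ = ((1 / 8 : ℝ) : ℂ) * Complex.I := by
      rw [hEt t₁ ⟨le_rfl, h12⟩, h₁, show (1 / 4 * (2 * Real.pi) : ℝ) = Real.pi / 2 by ring]
      push_cast
      rw [Complex.exp_pi_div_two_mul_I]
    rw [h4, mul_assoc, Complex.im_ofReal_mul, Complex.I_mul_im, Complex.conj_re] at h3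
    linarith
  have hval₂ : 0 ≤ (c e t₂ * starRingEnd ℂ M).im := by
    have h3 := (abs_lt.1 (hdiff t₂ ⟨h12, le_rfl⟩)).1
    have h4 : E t₂ = ((-(1 / 8) : ℝ) : ℂ) * Complex.I := by
      rw [hEt t₂ ⟨h12, le_rfl⟩, h₂, show (3 / 4 * (2 * Real.pi) : ℝ) = Real.pi + Real.pi / 2 by ring]
      push_cast
      rw [add_mul, Complex.exp_add, Complex.exp_pi_div_two_mul_I, Complex.exp_pi_mul_I]
      ring
    rw [h4, mul_assoc, Complex.im_ofReal_mul, Complex.I_mul_im, Complex.conj_re] at h3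
    linarith
  have hcont : Continuous fun t => (c e t * starRingEnd ℂ M).im :=
    Complex.continuous_im.comp ((D.smooth e).continuous.mul continuous_const)
  -- The function vanishes exactly on the line through the origin with direction M; its sign change
  -- survives an error of 1/64, since its unperturbed values have modulus at least 1/16.
  obtain ⟨t, ht, h0⟩ := intermediate_value_Icc h12 hcont.continuousOn ⟨hval₁, hval₂⟩
  set r := (c e t * starRingEnd ℂ M).re with hr
  have hreal : c e t * starRingEnd ℂ M = (r : ℂ) := Complex.ext rfl (by simpa using h0)
  have hct : c e t = r * M := by
    rw [← hreal, mul_assoc, hMM, mul_one]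
  have hEn : ‖E t‖ = 1 / 8 := norm_windingCurve_of_mem (hI t ht)
  have hcn : |r| = ‖c e t‖ := by rw [hct, norm_mul, hMn, mul_one, Complex.norm_real, Real.norm_eq_abs]
  have hcl := hclose t (hI' t ht)
  have hle := (abs_le.1 (abs_norm_sub_norm_le (c e t) (E t)))
  rw [hEn, ← hcn] at hle
  -- The opposite half line lies in the right half plane: a point on it of norm at least 1/8 - 1/64
  -- has real part more than 1/64, too far from the unperturbed curve.
  have hrpos : 0 < r := by
    by_contra hneg
    have habs := abs_of_nonpos (not_lt.1 hneg)
    have h3 : (E t).re ≤ 0 := by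
      have hs₁ : 1 / 4 ≤ Real.smoothTransition (4 * t - 3 / 2) := h₁ ▸ hmono ht.1
      have hs₂ : Real.smoothTransition (4 * t - 3 / 2) ≤ 3 / 4 := h₂ ▸ hmono ht.2
      have hpi := Real.pi_pos
      rw [hEt t ht, show (1 / 8 : ℂ) = ((1 / 8 : ℝ) : ℂ) by push_cast; rfl, Complex.re_ofReal_mul,
        Complex.exp_ofReal_mul_I_re]
      exact mul_nonpos_of_nonneg_of_nonpos (by norm_num)
        (Real.cos_nonpos_of_pi_div_two_le_of_le (by nlinarith) (by nlinarith))
    have h4 := (abs_le.1 ((Complex.abs_re_le_norm (c e t - E t)).trans hcl.le)).2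
    rw [Complex.sub_re, hct, Complex.re_ofReal_mul] at h4
    nlinarith [hle.1, hle.2]
  rw [abs_of_pos hrpos] at hle
  refine ⟨r, ⟨hrpos, by linarith [hle.2]⟩, t, ⟨by linarith [(hI t ht).1], by linarith [(hI t ht).2]⟩, ?_⟩
  rw [D.start d hd r ⟨hrpos.le, by linarith [hle.2]⟩, hpos, zero_add, hct]

/-! ### Necessity of the conditions on edges -/

section Necessity
variable {α β : Type*} {G : Graph α β} {Λ : Finset (Graph α β)} {m : ℕ} {d e : β}

theorem dvd_of_add_modEq {a b c : ℕ} (h : a + c = b) (hab : a ≡ b [MOD m]) : m ∣ c := by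
  rw [← h] at hab
  exact (Nat.modEq_zero_iff_dvd).1 (Nat.ModEq.add_left_cancel' a hab.symm)

theorem dvd_countContaining_self (hV : G.vertexSet.Finite) (hE : G.edgeSet.Finite)
    (hΛ : ∀ H ∈ Λ, H ≤ G) (hA : ∀ f g : GenericImmersion G,
      ∑ H ∈ Λ, f.crossingNumber H ≡ ∑ H ∈ Λ, g.crossingNumber H [MOD m])
    (he : e ∈ G.edgeSet) : m ∣ countContaining Λ e e := by
  obtain ⟨v, -⟩ := (G.edge_mem_iff_exists_isLink e).1 he
  obtain ⟨pos, -, -, sep⟩ := exists_pos hV v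
  obtain ⟨src, tgt, link, -⟩ := exists_orientation G v
  obtain ⟨ang, hang, hinj⟩ := exists_angles hE
  have hang' : ∀ f b, |ang f b| < 1 := fun f b => by
    rw [abs_of_pos (hang f b).1]
    exact (hang f b).2
  obtain ⟨c, -, D, -⟩ := exists_starDrawing_pair (dir := fun f b => leftDir (ang f b))
    hV hE link sep (fun _ _ _ => norm_leftDir _)
    (fun d hd f hf a b h => hinj d hd f hf a b (leftDir_injOn (hang' _ _) (hang' _ _) h))
    (fun _ => 0) (fun _ => 0) one_pos
  obtain ⟨g, hg⟩ := (D.toGenericImmersion hE).exists_kink hV hE he Λ hΛ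
  exact dvd_of_add_modEq hg (hA _ _)

/-- A crossing of `d` and `e` is needed to start from. An end of `d` is placed at the origin and
every edge winds around it, so `e` must cross the first ray of `d`. -/
theorem dvd_two_mul_countContaining (hV : G.vertexSet.Finite) (hE : G.edgeSet.Finite)
    (hΛ : ∀ H ∈ Λ, H ≤ G) (hA : ∀ f g : GenericImmersion G,
      ∑ H ∈ Λ, f.crossingNumber H ≡ ∑ H ∈ Λ, g.crossingNumber H [MOD m])
    (hd : d ∈ G.edgeSet) (he : e ∈ G.edgeSet) (hde : d ≠ e) : m ∣ 2 * countContaining Λ d e := by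
  obtain ⟨v, w, hvw⟩ := (G.edge_mem_iff_exists_isLink d).1 hd
  obtain ⟨pos, hposv, -, sep⟩ := exists_pos hV v
  obtain ⟨src, tgt, link, hsrc⟩ := exists_orientation G v
  obtain ⟨ang, hang, hinj⟩ := exists_angles hE
  have hang' : ∀ f b, |ang f b| < 1 := fun f b => by
    rw [abs_of_pos (hang f b).1]
    exact (hang f b).2
  obtain ⟨c, -, D, -, -, hclose, -⟩ := exists_starDrawing_pair
    (dir := fun f b => leftDir (ang f b)) hV hE link sep (fun _ _ _ => norm_leftDir _)
    (fun d hd f hf a b h => hinj d hd f hf a b (leftDir_injOn (hang' _ _) (hang' _ _) h))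
    (fun _ => 1) (fun _ => 1) (show (0 : ℝ) < 1 / 64 by norm_num)
  obtain ⟨s, hs, t, ht, hst⟩ := D.exists_crossing hd (hang' d false)
    (by rw [hsrc d hvw.inc_left, hposv]) (hclose e)
  obtain ⟨g, hg⟩ := (D.toGenericImmersion hE).exists_swerve hV hE hd he hde hs ht
    (congrArg toC.symm hst) Λ hΛ
  exact dvd_of_add_modEq hg (hA _ _)

theorem dvd_countContaining_of_adjacent (hV : G.vertexSet.Finite) (hE : G.edgeSet.Finite)
    (hΛ : ∀ H ∈ Λ, H ≤ G) (hA : ∀ f g : GenericImmersion G,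
      ∑ H ∈ Λ, f.crossingNumber H ≡ ∑ H ∈ Λ, g.crossingNumber H [MOD m])
    (hd : d ∈ G.edgeSet) (he : e ∈ G.edgeSet) (hde : AdjacentEdges G d e) :
    m ∣ countContaining Λ d e := by
  obtain ⟨hne, v, hdv, hev⟩ := hde
  obtain ⟨pos, -, -, sep⟩ := exists_pos hV v
  obtain ⟨src, tgt, link, hsrc⟩ := exists_orientation G v
  obtain ⟨ang, hang, hae, had, hpos, hinj⟩ := exists_angles_of_ne hE hne
  obtain ⟨c, -, D, -⟩ := exists_starDrawing_pair (dir := fun f b => leftDir (ang f b))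
    hV hE link sep (fun _ _ _ => norm_leftDir _)
    (fun d hd f hf a b h => hinj d hd f hf a b (leftDir_injOn (hang _ _) (hang _ _) h))
    (fun _ => 0) (fun _ => 0) one_pos
  obtain ⟨g, hg⟩ := D.exists_twist hV hE hang hd he hne ((hsrc d hdv).trans (hsrc e hev).symm)
    hae had hpos Λ hΛ
  exact dvd_of_add_modEq hg (hA _ _)

/-- Every term is divisible: an edge at `v` is `e` itself or adjacent to `e`, and the other edges
have no ends at `v`. -/
theorem dvd_sum_endsAt_of_inc (hE : G.edgeSet.Finite)
    (h1 : ∀ e ∈ G.edgeSet, m ∣ countContaining Λ e e)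
    (h4 : ∀ d ∈ G.edgeSet, ∀ e ∈ G.edgeSet, AdjacentEdges G d e → m ∣ countContaining Λ d e)
    (he : e ∈ G.edgeSet) {v : α} (hev : G.Inc e v) :
    m ∣ ∑ e' ∈ hE.toFinset, endsAt G v e' * countContaining Λ e e' := by
  refine Finset.dvd_sum fun e' he' => ?_
  have he' := hE.mem_toFinset.1 he'
  by_cases hee : e = e'
  · subst hee
    exact (h1 e he).mul_left _
  by_cases hinc : G.Inc e' v
  · exact (h4 e he e' he' ⟨hee, v, hev, hinc⟩).mul_left _
  · have hloop : ¬ G.IsLoopAt e' v := fun h => hinc h.inc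
    rw [endsAt, if_neg hloop, if_neg hinc, zero_mul]
    exact dvd_zero m

end Necessity

end PlaneGraph

theorem proposition2p2 {α β : Type*} (G : Graph α β)
    (hV : G.vertexSet.Finite) (hE : G.edgeSet.Finite)
    (Λ : Finset (Graph α β)) (hΛ : ∀ H ∈ Λ, H ≤ G) (m : ℕ) (hm : 0 < m) :
    (∀ f g : PlaneGraph.GenericImmersion G,
      (∑ H ∈ Λ, f.crossingNumber H) ≡ (∑ H ∈ Λ, g.crossingNumber H) [MOD m]) ↔
    ((∀ e ∈ G.edgeSet, m ∣ {H : Graph α β | H ∈ Λ ∧ e ∈ H.edgeSet}.ncard) ∧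
      (∀ d ∈ G.edgeSet, ∀ e ∈ G.edgeSet, d ≠ e → m ∣ 2 * PlaneGraph.countContaining Λ d e) ∧
      (∀ v ∈ G.vertexSet, ∀ e ∈ G.edgeSet,
        m ∣ ∑ e' ∈ hE.toFinset, PlaneGraph.endsAt G v e' * PlaneGraph.countContaining Λ e e') ∧
      (∀ d ∈ G.edgeSet, ∀ e ∈ G.edgeSet, PlaneGraph.AdjacentEdges G d e →
        m ∣ PlaneGraph.countContaining Λ d e)) := by
  have hcount : ∀ e : β, {H : Graph α β | H ∈ Λ ∧ e ∈ H.edgeSet}.ncard =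
      PlaneGraph.countContaining Λ e e := fun e => by
    simp [PlaneGraph.countContaining]
  simp only [hcount]
  constructor
  · intro hA
    have h1 : ∀ e ∈ G.edgeSet, m ∣ PlaneGraph.countContaining Λ e e := fun e he =>
      PlaneGraph.dvd_countContaining_self hV hE hΛ hA he
    have h2 : ∀ d ∈ G.edgeSet, ∀ e ∈ G.edgeSet, d ≠ e → m ∣ 2 * PlaneGraph.countContaining Λ d e :=
      fun d hd e he hde => PlaneGraph.dvd_two_mul_countContaining hV hE hΛ hA hd he hde
    have h4 : ∀ d ∈ G.edgeSet, ∀ e ∈ G.edgeSet, PlaneGraph.AdjacentEdges G d e →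
        m ∣ PlaneGraph.countContaining Λ d e :=
      fun d hd e he hde => PlaneGraph.dvd_countContaining_of_adjacent hV hE hΛ hA hd he hde
    refine ⟨h1, h2, fun v hv e he => ?_, h4⟩
    by_cases hev : G.Inc e v
    · exact PlaneGraph.dvd_sum_endsAt_of_inc hE h1 h4 he hev
    · exact PlaneGraph.dvd_sum_endsAt_of_not_inc hV hE Λ hΛ m hA h1 h2 h4 hv he hev
  · rintro ⟨h1, h2, h3, h4⟩ f g
    exact PlaneGraph.GenericImmersion.sum_crossingNumber_modEq hV hE Λ hΛ m h1 h2 h3 h4 f g
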